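/- Let $N\ge 1$, let $d\mu(x)=(2\pi)^{-N/2}e^{-|x|^2/2}\,dx$ on $\mathbb R^N$, and let $L^2_\mu=L^2(\mathbb R^N,d\mu;\mathbb C)$. Let $(L,D(L))$ be the Ornstein–Uhlenbeck operator, i.e. the closure in $L^2_\mu$ of $Lf=\Delta f-x\cdot\nabla f$, $f\in C_c^\infty(\mathbb R^N)$, and let $(A,D(A))$ be the bi-Ornstein–Uhlenbeck operator, i.e. the operator in $L^2_\mu$ associated with the form $a_L(u,v)=\int Lu\,\overline{Lv}\,d\mu$, $u,v\in D(L)$. Let $H^4_\mu$ be the space of $u\in L^2_\mu$ whose weak derivatives of order at most $4$ all lie in $L^2_\mu$. Then $$D(A)=H^4_\mu(\mathbb R^N),\qquad Af=\Delta^2f-2x\cdot\nabla(\Delta f)+\mathrm{Tr}(x\otimes x\,D^2f)-2\Delta f+x\cdot\nabla f\quad (f\in D(A)).$$ Moreover $-A$ generates a $C_0$-semigroup $(e^{-tA})_{t\ge0}$ on $L^2_\mu$, and it is given by a real kernel $k$: for $t>0$ and $f\in L^2_\mu$, $$e^{-tA}f(x)=\int_{\mathbb R^N}k(t,x,y)f(y)\,dy\quad\text{for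 a.e. }x,$$ the integral converging absolutely for every $x\in\mathbb R^N$. The kernel is given as follows. For $z\in\mathbb C$ with $\Re z\ge0$, $z\notin i\pi\mathbb Z$, let $$p(z,x,y)=\bigl(2\pi(1-e^{-2z})\bigr)^{-N/2}\exp\Bigl(-\frac{(e^{-z}x-y)\cdot(e^{-z}x-y)}{2(1-e^{-2z})}\Bigr)$$ be the analytically continued Mehler kernel (principal power, bilinear product $a\cdot b=\sum_i a_ib_i$), and for $\theta\in\mathbb R\setminus\pi\mathbb Z$ let $$c(\theta,x,y)=|\sin\theta|^{-N/2}\,e^{\frac{|x|^2-|y|^2}{4}}\cos\Bigl(\tfrac N2\bigl(\theta-\pi\lfloor\theta/\pi\rfloor-\tfrac\pi2\bigr)+\frac{(|x|^2+|y|^2)\cos\theta-2\,x\cdot y}{4\sin\theta}\Bigr).$$ Then $p(i\theta,x,y)+p(-i\theta,x,y)=2(4\pi)^{-N/2}c(\theta,x,y)$, and, as oscillatory integrals, $$k(t,x,y)=(4\pi t)^{-\frac12}\int_0^\infty e^{-\frac{s^2}{4t}}\bigl(p(is,x,y)+p(-is,x,y)\bigr)\,ds=2(4\pi)^{-\frac{N+1}{2}}\int_0^\infty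 e^{-\frac{s^2}{4}}\,c(s\sqrt t,x,y)\,ds .$$ This means the following, for all $t>0$. 1. For all $x,y\in\mathbb R^N$, $$k(t,x,y)=\lim_{\varepsilon\to0^+}(4\pi t)^{-\frac12}\int_0^\infty e^{-\frac{s^2}{4t}}\bigl(p(\varepsilon+is,x,y)+p(\varepsilon-is,x,y)\bigr)\,ds,$$ where the integrals converge absolutely. 2. For all $x\in\mathbb R^N$ and $\varphi\in C_c^\infty(\mathbb R^N)$, $$\int k(t,x,y)\varphi(y)\,dy=(4\pi t)^{-\frac12}\int_0^\infty e^{-\frac{s^2}{4t}}\Bigl(\int\bigl(p(is,x,y)+p(-is,x,y)\bigr)\varphi(y)\,dy\Bigr)ds=2(4\pi)^{-\frac{N+1}{2}}\int_0^\infty e^{-\frac{s^2}{4}}\Bigl(\int c(s\sqrt t,x,y)\varphi(y)\,dy\Bigr)ds,$$ where the integrals over $s$ converge absolutely. 3. If $N=1$, both integrals for $k(t,x,y)$ converge absolutely and both formulas hold literally, for all $x,y\in\mathbb R$. -/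

import Mathlib

open MeasureTheory Filter Topology Set
open scoped ContDiff

noncomputable section

/-- Euclidean space `ℝ^N`. -/
abbrev RN (N : ℕ) : Type := EuclideanSpace ℝ (Fin N)

/-- The Gaussian probability measure with density `(2π)^(-N/2) exp(-|x|²/2)`. -/
def gaussMeasure (N : ℕ) : Measure (RN N) :=
  (volume : Measure (RN N)).withDensity fun x =>
    ENNReal.ofReal ((2 * Real.pi) ^ (-(N : ℝ) / 2) * Real.exp (-‖x‖ ^ 2 / 2))

/-- The complex Hilbert space `L²_μ(ℝ^N)`. -/
abbrev L2mu (N : ℕ) : Type := Lp ℂ 2 (gaussMeasure N)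

/-- The class `C_c^∞(ℝ^N)` of complex valued test functions. -/
def IsTest {N : ℕ} (φ : RN N → ℂ) : Prop := ContDiff ℝ ∞ φ ∧ HasCompactSupport φ

/-- The differential expression `Lφ = Δφ - x · ∇φ` on smooth functions. -/
def ouExpr {N : ℕ} (φ : RN N → ℂ) (x : RN N) : ℂ :=
  Laplacian.laplacian φ x - fderiv ℝ φ x x

/-- The closure in `L²_μ × L²_μ` of the graph of `L` on `C_c^∞`. -/
def ouGraph (N : ℕ) : Submodule ℂ (L2mu N × L2mu N) :=
  (Submodule.span ℂ {p : L2mu N × L2mu N | ∃ φ : RN N → ℂ, IsTest φ ∧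
    p.1 =ᵐ[gaussMeasure N] φ ∧ p.2 =ᵐ[gaussMeasure N] ouExpr φ}).topologicalClosure

/-- The Ornstein-Uhlenbeck operator `(L, D(L))`: the closure of `(L, C_c^∞)` in `L²_μ`. -/
def ouOp (N : ℕ) : L2mu N →ₗ.[ℂ] L2mu N := (ouGraph N).toLinearPMap

/-- The graph of the operator associated with the form `a_L(u, v) = ∫ Lu \overline{Lv} dμ`,
`D(a_L) = D(L)`: pairs `(u, f)` with `u ∈ D(L)` and `a_L(u, v) = ∫ f \overline{v} dμ` for all
`v ∈ D(L)`. (The inner product of Mathlib is conjugate-linear in its first argument.) -/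
def biOUGraph (N : ℕ) : Submodule ℂ (L2mu N × L2mu N) where
  carrier := {p | ∃ u : (ouOp N).domain, (u : L2mu N) = p.1 ∧
    ∀ v : (ouOp N).domain, inner ℂ (ouOp N v) (ouOp N u) = inner ℂ (v : L2mu N) p.2}
  add_mem' := by
    rintro p q ⟨u, hu, hp⟩ ⟨w, hw, hq⟩
    refine ⟨u + w, by simp [hu, hw], fun v => ?_⟩
    rw [LinearPMap.map_add, inner_add_right, hp v, hq v, Prod.snd_add, inner_add_right]
  zero_mem' := ⟨0, by simp, fun v => by simp⟩
  smul_mem' := by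
    rintro c p ⟨u, hu, hp⟩
    refine ⟨c • u, by simp [hu], fun v => ?_⟩
    rw [LinearPMap.map_smul, inner_smul_right, hp v, Prod.smul_snd, inner_smul_right]

/-- The bi-Ornstein-Uhlenbeck operator `(A, D(A))`, associated with the form `a_L`. -/
def biOU (N : ℕ) : L2mu N →ₗ.[ℂ] L2mu N := (biOUGraph N).toLinearPMap

/-- `v` is the weak partial derivative `∂_i u` on `ℝ^N`. -/
def HasWeakPartial {N : ℕ} (i : Fin N) (u v : RN N → ℂ) : Prop :=
  LocallyIntegrable u ∧ LocallyIntegrable v ∧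
    ∀ φ : RN N → ℂ, IsTest φ →
      ∫ x, u x * fderiv ℝ φ x (EuclideanSpace.single i 1) = -∫ x, v x * φ x

/-- `u ∈ H^m_μ(ℝ^N)`: all weak derivatives of `u` of order at most `m` are in `L²_μ`. -/
def MemSobolev {N : ℕ} : ℕ → (RN N → ℂ) → Prop
  | 0, u => MemLp u 2 (gaussMeasure N)
  | m + 1, u => MemLp u 2 (gaussMeasure N) ∧
      ∀ i : Fin N, ∃ v, HasWeakPartial i u v ∧ MemSobolev m v

open scoped Classical in
/-- The weak partial derivative `∂_i u` (unique up to null sets where it exists). -/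
def wD {N : ℕ} (i : Fin N) (u : RN N → ℂ) : RN N → ℂ :=
  if h : ∃ v, HasWeakPartial i u v then h.choose else 0

/-- The weak Laplacian. -/
def wLap {N : ℕ} (u : RN N → ℂ) : RN N → ℂ := fun x => ∑ i, wD i (wD i u) x

/-- `Δ²u - 2 x·∇(Δu) + Tr(x ⊗ x D²u) - 2 Δu + x·∇u`, with weak derivatives. -/
def biOUExpr {N : ℕ} (u : RN N → ℂ) (x : RN N) : ℂ :=
  wLap (wLap u) x
    - 2 * ∑ i, (x i : ℂ) * wD i (wLap u) x
    + ∑ i, ∑ j, (x i : ℂ) * (x j : ℂ) * wD i (wD j u) x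
    - 2 * wLap u x
    + ∑ i, (x i : ℂ) * wD i u x

/-- `T` (considered for `t ≥ 0`) is a `C_0`-semigroup. -/
structure IsC0Semigroup {H : Type*} [NormedAddCommGroup H] [NormedSpace ℂ H]
    (T : ℝ → H →L[ℂ] H) : Prop where
  zero : T 0 = ContinuousLinearMap.id ℂ H
  add : ∀ s t : ℝ, 0 ≤ s → 0 ≤ t → T (s + t) = (T s).comp (T t)
  cont : ∀ u : H, Tendsto (fun t => T t u) (𝓝[>] 0) (𝓝 u)

/-- `B` is the generator of the `C_0`-semigroup `T`: `u ∈ D(B)` and `Bu = v` iff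
`(T(h)u - u)/h → v` as `h → 0+`. -/
def IsGeneratorOf {H : Type*} [NormedAddCommGroup H] [NormedSpace ℂ H]
    (B : H →ₗ.[ℂ] H) (T : ℝ → H →L[ℂ] H) : Prop :=
  IsC0Semigroup T ∧ ∀ u v : H,
    (∃ hu : u ∈ B.domain, B ⟨u, hu⟩ = v) ↔
      Tendsto (fun h : ℝ => ((h⁻¹ : ℝ) : ℂ) • (T h u - u)) (𝓝[>] 0) (𝓝 v)

/-- The Mehler kernel
`p(z,x,y) = (2π(1 - e^{-2z}))^{-N/2} exp(-(e^{-z}x - y)·(e^{-z}x - y) / (2(1 - e^{-2z})))`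
for complex time `z`, with the bilinear product on `ℂ^N` and the principal power. It is holomorphic
in `Re z > 0` and continuous on `Re z ≥ 0`, `z ∉ iπℤ`, where `Re (1 - e^{-2z}) > 0`. -/
def mehler {N : ℕ} (z : ℂ) (x y : RN N) : ℂ :=
  (2 * Real.pi * (1 - Complex.exp (-2 * z))) ^ (-(N : ℂ) / 2) *
    Complex.exp (-(∑ i, (Complex.exp (-z) * (x i : ℂ) - (y i : ℂ)) ^ 2) /
      (2 * (1 - Complex.exp (-2 * z))))

/-- The oscillating factor of the cosine integral, for `θ ∉ πℤ`. The branch `θ - π⌊θ/π⌋` of the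
angle, which is `θ` for `0 < θ < π`, gives the continuation of `(sin θ)^(-N/2)` across the zeros of
the sine. -/
def oscCos {N : ℕ} (θ : ℝ) (x y : RN N) : ℝ :=
  |Real.sin θ| ^ (-(N : ℝ) / 2) * Real.exp ((‖x‖ ^ 2 - ‖y‖ ^ 2) / 4) *
    Real.cos ((N : ℝ) / 2 * (θ - Real.pi * (⌊θ / Real.pi⌋ : ℝ) - Real.pi / 2) +
      ((‖x‖ ^ 2 + ‖y‖ ^ 2) * Real.cos θ - 2 * inner ℝ x y) / (4 * Real.sin θ))

end

noncomputable section

/-! ### The Gaussian density -/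

/-! The normalized Hermite functions `hermL α` form an orthonormal basis of L²_μ in which all
operators are diagonal. On them ∂_i lowers the index and its adjoint x_i - ∂_i raises it, so L = -∑
(x_i - ∂_i)∂_i multiplies by -|α|. The closure of L on C_c^∞ is exactly this diagonal operator
(`mem_ouGraph_iff`): cutoffs put each Hermite function into the closed graph, and integration by
parts excludes anything else. Hence A is multiplication by |α|² (`mem_biOUGraph_iff`).

Weak differentiation is a weighted shift of the coefficients (`hasWeakPartial_iff_hc`), so H^m_μ is
the ℓ² space with weight (|α|+1)^m (`memSobolev_iff`), and m = 4 gives the domain of A. Since A =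
L², its expression comes from applying L to Lu = Δu - x·∇u (`ae_eq_biOUExpr`).

The semigroup multiplies by e^{-t|α|²}, and every C_0-semigroup generated by -A must do so
(`HilbertBasis.repr_semigroup`). With γ the Gaussian density, its kernel is k = ∑ e^{-t|α|²} h_α(x)
h_α(y) γ(y). Two facts turn this series into the integral: the Gaussian Fourier transform e^{-tn²} =
(4πt)^{-1/2} ∫_0^∞ e^{-s²/4t} (e^{-isn} + e^{isn}) ds (`integral_gaussian_time`), and Mehler's
formula ∑ r^{|α|} h_α(x) h_α(y) γ(y) = p(z,x,y) with r = e^{-z}, |r| < 1 (`hasSum_mehlerR`). Sum and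
integral commute when Re z = ε > 0, and ε → 0 is an Abel limit.

At ε = 0 the series over α has no absolute convergence to rely on, and p is singular like |sin
s|^{-N/2}. Test functions restore summability, because their Hermite coefficients decay rapidly
while h_α(x) grows at most polynomially in |α| (`tested_formula`). For N = 1 the singularity is
integrable, and a bound uniform in ε (`norm_mehlerR_mul_le`) permits dominated convergence
(`pointwise_formula`). -/

/-- The density of `gaussMeasure N`. -/
def gw {N : ℕ} (x : RN N) : ℝ := (2 * Real.pi) ^ (-(N : ℝ) / 2) * Real.exp (-‖x‖ ^ 2 / 2)

lemma gw_pos {N : ℕ} (x : RN N) : 0 < gw x := by unfold gw; positivity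

lemma gw_ne_zero {N : ℕ} (x : RN N) : (gw x : ℂ) ≠ 0 := by exact_mod_cast (gw_pos x).ne'

lemma contDiff_gw {N : ℕ} : ContDiff ℝ ∞ (gw : RN N → ℝ) := by
  unfold gw
  exact contDiff_const.mul (((contDiff_norm_sq ℝ).neg.div_const 2).exp)

lemma continuous_gw {N : ℕ} : Continuous (gw : RN N → ℝ) := contDiff_gw.continuous

lemma measurable_ofReal_gw {N : ℕ} : Measurable fun x : RN N => ENNReal.ofReal (gw x) :=
  continuous_gw.measurable.ennreal_ofReal

lemma gaussMeasure_eq (N : ℕ) :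
    gaussMeasure N = (volume : Measure (RN N)).withDensity fun x => ENNReal.ofReal (gw x) := rfl

lemma ae_gauss (N : ℕ) : ae (gaussMeasure N) = ae (volume : Measure (RN N)) := by
  apply le_antisymm
  · exact (withDensity_absolutelyContinuous _ _).ae_le
  · refine (withDensity_absolutelyContinuous' measurable_ofReal_gw.aemeasurable
      (Eventually.of_forall fun x => ?_)).ae_le
    simpa using gw_pos x

lemma integral_gauss {N : ℕ} (f : RN N → ℂ) :
    ∫ x, f x ∂gaussMeasure N = ∫ x, (gw x : ℂ) * f x := by
  rw [gaussMeasure_eq, integral_withDensity_eq_integral_toReal_smul measurable_ofReal_gw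
    (Eventually.of_forall fun x => by simp)]
  refine integral_congr_ae (Eventually.of_forall fun x => ?_)
  simp [ENNReal.toReal_ofReal (gw_pos x).le]

lemma integrable_gauss_iff {N : ℕ} {f : RN N → ℂ} :
    Integrable f (gaussMeasure N) ↔ Integrable fun x => (gw x : ℂ) * f x := by
  rw [gaussMeasure_eq, integrable_withDensity_iff_integrable_smul' measurable_ofReal_gw
    (Eventually.of_forall fun x => by simp)]
  refine integrable_congr (Eventually.of_forall fun x => ?_)
  simp [ENNReal.toReal_ofReal (gw_pos x).le]

/-- Half of the Gaussian exponent is kept as an integrable majorant; the other half absorbs factors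
of exponential growth. -/
lemma integrable_exp_neg_quarter (N : ℕ) :
    Integrable fun x : RN N => Real.exp (-(1 / 4) * ‖x‖ ^ 2) := by
  have h := (GaussianFourier.integrable_cexp_neg_mul_sq_norm_add (V := RN N) (b := 1 / 4)
    (by norm_num) 0 0).norm
  refine h.congr (Eventually.of_forall fun x => ?_)
  simp [Complex.norm_exp]
  norm_cast

lemma integral_gw (N : ℕ) : ∫ x : RN N, gw x = 1 := by
  unfold gw
  rw [integral_const_mul]
  have h := GaussianFourier.integral_rexp_neg_mul_sq_norm (V := RN N) (b := 1 / 2) (by norm_num)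
  have h2 : ∀ x : RN N, -‖x‖ ^ 2 / 2 = -(1 / 2) * ‖x‖ ^ 2 := fun x => by ring
  simp_rw [h2, h]
  rw [finrank_euclideanSpace_fin, neg_div, Real.rpow_neg (by positivity)]
  rw [show Real.pi / (1 / 2) = 2 * Real.pi by ring]
  exact inv_mul_cancel₀ (by positivity)

/-! ### Exponentially bounded functions -/

/-- Continuous functions of at most exponential growth. -/
def ExpBdd {N : ℕ} (f : RN N → ℂ) : Prop :=
  Continuous f ∧ ∃ C a : ℝ, ∀ x, ‖f x‖ ≤ C * Real.exp (a * ‖x‖)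

namespace ExpBdd
variable {N : ℕ} {f g : RN N → ℂ}

lemma exists_pos (hf : ExpBdd f) :
    ∃ C a : ℝ, 0 < C ∧ 0 < a ∧ ∀ x, ‖f x‖ ≤ C * Real.exp (a * ‖x‖) := by
  obtain ⟨C, a, h⟩ := hf.2
  refine ⟨|C| + 1, |a| + 1, by positivity, by positivity, fun x => (h x).trans ?_⟩
  have h1 : C ≤ |C| + 1 := by linarith [le_abs_self C]
  have h2 : a * ‖x‖ ≤ (|a| + 1) * ‖x‖ :=
    mul_le_mul_of_nonneg_right (by linarith [le_abs_self a]) (norm_nonneg _)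
  gcongr

lemma add (hf : ExpBdd f) (hg : ExpBdd g) : ExpBdd fun x => f x + g x := by
  obtain ⟨C, a, hC, ha, h⟩ := hf.exists_pos
  obtain ⟨D, b, hD, hb, h'⟩ := hg.exists_pos
  refine ⟨hf.1.add hg.1, C + D, a + b, fun x => (norm_add_le _ _).trans ?_⟩
  have hx := norm_nonneg x
  have h1 : Real.exp (a * ‖x‖) ≤ Real.exp ((a + b) * ‖x‖) := Real.exp_le_exp.2 (by nlinarith)
  have h2 : Real.exp (b * ‖x‖) ≤ Real.exp ((a + b) * ‖x‖) := Real.exp_le_exp.2 (by nlinarith)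
  have h3 := mul_le_mul_of_nonneg_left h1 hC.le
  have h4 := mul_le_mul_of_nonneg_left h2 hD.le
  linarith [h x, h' x]

lemma mul (hf : ExpBdd f) (hg : ExpBdd g) : ExpBdd fun x => f x * g x := by
  obtain ⟨C, a, hC, ha, h⟩ := hf.exists_pos
  obtain ⟨D, b, hD, hb, h'⟩ := hg.exists_pos
  refine ⟨hf.1.mul hg.1, C * D, a + b, fun x => ?_⟩
  rw [norm_mul, add_mul, Real.exp_add]
  calc _ ≤ (C * Real.exp (a * ‖x‖)) * (D * Real.exp (b * ‖x‖)) :=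
        mul_le_mul (h x) (h' x) (norm_nonneg _) (by positivity)
    _ = _ := by ring

lemma const (c : ℂ) : ExpBdd fun _ : RN N => c :=
  ⟨continuous_const, ‖c‖, 0, fun x => by simp⟩

lemma neg (hf : ExpBdd f) : ExpBdd fun x => -f x := by
  simpa using (const (-1)).mul hf

lemma sub (hf : ExpBdd f) (hg : ExpBdd g) : ExpBdd fun x => f x - g x := by
  simpa [sub_eq_add_neg] using hf.add hg.neg

lemma conj (hf : ExpBdd f) : ExpBdd fun x => starRingEnd ℂ (f x) :=
  ⟨Complex.continuous_conj.comp hf.1, by simpa using hf.2⟩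

lemma coord (i : Fin N) : ExpBdd fun x : RN N => (x i : ℂ) := by
  refine ⟨by fun_prop, 1, 1, fun x => ?_⟩
  simp only [Complex.norm_real, one_mul]
  exact (PiLp.norm_apply_le x i).trans (by linarith [Real.add_one_le_exp ‖x‖])

lemma sum {ι : Type*} (s : Finset ι) {F : ι → RN N → ℂ} (h : ∀ i ∈ s, ExpBdd (F i)) :
    ExpBdd fun x => ∑ i ∈ s, F i x := by
  classical
  induction s using Finset.induction_on with
  | empty => simpa using const 0
  | insert a s ha ih =>
    simp_rw [Finset.sum_insert ha]
    exact (h a (by simp)).add (ih fun i hi => h i (by simp [hi]))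

lemma prod {ι : Type*} (s : Finset ι) {F : ι → RN N → ℂ} (h : ∀ i ∈ s, ExpBdd (F i)) :
    ExpBdd fun x => ∏ i ∈ s, F i x := by
  classical
  induction s using Finset.induction_on with
  | empty => simpa using const 1
  | insert a s ha ih =>
    simp_rw [Finset.prod_insert ha]
    exact (h a (by simp)).mul (ih fun i hi => h i (by simp [hi]))

lemma of_hasCompactSupport (hf : Continuous f) (h : HasCompactSupport f) : ExpBdd f := by
  obtain ⟨C, hC⟩ := h.exists_bound_of_continuous hf
  exact ⟨hf, C, 0, fun x => by simpa using hC x⟩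

lemma integrable_gw_mul (hf : ExpBdd f) : Integrable fun x => (gw x : ℂ) * f x := by
  obtain ⟨C, a, hC, ha, h⟩ := hf.exists_pos
  refine Integrable.mono' ((integrable_exp_neg_quarter N).const_mul
    ((2 * Real.pi) ^ (-(N : ℝ) / 2) * (C * Real.exp (a ^ 2)))) ?_ (Eventually.of_forall fun x => ?_)
  · exact ((Complex.continuous_ofReal.comp continuous_gw).mul hf.1).aestronglyMeasurable
  · rw [norm_mul, Complex.norm_real, Real.norm_of_nonneg (gw_pos x).le]
    refine (mul_le_mul_of_nonneg_left (h x) (gw_pos x).le).trans ?_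
    unfold gw
    have : Real.exp (-‖x‖ ^ 2 / 2) * Real.exp (a * ‖x‖) ≤
        Real.exp (a ^ 2) * Real.exp (-(1 / 4) * ‖x‖ ^ 2) := by
      rw [← Real.exp_add, ← Real.exp_add]
      -- Expanding (a - ‖x‖/2)² ≥ 0 gives a‖x‖ ≤ a² + ‖x‖²/4.
      exact Real.exp_le_exp.2 (by nlinarith [sq_nonneg (a - ‖x‖ / 2)])
    have h3 := mul_le_mul_of_nonneg_left this
      (show 0 ≤ (2 * Real.pi) ^ (-(N : ℝ) / 2) * C by positivity)
    calc _ = _ := ?_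
      _ ≤ _ := h3
      _ = _ := by ring
    ring

lemma integrable (hf : ExpBdd f) : Integrable f (gaussMeasure N) :=
  integrable_gauss_iff.2 hf.integrable_gw_mul

lemma memLp (hf : ExpBdd f) : MemLp f 2 (gaussMeasure N) := by
  rw [memLp_two_iff_integrable_sq_norm hf.1.aestronglyMeasurable]
  refine (hf.mul hf.conj).integrable.norm.congr (Eventually.of_forall fun x => ?_)
  simp [sq]

lemma integrable_mul (hf : ExpBdd f) {u : RN N → ℂ} (hu : MemLp u 2 (gaussMeasure N)) :
    Integrable (fun x => f x * u x) (gaussMeasure N) :=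
  hf.memLp.integrable_mul hu

end ExpBdd

instance (N : ℕ) : IsProbabilityMeasure (gaussMeasure N) := by
  constructor
  have h := integral_gw N
  rw [gaussMeasure_eq, withDensity_apply _ MeasurableSet.univ, Measure.restrict_univ,
    ← ofReal_integral_eq_lintegral_ofReal _ (Eventually.of_forall fun x => (gw_pos x).le), h]
  · simp
  -- A nonintegrable function has integral 0 by convention, so the value 1 already forces
  -- integrability.
  · by_contra hc
    rw [integral_undef hc] at h
    exact zero_ne_one h

/-! ### Partial derivatives and integration by parts -/

/-- The classical partial derivative. -/
def pd {N : ℕ} (i : Fin N) (f : RN N → ℂ) (x : RN N) : ℂ :=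
  fderiv ℝ f x (EuclideanSpace.single i 1)

section pd
variable {N : ℕ} {f g : RN N → ℂ}

lemma contDiff_pd (i : Fin N) (hf : ContDiff ℝ ∞ f) : ContDiff ℝ ∞ (pd i f) := by
  unfold pd
  exact (hf.fderiv_right (m := ∞) (by norm_cast)).clm_apply contDiff_const

lemma pd_mul (i : Fin N) {x : RN N} (hf : DifferentiableAt ℝ f x) (hg : DifferentiableAt ℝ g x) :
    pd i (fun y => f y * g y) x = pd i f x * g x + f x * pd i g x := by
  unfold pd
  rw [fderiv_fun_mul hf hg]
  simp
  ring

lemma pd_add (i : Fin N) {x : RN N} (hf : DifferentiableAt ℝ f x) (hg : DifferentiableAt ℝ g x) :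
    pd i (fun y => f y + g y) x = pd i f x + pd i g x := by
  unfold pd
  rw [fderiv_fun_add hf hg]; rfl

lemma pd_coord (i j : Fin N) (x : RN N) :
    pd i (fun y : RN N => (y j : ℂ)) x = if j = i then 1 else 0 := by
  have h : HasFDerivAt (fun y : RN N => (y j : ℂ))
      (Complex.ofRealCLM.comp (EuclideanSpace.proj j : RN N →L[ℝ] ℝ)) x :=
    (Complex.ofRealCLM.comp (EuclideanSpace.proj j : RN N →L[ℝ] ℝ)).hasFDerivAt
  unfold pd
  rw [h.fderiv]
  by_cases hij : j = i <;> simp [hij]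

lemma pd_comm (i j : Fin N) (hf : ContDiff ℝ ∞ f) (x : RN N) :
    pd i (pd j f) x = pd j (pd i f) x := by
  have hd : DifferentiableAt ℝ (fderiv ℝ f) x :=
    ((hf.fderiv_right (m := ∞) (by norm_cast)).differentiable (by simp)) x
  have key : ∀ a b : Fin N, pd a (pd b f) x =
      fderiv ℝ (fderiv ℝ f) x (EuclideanSpace.single a 1) (EuclideanSpace.single b 1) := by
    intro a b
    unfold pd
    rw [fderiv_clm_apply hd (differentiableAt_const _)]
    simp
  rw [key, key]
  have hs : IsSymmSndFDerivAt ℝ f x :=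
    hf.contDiffAt.isSymmSndFDerivAt (by simp [minSmoothness_of_isRCLikeNormedField]; norm_cast)
  exact hs _ _

lemma contDiff_coord (i : Fin N) : ContDiff ℝ ∞ fun x : RN N => (x i : ℂ) := by
  exact Complex.ofRealCLM.contDiff.comp (EuclideanSpace.proj i : RN N →L[ℝ] ℝ).contDiff

lemma fderiv_self_eq_sum (f : RN N → ℂ) (x : RN N) :
    fderiv ℝ f x x = ∑ i, (x i : ℂ) * pd i f x := by
  conv_lhs => rw [show fderiv ℝ f x x = fderiv ℝ f x (∑ i, x i • EuclideanSpace.single i 1) by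
    congr 1; ext j; simp [Pi.single_apply]]
  simp [pd]

lemma laplacian_eq_sum_pd (hf : ContDiff ℝ ∞ f) (x : RN N) :
    Laplacian.laplacian f x = ∑ i, pd i (pd i f) x := by
  have hd : DifferentiableAt ℝ (fderiv ℝ f) x :=
    ((hf.fderiv_right (m := ∞) (by norm_cast)).differentiable (by simp)) x
  rw [InnerProductSpace.laplacian_eq_iteratedFDeriv_orthonormalBasis f
    (EuclideanSpace.basisFun (Fin N) ℝ)]
  refine Finset.sum_congr rfl fun i _ => ?_
  rw [iteratedFDeriv_two_apply]
  unfold pd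
  rw [fderiv_clm_apply hd (differentiableAt_const _)]
  simp

lemma ouExpr_eq (hf : ContDiff ℝ ∞ f) (x : RN N) :
    ouExpr f x = ∑ i, (pd i (pd i f) x - (x i : ℂ) * pd i f x) := by
  rw [ouExpr, laplacian_eq_sum_pd hf, fderiv_self_eq_sum, Finset.sum_sub_distrib]

lemma pd_gw (i : Fin N) (x : RN N) :
    pd i (fun y : RN N => (gw y : ℂ)) x = -(x i : ℂ) * gw x := by
  have h1 : HasFDerivAt (fun y : RN N => ‖y‖ ^ 2) (2 • (innerSL ℝ x)) x := by
    simpa using (hasStrictFDerivAt_norm_sq x).hasFDerivAt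
  have h2 := ((h1.neg.mul_const (1 / 2)).exp.const_mul ((2 * Real.pi) ^ (-(N : ℝ) / 2)))
  have h3 : HasFDerivAt (fun y : RN N => (gw y : ℂ)) (Complex.ofRealCLM.comp _) x :=
    Complex.ofRealCLM.hasFDerivAt.comp x (h2.congr_of_eventuallyEq (f₁ := gw)
      (Eventually.of_forall fun y => by simp [gw]; left; ring))
  unfold pd
  rw [h3.fderiv]
  simp [gw, EuclideanSpace.inner_single_right]
  ring_nf

end pd

/-- Smooth functions of at most exponential growth together with their first derivatives. -/
def Tame {N : ℕ} (f : RN N → ℂ) : Prop :=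
  ContDiff ℝ ∞ f ∧ ExpBdd f ∧ ∀ i, ExpBdd (pd i f)

namespace IsTest
variable {N : ℕ} {φ ψ : RN N → ℂ}

lemma pd (i : Fin N) (h : IsTest φ) : IsTest (pd i φ) :=
  ⟨contDiff_pd i h.1, HasCompactSupport.comp_left
    (g := fun L : RN N →L[ℝ] ℂ => L (EuclideanSpace.single i 1)) (h.2.fderiv ℝ) rfl⟩

lemma mul_left {g : RN N → ℂ} (hg : ContDiff ℝ ∞ g) (h : IsTest φ) : IsTest fun x => g x * φ x :=
  ⟨hg.mul h.1, h.2.mul_left⟩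

lemma add (h : IsTest φ) (h' : IsTest ψ) : IsTest fun x => φ x + ψ x :=
  ⟨h.1.add h'.1, h.2.add h'.2⟩

lemma sub (h : IsTest φ) (h' : IsTest ψ) : IsTest fun x => φ x - ψ x :=
  ⟨h.1.sub h'.1, h.2.sub h'.2⟩

lemma sum {ι : Type*} (s : Finset ι) {F : ι → RN N → ℂ} (h : ∀ i ∈ s, IsTest (F i)) :
    IsTest fun x => ∑ i ∈ s, F i x := by
  classical
  induction s using Finset.induction_on with
  | empty => exact ⟨by simpa using contDiff_const, HasCompactSupport.zero⟩
  | insert a s ha ih =>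
    simp_rw [Finset.sum_insert ha]
    exact (h a (by simp)).add (ih fun i hi => h i (by simp [hi]))

lemma expBdd (h : IsTest φ) : ExpBdd φ := .of_hasCompactSupport h.1.continuous h.2

lemma tame (h : IsTest φ) : Tame φ := ⟨h.1, h.expBdd, fun i => (h.pd i).expBdd⟩

lemma differentiable (h : IsTest φ) : Differentiable ℝ φ := h.1.differentiable (by simp)

lemma ouExpr (h : IsTest φ) : IsTest (ouExpr φ) := by
  rw [funext (ouExpr_eq h.1)]
  exact IsTest.sum _ fun i _ => ((h.pd i).pd i).sub ((h.pd i).mul_left (contDiff_coord i))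

lemma gw_mul (h : IsTest φ) : IsTest fun x => (gw x : ℂ) * φ x :=
  h.mul_left (Complex.ofRealCLM.contDiff.comp contDiff_gw)

lemma gw_inv_mul (h : IsTest φ) : IsTest fun x => (gw x : ℂ)⁻¹ * φ x :=
  h.mul_left ((Complex.ofRealCLM.contDiff.comp contDiff_gw).inv gw_ne_zero)

end IsTest

lemma Tame.differentiable {N : ℕ} {f : RN N → ℂ} (h : Tame f) : Differentiable ℝ f :=
  h.1.differentiable (by simp)

/-- The adjoint of `∂_i` with respect to the Gaussian measure. -/
def dl {N : ℕ} (i : Fin N) (f : RN N → ℂ) (x : RN N) : ℂ := (x i : ℂ) * f x - pd i f x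

lemma pd_gw_mul {N : ℕ} {f : RN N → ℂ} (hf : Differentiable ℝ f) (i : Fin N) (x : RN N) :
    pd i (fun y => (gw y : ℂ) * f y) x = -((gw x : ℂ) * dl i f x) := by
  have h : Differentiable ℝ fun y : RN N => (gw y : ℂ) :=
    (Complex.ofRealCLM.contDiff.comp contDiff_gw : ContDiff ℝ ∞ _).differentiable (by simp)
  rw [pd_mul i (h x) (hf x), pd_gw, dl]
  ring

lemma Tame.expBdd_dl {N : ℕ} {f : RN N → ℂ} (hf : Tame f) (i : Fin N) : ExpBdd (dl i f) :=
  ((ExpBdd.coord i).mul hf.2.1).sub (hf.2.2 i)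

/-- Integration by parts for Lebesgue measure with the factors f and γg; differentiating the density
γ produces the term x_i g. The growth bounds make all three products integrable, so no boundary
terms appear. -/
lemma gauss_integral_by_parts {N : ℕ} {f g : RN N → ℂ} (hf : Tame f) (hg : Tame g) (i : Fin N) :
    ∫ x, pd i f x * g x ∂gaussMeasure N = ∫ x, f x * dl i g x ∂gaussMeasure N := by
  have hgd : Differentiable ℝ fun y : RN N => (gw y : ℂ) :=
    (Complex.ofRealCLM.contDiff.comp contDiff_gw : ContDiff ℝ ∞ _).differentiable (by simp)
  have h := integral_mul_fderiv_eq_neg_fderiv_mul_of_integrable (μ := (volume : Measure (RN N)))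
    (f := f) (g := fun y => (gw y : ℂ) * g y) (v := EuclideanSpace.single i 1)
    ?_ ?_ ?_ (fun x _ => hf.differentiable x) (fun x _ => (hgd.mul hg.differentiable) x)
  · change ∫ x, f x * pd i _ x = - ∫ x, pd i f x * _ at h
    simp_rw [pd_gw_mul hg.differentiable] at h
    rw [integral_gauss, integral_gauss]
    simp_rw [mul_neg] at h
    rw [integral_neg, neg_inj] at h
    convert h.symm using 3 <;> ring
  · refine ((hf.2.2 i).mul hg.2.1).integrable_gw_mul.congr (Eventually.of_forall fun x => ?_)
    change _ = pd i f x * _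
    ring
  · refine (hf.2.1.mul (hg.expBdd_dl i)).integrable_gw_mul.neg.congr
      (Eventually.of_forall fun x => ?_)
    change _ = f x * pd i _ x
    rw [pd_gw_mul hg.differentiable]
    simp
    ring
  · refine (hf.2.1.mul hg.2.1).integrable_gw_mul.congr (Eventually.of_forall fun x => ?_)
    simp only
    ring

end

noncomputable section

/-! ### Normalized Hermite functions -/

/-- Differentiating He_{n+2} = X He_{n+1} - He_{n+1}' and inserting the induction hypothesis leaves
n + 1 times the recursion for He_{n+1}. -/
lemma derivative_hermite_succ (n : ℕ) :
    Polynomial.derivative (Polynomial.hermite (n + 1)) =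
      ((n + 1 : ℕ) : Polynomial ℤ) * Polynomial.hermite n := by
  induction n with
  | zero => simp [Polynomial.hermite_zero]
  | succ n ih =>
    rw [Polynomial.hermite_succ (n + 1), Polynomial.derivative_sub, Polynomial.derivative_mul, ih,
      Polynomial.derivative_mul, Polynomial.derivative_natCast, Polynomial.derivative_X]
    have := Polynomial.hermite_succ n
    push_cast
    linear_combination -((n : Polynomial ℤ) + 1) * this

/-- The normalized Hermite polynomial `He_n / √n!`. -/
def hN (n : ℕ) (t : ℝ) : ℝ := Polynomial.aeval t (Polynomial.hermite n) / √(n.factorial)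

lemma hN_zero (t : ℝ) : hN 0 t = 1 := by simp [hN]

lemma sqrt_factorial_succ (n : ℕ) :
    √((n + 1).factorial : ℝ) = √((n : ℝ) + 1) * √(n.factorial) := by
  rw [Nat.factorial_succ, Nat.cast_mul, Real.sqrt_mul (by positivity)]
  push_cast; rfl

/-- For n = 0 the truncated index n - 1 = 0 is harmless because its coefficient √0 vanishes. The
same convention is used for multi-indices below. -/
lemma hasDerivAt_hN (n : ℕ) (t : ℝ) : HasDerivAt (hN n) (√n * hN (n - 1) t) t := by
  have h := (Polynomial.hasDerivAt_aeval (Polynomial.hermite n) t).div_const √(n.factorial)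
  refine h.congr_deriv ?_
  cases n with
  | zero => simp
  | succ n =>
    rw [derivative_hermite_succ]
    have h1 : √((n : ℝ) + 1) ^ 2 = n + 1 := Real.sq_sqrt (by positivity)
    have h2 : √((n : ℝ) + 1) ≠ 0 := by positivity
    have h3 : √(n.factorial : ℝ) ≠ 0 := by positivity
    simp only [hN, Nat.add_sub_cancel, map_mul, map_natCast, sqrt_factorial_succ]
    push_cast
    field_simp
    rw [h1]
    ring

lemma hN_succ (n : ℕ) (t : ℝ) :
    √((n : ℝ) + 1) * hN (n + 1) t = t * hN n t - √n * hN (n - 1) t := by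
  have h := (hasDerivAt_hN n t).unique
    ((Polynomial.hasDerivAt_aeval (Polynomial.hermite n) t).div_const √(n.factorial))
  rw [h]
  have h2 : √((n : ℝ) + 1) ≠ 0 := by positivity
  have h3 : √(n.factorial : ℝ) ≠ 0 := by positivity
  simp only [hN, sqrt_factorial_succ, Polynomial.hermite_succ, map_sub, map_mul,
    Polynomial.aeval_X]
  field_simp

lemma contDiff_hN (n : ℕ) : ContDiff ℝ ∞ (hN n) := by
  unfold hN
  exact (Polynomial.contDiff_aeval _ _).div_const _

variable {N : ℕ}

/-- The normalized Hermite functions on `ℝ^N`. -/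
def hermR (α : Fin N → ℕ) (x : RN N) : ℝ := ∏ i, hN (α i) (x i)

/-- The normalized Hermite functions on `ℝ^N`, as complex valued functions. -/
def herm (α : Fin N → ℕ) (x : RN N) : ℂ := (hermR α x : ℂ)

lemma herm_eq_prod (α : Fin N → ℕ) (x : RN N) : herm α x = ∏ i, (hN (α i) (x i) : ℂ) := by
  simp [herm, hermR]

lemma contDiff_hN_coord (n : ℕ) (i : Fin N) : ContDiff ℝ ∞ fun x : RN N => (hN n (x i) : ℂ) :=
  Complex.ofRealCLM.contDiff.comp ((contDiff_hN n).comp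
    (EuclideanSpace.proj i : RN N →L[ℝ] ℝ).contDiff)

lemma contDiff_herm (α : Fin N → ℕ) : ContDiff ℝ ∞ (herm α) := by
  rw [funext (herm_eq_prod α)]
  exact contDiff_prod fun i _ => contDiff_hN_coord (α i) i

lemma expBdd_aeval (p : Polynomial ℤ) (i : Fin N) :
    ExpBdd fun x : RN N => ((Polynomial.aeval (x i) p : ℝ) : ℂ) := by
  induction p using Polynomial.induction_on' with
  | add p q hp hq => simpa using hp.add hq
  | monomial n a =>
    have h := (ExpBdd.const (N := N) a).mul
      (ExpBdd.prod (N := N) (Finset.range n) (F := fun _ x => (x i : ℂ)) fun _ _ => .coord i)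
    simpa [Polynomial.aeval_monomial] using h

lemma expBdd_herm (α : Fin N → ℕ) : ExpBdd (herm α) := by
  rw [funext (herm_eq_prod α)]
  refine ExpBdd.prod _ fun i _ => ?_
  have h := (expBdd_aeval (Polynomial.hermite (α i)) i).mul
    (.const (((√((α i).factorial))⁻¹ : ℝ) : ℂ))
  simpa [hN, div_eq_mul_inv] using h

lemma prod_eq_mul_erase {M : Type*} [CommMonoid M] (i : Fin N) (F : Fin N → M) :
    ∏ j, F j = F i * ∏ j ∈ Finset.univ.erase i, F j :=
  (Finset.mul_prod_erase _ _ (Finset.mem_univ i)).symm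

lemma pd_herm (i : Fin N) (α : Fin N → ℕ) (x : RN N) :
    pd i (herm α) x = (√(α i) : ℂ) * herm (α - Pi.single i 1) x := by
  have h1 : ∀ j ∈ Finset.univ, HasFDerivAt (fun y : RN N => (hN (α j) (y j) : ℂ))
      ((√(α j) * hN (α j - 1) (x j)) •
        (Complex.ofRealCLM.comp (EuclideanSpace.proj j : RN N →L[ℝ] ℝ))) x := by
    intro j _
    have h := (hasDerivAt_hN (α j) (x j)).comp_hasFDerivAt (x := x)
      (EuclideanSpace.proj j : RN N →L[ℝ] ℝ).hasFDerivAt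
    have h' := Complex.ofRealCLM.hasFDerivAt.comp x h
    exact h'.congr_fderiv (by ext v; simp)
  have h2 := HasFDerivAt.finsetProd h1
  have h3 : herm α = fun y => ∏ j, (hN (α j) (y j) : ℂ) := funext (herm_eq_prod α)
  unfold pd
  rw [h3, h2.fderiv, herm_eq_prod, prod_eq_mul_erase i]
  rw [sum_apply, Finset.sum_eq_single i]
  · rw [Finset.prod_congr rfl (g := fun j => (hN ((α - Pi.single i 1 : Fin N → ℕ) j) (x j) : ℂ))]
    · simp
      ring
    · intro j hj
      simp [Finset.ne_of_mem_erase hj]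
  · intro j _ hj
    simp [hj]
  · simp

lemma herm_split (i : Fin N) {α β : Fin N → ℕ} (x : RN N) (h : ∀ j, j ≠ i → β j = α j) :
    herm β x = hN (β i) (x i) * ∏ j ∈ Finset.univ.erase i, (hN (α j) (x j) : ℂ) := by
  rw [herm_eq_prod, prod_eq_mul_erase i]
  congr 1
  exact Finset.prod_congr rfl fun j hj => by rw [h j (Finset.ne_of_mem_erase hj)]

/-- The three-term recursion `hN_succ` in the i-th variable, the other factors being common.
Together with `pd_herm` it provides the raising and lowering operators. -/
lemma dl_herm (i : Fin N) (α : Fin N → ℕ) (x : RN N) :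
    dl i (herm α) x = (√((α i : ℝ) + 1) : ℂ) * herm (α + Pi.single i 1) x := by
  rw [dl, pd_herm, herm_split i (β := α) (α := α) x fun j _ => rfl,
    herm_split i (β := α - Pi.single i 1) (α := α) x fun j hj => by simp [hj],
    herm_split i (β := α + Pi.single i 1) (α := α) x fun j hj => by simp [hj]]
  have h := congrArg (fun r : ℝ => (r : ℂ)) (hN_succ (α i) (x i))
  simp only [Pi.sub_apply, Pi.add_apply, Pi.single_eq_same]
  push_cast at h
  linear_combination -(∏ j ∈ Finset.univ.erase i, (hN (α j) (x j) : ℂ)) * h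

lemma tame_herm (α : Fin N → ℕ) : Tame (herm α) := by
  refine ⟨contDiff_herm α, expBdd_herm α, fun i => ?_⟩
  rw [funext (pd_herm i α)]
  exact (ExpBdd.const _).mul (expBdd_herm _)

lemma conj_herm (α : Fin N → ℕ) (x : RN N) : starRingEnd ℂ (herm α x) = herm α x := by
  simp [herm]

/-- The degree of a multi-index. -/
def deg (α : Fin N → ℕ) : ℕ := ∑ i, α i

lemma deg_add_single (α : Fin N → ℕ) (i : Fin N) : deg (α + Pi.single i 1 : Fin N → ℕ) = deg α + 1 := by
  simp [deg, Finset.sum_add_distrib]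

lemma sub_add_single {α : Fin N → ℕ} {i : Fin N} (h : α i ≠ 0) :
    α - Pi.single i 1 + Pi.single i 1 = α := by
  ext j
  by_cases hj : j = i
  · subst hj; simp; omega
  · simp [hj]

lemma deg_sub_single {α : Fin N → ℕ} {i : Fin N} (h : α i ≠ 0) :
    deg (α - Pi.single i 1 : Fin N → ℕ) + 1 = deg α := by
  rw [← deg_add_single, sub_add_single h]

lemma add_sub_single (α : Fin N → ℕ) (i : Fin N) : α + Pi.single i 1 - Pi.single i 1 = α := by
  ext j; simp

lemma dl_pd_herm (i : Fin N) (α : Fin N → ℕ) (x : RN N) :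
    dl i (pd i (herm α)) x = (α i : ℂ) * herm α x := by
  have h : dl i (pd i (herm α)) x = (√(α i) : ℂ) * dl i (herm (α - Pi.single i 1)) x := by
    unfold dl
    rw [funext (pd_herm i α), pd_mul i (differentiableAt_const _) ((tame_herm _).differentiable x)]
    simp [pd]
    ring
  rw [h, dl_herm]
  by_cases h0 : α i = 0
  · simp [h0]
  · rw [sub_add_single h0, ← mul_assoc]
    congr 1
    have h1 : (((α - Pi.single i 1 : Fin N → ℕ) i : ℕ) : ℝ) + 1 = α i := by
      simp only [Pi.sub_apply, Pi.single_eq_same]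
      exact_mod_cast Nat.sub_add_cancel (Nat.one_le_iff_ne_zero.2 h0)
    rw [h1, ← Complex.ofReal_mul, Real.mul_self_sqrt (by positivity)]
    simp

/-- L = -∑ (x_i - ∂_i)∂_i, and each summand counts the i-th index by `dl_pd_herm`. -/
lemma ouExpr_herm (α : Fin N → ℕ) (x : RN N) : ouExpr (herm α) x = -(deg α : ℂ) * herm α x := by
  rw [ouExpr_eq (contDiff_herm α)]
  have : ∀ i, pd i (pd i (herm α)) x - (x i : ℂ) * pd i (herm α) x = -((α i : ℂ) * herm α x) := by
    intro i
    rw [← dl_pd_herm, dl]; ring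
  simp_rw [this, Finset.sum_neg_distrib, ← Finset.sum_mul, deg]
  push_cast; ring

/-- Induction on the degree of α: write h_α as a raising operator applied to h_{α-e_i} and move it
to h_β as the lowering operator ∂_i. In the base case h_0 = 1 is killed by ∂_i, so it is orthogonal
to everything in the range of a raising operator. -/
lemma integral_herm_mul_herm (α β : Fin N → ℕ) :
    ∫ x, herm α x * herm β x ∂gaussMeasure N = if α = β then 1 else 0 := by
  induction hn : deg α generalizing α β with
  | zero =>
    have hα : α = 0 := by
      ext i
      have := Finset.sum_eq_zero_iff.1 hn i (Finset.mem_univ i)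
      simpa using this
    have h0 : herm (0 : Fin N → ℕ) = fun _ => (1 : ℂ) := by
      ext x; simp [herm, hermR, hN_zero]
    subst hα
    by_cases hβ : β = 0
    · subst hβ; simp [h0]
    · obtain ⟨i, hi⟩ : ∃ i, β i ≠ 0 := by
        by_contra hc; push Not at hc; exact hβ (funext hc)
      have h := gauss_integral_by_parts (tame_herm (0 : Fin N → ℕ))
        (tame_herm (β - Pi.single i 1)) i
      simp_rw [pd_herm, dl_herm, sub_add_single hi] at h
      simp only [Pi.zero_apply, Nat.cast_zero, Real.sqrt_zero, Complex.ofReal_zero, zero_mul,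
        integral_zero] at h
      simp_rw [mul_left_comm (herm (0 : Fin N → ℕ) _)] at h
      rw [integral_const_mul, eq_comm, mul_eq_zero] at h
      have hne : (√(((β - Pi.single i 1 : Fin N → ℕ) i : ℕ) + 1 : ℝ) : ℂ) ≠ 0 := by
        rw [Complex.ofReal_ne_zero]; positivity
      rw [if_neg (Ne.symm hβ)]
      exact h.resolve_left hne
  | succ n ih =>
    obtain ⟨i, hi⟩ : ∃ i, α i ≠ 0 := by
      by_contra hc; push Not at hc; simp [deg, hc] at hn
    have h := gauss_integral_by_parts (tame_herm β) (tame_herm (α - Pi.single i 1)) i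
    simp_rw [pd_herm, dl_herm, sub_add_single hi] at h
    have h1 : (((α - Pi.single i 1 : Fin N → ℕ) i : ℕ) : ℝ) + 1 = α i := by
      simp only [Pi.sub_apply, Pi.single_eq_same]
      exact_mod_cast Nat.sub_add_cancel (Nat.one_le_iff_ne_zero.2 hi)
    simp_rw [h1, mul_left_comm (herm β _), mul_comm (herm β _), mul_assoc,
      mul_comm (herm (β - _) _)] at h
    rw [integral_const_mul, integral_const_mul, ih _ _ (by have := deg_sub_single hi; omega)] at h
    have hne : (√(α i : ℝ) : ℂ) ≠ 0 := by
      rw [Complex.ofReal_ne_zero]; positivity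
    apply mul_left_cancel₀ hne
    rw [← h]
    by_cases hb : β i = 0
    · have : α ≠ β := fun hab => hi (by rw [hab, hb])
      simp [hb, this]
    · by_cases hab : α = β
      · subst hab; simp
      · have : α - Pi.single i 1 ≠ β - Pi.single i 1 := fun hc => hab (by
          rw [← sub_add_single hi, hc, sub_add_single hb])
        simp [hab, this]

end

noncomputable section

/-! ### The Hermite basis -/

/-- The finite measures with densities g⁺ and g⁻ have the same characteristic function, hence are
equal, so g⁺ = g⁻ almost everywhere. -/
lemma ae_eq_zero_of_integral_exp_inner_real {E : Type*} [NormedAddCommGroup E]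
    [InnerProductSpace ℝ E] [MeasurableSpace E] [BorelSpace E] [CompleteSpace E]
    [SecondCountableTopology E] {μ : Measure E} [SigmaFinite μ] {g : E → ℝ} (hg : Integrable g μ)
    (h : ∀ t : E, ∫ x, Complex.exp (inner ℝ x t * Complex.I) * g x ∂μ = 0) : g =ᵐ[μ] 0 := by
  set d1 : E → ENNReal := fun x => ENNReal.ofReal (g x)
  set d2 : E → ENNReal := fun x => ENNReal.ofReal (-g x)
  have m1 : AEMeasurable d1 μ := hg.aemeasurable.ennreal_ofReal
  have m2 : AEMeasurable d2 μ := hg.aemeasurable.neg.ennreal_ofReal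
  have f1 : ∫⁻ x, d1 x ∂μ ≠ ⊤ := hg.lintegral_lt_top.ne
  have f2 : ∫⁻ x, d2 x ∂μ ≠ ⊤ := hg.neg.lintegral_lt_top.ne
  have : IsFiniteMeasure (μ.withDensity d1) := isFiniteMeasure_withDensity f1
  have : IsFiniteMeasure (μ.withDensity d2) := isFiniteMeasure_withDensity f2
  have hm : μ.withDensity d1 = μ.withDensity d2 := by
    refine Measure.ext_of_charFun (funext fun t => ?_)
    rw [charFun_apply, charFun_apply,
      integral_withDensity_eq_integral_toReal_smul₀ m1 (Eventually.of_forall fun x => by simp [d1]),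
      integral_withDensity_eq_integral_toReal_smul₀ m2 (Eventually.of_forall fun x => by simp [d2]),
      ← sub_eq_zero]
    have hb : ∀ x : E, ‖Complex.exp (inner ℝ x t * Complex.I)‖ ≤ 1 := fun x => by
      rw [Complex.norm_exp_ofReal_mul_I]
    have hc : AEStronglyMeasurable (fun x : E => Complex.exp (inner ℝ x t * Complex.I)) μ := by
      apply Continuous.aestronglyMeasurable; fun_prop
    have i1 : Integrable (fun x => (d1 x).toReal) μ := hg.real_toNNReal
    have i2 : Integrable (fun x => (d2 x).toReal) μ := hg.neg.real_toNNReal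
    have j1 : Integrable (fun x => (d1 x).toReal • Complex.exp (inner ℝ x t * Complex.I)) μ := by
      refine (i1.ofReal.bdd_mul hc (Eventually.of_forall hb)).congr (Eventually.of_forall fun x => ?_)
      simp [mul_comm]
    have j2 : Integrable (fun x => (d2 x).toReal • Complex.exp (inner ℝ x t * Complex.I)) μ := by
      refine (i2.ofReal.bdd_mul hc (Eventually.of_forall hb)).congr (Eventually.of_forall fun x => ?_)
      simp [mul_comm]
    rw [← integral_sub j1 j2, ← h t]
    refine integral_congr_ae (Eventually.of_forall fun x => ?_)
    have hx : (d1 x).toReal - (d2 x).toReal = g x := by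
      simp only [d1, d2, ENNReal.toReal_ofReal']
      rcases le_total (g x) 0 with h0 | h0
      · rw [max_eq_right h0, max_eq_left (by linarith)]; ring
      · rw [max_eq_left h0, max_eq_right (by linarith)]; ring
    simp only
    rw [← sub_smul, hx, Complex.real_smul, mul_comm]
  rw [withDensity_eq_iff m1 m2 f1] at hm
  filter_upwards [hm] with x hx
  simp only [d1, d2] at hx
  have := congrArg ENNReal.toReal hx
  rw [ENNReal.toReal_ofReal', ENNReal.toReal_ofReal'] at this
  rcases le_total (g x) 0 with h0 | h0
  · rw [max_eq_right h0, max_eq_left (by linarith)] at this; simp; linarith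
  · rw [max_eq_left h0, max_eq_right (by linarith)] at this; simp; linarith

/-- Conjugation replaces t by -t, so the transform of the conjugate of f vanishes as well. Hence so
do those of the real and imaginary parts. -/
lemma ae_eq_zero_of_integral_exp_inner {E : Type*} [NormedAddCommGroup E]
    [InnerProductSpace ℝ E] [MeasurableSpace E] [BorelSpace E] [CompleteSpace E]
    [SecondCountableTopology E] {μ : Measure E} [SigmaFinite μ] {f : E → ℂ} (hf : Integrable f μ)
    (h : ∀ t : E, ∫ x, Complex.exp (inner ℝ x t * Complex.I) * f x ∂μ = 0) : f =ᵐ[μ] 0 := by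
  have hi : ∀ t : E, ∀ F : E → ℂ, Integrable F μ →
      Integrable (fun x => Complex.exp (inner ℝ x t * Complex.I) * F x) μ := fun t F hF =>
    hF.bdd_mul (c := 1) (by apply Continuous.aestronglyMeasurable; fun_prop)
      (Eventually.of_forall fun x => by rw [Complex.norm_exp_ofReal_mul_I])
  have hconj : Integrable (fun x => starRingEnd ℂ (f x)) μ :=
    (Complex.conjLIE.integrable_comp_iff).2 hf
  have h' : ∀ t : E, ∫ x, Complex.exp (inner ℝ x t * Complex.I) * starRingEnd ℂ (f x) ∂μ = 0 := by
    intro t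
    have := congrArg (starRingEnd ℂ) (h (-t))
    rw [← integral_conj, map_zero] at this
    rw [← this]
    refine integral_congr_ae (Eventually.of_forall fun x => ?_)
    simp [← Complex.exp_conj]
  have hre := ae_eq_zero_of_integral_exp_inner_real hf.re (fun t => by
    have e : ∀ x, Complex.exp (inner ℝ x t * Complex.I) * ((RCLike.re (f x) : ℝ) : ℂ) =
        (1 / 2 : ℂ) * (Complex.exp (inner ℝ x t * Complex.I) * f x +
          Complex.exp (inner ℝ x t * Complex.I) * starRingEnd ℂ (f x)) := by
      intro x
      have := Complex.re_eq_add_conj (f x)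
      simp only [RCLike.re_to_complex]
      rw [this]; ring
    simp_rw [e]
    rw [integral_const_mul, integral_add (hi t _ hf) (hi t _ hconj), h, h']; simp)
  have him := ae_eq_zero_of_integral_exp_inner_real hf.im (fun t => by
    have e : ∀ x, Complex.exp (inner ℝ x t * Complex.I) * ((RCLike.im (f x) : ℝ) : ℂ) =
        (1 / (2 * Complex.I) : ℂ) * (Complex.exp (inner ℝ x t * Complex.I) * f x -
          Complex.exp (inner ℝ x t * Complex.I) * starRingEnd ℂ (f x)) := by
      intro x
      have := Complex.im_eq_sub_conj (f x)
      simp only [RCLike.im_to_complex]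
      rw [this]; ring
    simp_rw [e]
    rw [integral_const_mul, integral_sub (hi t _ hf) (hi t _ hconj), h, h']; simp)
  filter_upwards [hre, him] with x h1 h2
  exact Complex.ext h1 h2

variable {N : ℕ}

/-- Multiplication by x_i is the sum of the raising operator x_i - ∂_i and the lowering operator
∂_i, both of which preserve the span. -/
lemma coord_mul_mem_span_herm (i : Fin N) {g : RN N → ℂ}
    (hg : g ∈ Submodule.span ℂ (range (herm (N := N)))) :
    (fun x => (x i : ℂ) * g x) ∈ Submodule.span ℂ (range (herm (N := N))) := by
  induction hg using Submodule.span_induction with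
  | mem g hg =>
    obtain ⟨α, rfl⟩ := hg
    have : (fun x : RN N => (x i : ℂ) * herm α x) =
        (√((α i : ℝ) + 1) : ℂ) • herm (α + Pi.single i 1) +
          (√(α i) : ℂ) • herm (α - Pi.single i 1) := by
      ext x
      have h1 := dl_herm i α x
      rw [dl, pd_herm] at h1
      simp only [Pi.add_apply, Pi.smul_apply, smul_eq_mul]
      rw [← h1]; ring
    rw [this]
    exact add_mem (Submodule.smul_mem _ _ (Submodule.subset_span ⟨_, rfl⟩))
      (Submodule.smul_mem _ _ (Submodule.subset_span ⟨_, rfl⟩))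
  | zero => simp only [Pi.zero_apply, mul_zero]; exact zero_mem _
  | add f g _ _ hf hg => simpa [mul_add] using! add_mem hf hg
  | smul c f _ hf => simpa [mul_left_comm] using! Submodule.smul_mem _ c hf

lemma inner_pow_mem_span_herm (t : RN N) (n : ℕ) :
    (fun x : RN N => (inner ℝ x t : ℂ) ^ n) ∈ Submodule.span ℂ (range (herm (N := N))) := by
  induction n with
  | zero =>
    refine Submodule.subset_span ⟨0, ?_⟩
    ext x; simp [herm, hermR, hN_zero]
  | succ n ih =>
    have : (fun x : RN N => (inner ℝ x t : ℂ) ^ (n + 1)) =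
        ∑ i, (t i : ℂ) • fun x : RN N => (x i : ℂ) * (inner ℝ x t : ℂ) ^ n := by
      ext x
      have hx : (inner ℝ x t : ℂ) = ∑ i, (t i : ℂ) * (x i : ℂ) := by
        simp [PiLp.inner_apply]
      rw [pow_succ', Finset.sum_apply]
      simp only [Pi.smul_apply, smul_eq_mul]
      nth_rw 1 [hx]
      rw [Finset.sum_mul]
      exact Finset.sum_congr rfl fun i _ => by ring
    rw [this]
    exact sum_mem fun i _ => Submodule.smul_mem _ _ (coord_mul_mem_span_herm i ih)

/-- Completeness of the Hermite system. Expanding e^{i⟨x,t⟩} in its power series gives terms in the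
Hermite span, and e^{|⟨x,t⟩|}|f| dominates the partial sums; it is integrable because exponentials
lie in L²_μ. So all Fourier integrals of f vanish. -/
lemma ae_eq_zero_of_integral_herm {f : RN N → ℂ} (hf : MemLp f 2 (gaussMeasure N))
    (h : ∀ α, ∫ x, herm α x * f x ∂gaussMeasure N = 0) : f =ᵐ[gaussMeasure N] 0 := by
  have hs : ∀ g ∈ Submodule.span ℂ (range (herm (N := N))),
      ExpBdd g ∧ ∫ x, g x * f x ∂gaussMeasure N = 0 := by
    intro g hg
    induction hg using Submodule.span_induction with
    | mem g hg => obtain ⟨α, rfl⟩ := hg; exact ⟨expBdd_herm α, h α⟩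
    | zero => exact ⟨ExpBdd.const 0, by simp⟩
    | add g k _ _ hg hk =>
      refine ⟨hg.1.add hk.1, ?_⟩
      simp only [Pi.add_apply, add_mul]
      rw [integral_add (hg.1.integrable_mul hf) (hk.1.integrable_mul hf), hg.2, hk.2, add_zero]
    | smul c g _ hg =>
      refine ⟨(ExpBdd.const c).mul hg.1, ?_⟩
      simp only [Pi.smul_apply, smul_eq_mul, mul_assoc]
      rw [integral_const_mul, hg.2, mul_zero]
  refine ae_eq_zero_of_integral_exp_inner (hf.integrable (by norm_num)) fun t => ?_
  have hbound : Integrable (fun x => ((Real.exp |inner ℝ x t| : ℝ) : ℂ) * f x)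
      (gaussMeasure N) := by
    refine ExpBdd.integrable_mul ⟨by fun_prop, 1, ‖t‖, fun x => ?_⟩ hf
    rw [Complex.norm_real, Real.norm_of_nonneg (Real.exp_pos _).le, one_mul, Real.exp_le_exp,
      mul_comm]
    exact abs_real_inner_le_norm x t
  have hsum : HasSum (fun n : ℕ => ∫ x, ((inner ℝ x t : ℂ) * Complex.I) ^ n / n.factorial * f x
      ∂gaussMeasure N) (∫ x, Complex.exp (inner ℝ x t * Complex.I) * f x ∂gaussMeasure N) := by
    refine hasSum_integral_of_dominated_convergence
      (fun n x => |inner ℝ x t| ^ n / n.factorial * ‖f x‖) (fun n => ?_) (fun n => ?_) ?_ ?_ ?_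
    · refine AEStronglyMeasurable.mul (Continuous.aestronglyMeasurable (by fun_prop)) hf.1
    · refine Eventually.of_forall fun x => ?_
      simp
    · exact Eventually.of_forall fun x => (Real.summable_pow_div_factorial _).mul_right _
    · refine hbound.norm.congr (Eventually.of_forall fun x => ?_)
      simp only
      rw [tsum_mul_right, norm_mul, Complex.norm_real, Real.norm_of_nonneg (Real.exp_pos _).le,
        Real.exp_eq_exp_ℝ, NormedSpace.exp_eq_tsum_div]
    · refine Eventually.of_forall fun x => HasSum.mul_right _ ?_
      rw [Complex.exp_eq_exp_ℂ]
      exact NormedSpace.expSeries_div_hasSum_exp _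
  have hz : ∀ n : ℕ, ∫ x, ((inner ℝ x t : ℂ) * Complex.I) ^ n / n.factorial * f x
      ∂gaussMeasure N = 0 := by
    intro n
    have := (hs _ (inner_pow_mem_span_herm t n)).2
    calc _ = ∫ x, (Complex.I ^ n / n.factorial) * ((inner ℝ x t : ℂ) ^ n * f x)
          ∂gaussMeasure N := by
          refine integral_congr_ae (Eventually.of_forall fun x => ?_)
          simp only [mul_pow]; ring
      _ = 0 := by rw [integral_const_mul, this, mul_zero]
  simp_rw [hz] at hsum
  exact hsum.unique hasSum_zero

/-- The Hermite functions as elements of `L²_μ`. -/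
def hermL (α : Fin N → ℕ) : L2mu N := (expBdd_herm α).memLp.toLp (herm α)

lemma coeFn_hermL (α : Fin N → ℕ) : (hermL α : RN N → ℂ) =ᵐ[gaussMeasure N] herm α :=
  MemLp.coeFn_toLp _

lemma inner_hermL (α : Fin N → ℕ) (f : L2mu N) :
    inner ℂ (hermL α) f = ∫ x, herm α x * f x ∂gaussMeasure N := by
  rw [L2.inner_def]
  refine integral_congr_ae ?_
  filter_upwards [coeFn_hermL α] with x hx
  rw [hx, RCLike.inner_apply, conj_herm, mul_comm]

lemma orthonormal_hermL : Orthonormal ℂ (hermL (N := N)) := by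
  classical
  rw [orthonormal_iff_ite]
  intro α β
  rw [inner_hermL, ← integral_herm_mul_herm]
  refine integral_congr_ae ?_
  filter_upwards [coeFn_hermL β] with x hx
  rw [hx]

/-- The Hilbert basis of `L²_μ` of normalized Hermite functions. -/
def hermBasis (N : ℕ) : HilbertBasis (Fin N → ℕ) ℂ (L2mu N) :=
  HilbertBasis.mkOfOrthogonalEqBot orthonormal_hermL (by
    rw [Submodule.eq_bot_iff]
    intro f hf
    rw [Submodule.mem_orthogonal] at hf
    rw [Lp.eq_zero_iff_ae_eq_zero]
    refine ae_eq_zero_of_integral_herm (Lp.memLp f) fun α => ?_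
    rw [← inner_hermL]
    exact hf _ (Submodule.subset_span ⟨α, rfl⟩))

lemma hermBasis_apply (α : Fin N → ℕ) : hermBasis N α = hermL α := by
  simp [hermBasis]

lemma hermBasis_repr (f : L2mu N) (α : Fin N → ℕ) :
    (hermBasis N).repr f α = ∫ x, herm α x * f x ∂gaussMeasure N := by
  rw [HilbertBasis.repr_apply_apply, hermBasis_apply, inner_hermL]

lemma hermBasis_repr_toLp {f : RN N → ℂ} (hf : MemLp f 2 (gaussMeasure N)) (α : Fin N → ℕ) :
    (hermBasis N).repr (hf.toLp f) α = ∫ x, herm α x * f x ∂gaussMeasure N := by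
  rw [hermBasis_repr]
  refine integral_congr_ae ?_
  filter_upwards [hf.coeFn_toLp] with x hx
  rw [hx]

end

noncomputable section

/-! ### Diagonal operators and semigroups on a Hilbert space -/

section Diagonal
variable {ι H : Type*} [NormedAddCommGroup H] [InnerProductSpace ℂ H] (b : HilbertBasis ι ℂ H)

lemma HilbertBasis.exists_repr_eq {a : ι → ℂ} (ha : Summable fun i => ‖a i‖ ^ 2) :
    ∃ u : H, ∀ i, b.repr u i = a i := by
  have h : Memℓp a 2 := memℓp_gen (by simpa using ha)
  exact ⟨b.repr.symm ⟨a, h⟩, fun i => by simp⟩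

lemma HilbertBasis.hasSum_repr_sq (u : H) : HasSum (fun i => ‖b.repr u i‖ ^ 2) (‖u‖ ^ 2) := by
  have h := lp.hasSum_norm (p := 2) (by norm_num) (b.repr u)
  simpa using h

lemma HilbertBasis.repr_injective' {u v : H} (h : ∀ i, b.repr u i = b.repr v i) : u = v :=
  b.repr.injective (lp.ext (funext h))

lemma HilbertBasis.continuous_repr (i : ι) : Continuous fun u : H => b.repr u i := by
  simp_rw [HilbertBasis.repr_apply_apply]
  fun_prop

/-- Dominated convergence for the series ∑ |(F x)_i - v_i|², which is ‖F x - v‖² by Parseval. -/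
lemma HilbertBasis.tendsto_of_repr {X : Type*} {l : Filter X} {F : X → H} {v : H} {g : ι → ℝ}
    (hg : Summable g) (hb : ∀ᶠ x in l, ∀ i, ‖b.repr (F x) i - b.repr v i‖ ^ 2 ≤ g i)
    (ht : ∀ i, Tendsto (fun x => b.repr (F x) i) l (𝓝 (b.repr v i))) : Tendsto F l (𝓝 v) := by
  rw [tendsto_iff_norm_sub_tendsto_zero]
  have h1 : Tendsto (fun x => ∑' i, ‖b.repr (F x) i - b.repr v i‖ ^ 2) l (𝓝 (∑' _ : ι, (0 : ℝ))) := by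
    refine tendsto_tsum_of_dominated_convergence hg (fun i => ?_) ?_
    · have := (tendsto_iff_norm_sub_tendsto_zero.1 (ht i)).pow 2
      simpa using this
    · filter_upwards [hb] with x hx i
      rw [Real.norm_of_nonneg (by positivity)]
      exact hx i
  have h2 : ∀ x, ∑' i, ‖b.repr (F x) i - b.repr v i‖ ^ 2 = ‖F x - v‖ ^ 2 := fun x => by
    rw [← (b.hasSum_repr_sq (F x - v)).tsum_eq]
    simp
  simp_rw [h2, tsum_zero] at h1
  simpa [Real.sqrt_sq (norm_nonneg _)] using h1.sqrt

lemma HilbertBasis.exists_diag (c : ι → ℂ) (hc : ∀ i, ‖c i‖ ≤ 1) :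
    ∃ S : H →L[ℂ] H, ∀ u i, b.repr (S u) i = c i * b.repr u i := by
  have hle : ∀ (u : H) (i : ι), ‖c i * b.repr u i‖ ^ 2 ≤ ‖b.repr u i‖ ^ 2 := fun u i => by
    rw [norm_mul]
    gcongr
    exact mul_le_of_le_one_left (norm_nonneg _) (hc i)
  choose F hF using fun u : H => b.exists_repr_eq (a := fun i => c i * b.repr u i)
    (Summable.of_nonneg_of_le (fun i => by positivity) (hle u) (b.hasSum_repr_sq u).summable)
  refine ⟨LinearMap.mkContinuous
    { toFun := F
      map_add' := fun u v => b.repr_injective' fun i => by simp [hF, mul_add]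
      map_smul' := fun a u => b.repr_injective' fun i => by simp [hF, mul_left_comm] } 1 ?_, hF⟩
  intro u
  rw [one_mul, ← sq_le_sq₀ (norm_nonneg _) (norm_nonneg _)]
  refine hasSum_le (fun i => ?_) (b.hasSum_repr_sq _) (b.hasSum_repr_sq u)
  simpa [hF] using hle u i

/-- The diagonal operator with the bounded eigenvalues `c`. -/
def HilbertBasis.diag (c : ι → ℂ) (hc : ∀ i, ‖c i‖ ≤ 1) : H →L[ℂ] H := (b.exists_diag c hc).choose

lemma HilbertBasis.repr_diag (c : ι → ℂ) (hc : ∀ i, ‖c i‖ ≤ 1) (u : H) (i : ι) :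
    b.repr (b.diag c hc u) i = c i * b.repr u i := (b.exists_diag c hc).choose_spec u i

variable (m : ι → ℝ) (hm : ∀ i, 0 ≤ m i)

/-- The semigroup `e^{-tM}`, `M` the diagonal operator with eigenvalues `m`. -/
def HilbertBasis.diagSemigroup (t : ℝ) : H →L[ℂ] H :=
  -- Truncating at `max t 0` only keeps the operator bounded for negative t, where its values play
  -- no role.
  b.diag (fun i => (Real.exp (-(max t 0 * m i)) : ℝ)) fun i => by
    rw [Complex.norm_real, Real.norm_of_nonneg (Real.exp_pos _).le, Real.exp_le_one_iff]
    have := mul_nonneg (le_max_right t 0) (hm i)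
    linarith

lemma HilbertBasis.repr_diagSemigroup {t : ℝ} (ht : 0 ≤ t) (u : H) (i : ι) :
    b.repr (b.diagSemigroup m hm t u) i = (Real.exp (-(t * m i)) : ℝ) * b.repr u i := by
  rw [HilbertBasis.diagSemigroup, HilbertBasis.repr_diag, max_eq_left ht]

lemma norm_exp_neg_sub_one_le {r : ℝ} (hr : 0 ≤ r) : |Real.exp (-r) - 1| ≤ r := by
  rw [abs_le]
  constructor
  · linarith [Real.add_one_le_exp (-r)]
  · have := Real.exp_le_one_iff.2 (neg_nonpos.2 hr)
    linarith

lemma HilbertBasis.isC0Semigroup_diagSemigroup : IsC0Semigroup (b.diagSemigroup m hm) where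
  zero := by
    ext u
    refine b.repr_injective' fun i => ?_
    rw [b.repr_diagSemigroup m hm le_rfl]
    simp
  add s t hs ht := by
    ext u
    refine b.repr_injective' fun i => ?_
    rw [ContinuousLinearMap.comp_apply, b.repr_diagSemigroup m hm (add_nonneg hs ht),
      b.repr_diagSemigroup m hm hs, b.repr_diagSemigroup m hm ht, ← mul_assoc,
      ← Complex.ofReal_mul, ← Real.exp_add]
    congr 4
    ring
  cont u := by
    refine b.tendsto_of_repr (g := fun i => ‖b.repr u i‖ ^ 2) (b.hasSum_repr_sq u).summable ?_ ?_
    · filter_upwards [self_mem_nhdsWithin] with t ht i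
      have ht' : (0 : ℝ) ≤ t := le_of_lt ht
      rw [b.repr_diagSemigroup m hm ht', ← sub_one_mul, norm_mul]
      gcongr
      refine mul_le_of_le_one_left (norm_nonneg _) ?_
      rw [← Complex.ofReal_one, ← Complex.ofReal_sub, Complex.norm_real, Real.norm_eq_abs, abs_le]
      have h1 := Real.exp_pos (-(t * m i))
      have h2 := Real.exp_le_one_iff.2 (neg_nonpos.2 (mul_nonneg ht' (hm i)))
      constructor <;> linarith
    · intro i
      have h : Tendsto (fun t : ℝ => (Real.exp (-(t * m i)) : ℂ) * b.repr u i) (𝓝[>] 0)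
          (𝓝 ((Real.exp (-(0 * m i)) : ℂ) * b.repr u i)) := by
        refine Tendsto.mono_left ?_ nhdsWithin_le_nhds
        apply Continuous.tendsto (f := fun t : ℝ => (Real.exp (-(t * m i)) : ℂ) * b.repr u i)
        fun_prop
      simp only [zero_mul, neg_zero, Real.exp_zero, Complex.ofReal_one, one_mul] at h
      refine h.congr' ?_
      filter_upwards [self_mem_nhdsWithin] with t ht
      rw [b.repr_diagSemigroup m hm (le_of_lt ht)]

lemma tendsto_exp_diffQuot (a : ℝ) :
    Tendsto (fun h : ℝ => h⁻¹ * (Real.exp (-(h * a)) - 1)) (𝓝[>] 0) (𝓝 (-a)) := by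
  have hd : HasDerivAt (fun h : ℝ => Real.exp (-(h * a))) (-a) 0 := by
    have := ((hasDerivAt_id (0 : ℝ)).mul_const a).neg.exp
    simpa using this
  have := hd.tendsto_slope_zero_right
  simpa using this

/-- Coordinates are continuous, which gives necessity. For sufficiency, |h⁻¹(e^{-hm} - 1)| ≤ m
bounds each coordinate of the difference quotient by that of v, so 4|v_i|² is a summable majorant.
-/
lemma HilbertBasis.tendsto_diffQuot_iff (u v : H) :
    Tendsto (fun h : ℝ => ((h⁻¹ : ℝ) : ℂ) • (b.diagSemigroup m hm h u - u)) (𝓝[>] 0) (𝓝 v) ↔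
      ∀ i, b.repr v i = -(m i : ℂ) * b.repr u i := by
  have hrepr : ∀ i, ∀ h : ℝ, 0 < h →
      b.repr (((h⁻¹ : ℝ) : ℂ) • (b.diagSemigroup m hm h u - u)) i =
        ((h⁻¹ * (Real.exp (-(h * m i)) - 1) : ℝ) : ℂ) * b.repr u i := by
    intro i h hh
    simp only [map_smul, map_sub, lp.coeFn_smul, lp.coeFn_sub, Pi.smul_apply, Pi.sub_apply,
      smul_eq_mul]
    rw [b.repr_diagSemigroup m hm hh.le]
    push_cast
    ring
  have hlim : ∀ i, Tendsto (fun h : ℝ =>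
      b.repr (((h⁻¹ : ℝ) : ℂ) • (b.diagSemigroup m hm h u - u)) i) (𝓝[>] 0)
      (𝓝 (-(m i : ℂ) * b.repr u i)) := by
    intro i
    have h1 := ((Complex.continuous_ofReal.tendsto _).comp (tendsto_exp_diffQuot (m i))).mul_const
      (b.repr u i)
    rw [Complex.ofReal_neg] at h1
    refine h1.congr' ?_
    filter_upwards [self_mem_nhdsWithin] with h hh
    exact (hrepr i h hh).symm
  constructor
  · intro ht i
    exact tendsto_nhds_unique (((b.continuous_repr i).tendsto v).comp ht) (hlim i)
  · intro hv
    refine b.tendsto_of_repr (g := fun i => 4 * ‖b.repr v i‖ ^ 2)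
      ((b.hasSum_repr_sq v).summable.mul_left 4) ?_ fun i => by rw [hv i]; exact hlim i
    filter_upwards [self_mem_nhdsWithin] with h hh i
    have hh' : (0 : ℝ) < h := hh
    rw [hrepr i h hh]
    have h1 : ‖((h⁻¹ * (Real.exp (-(h * m i)) - 1) : ℝ) : ℂ) * b.repr u i‖ ≤ ‖b.repr v i‖ := by
      rw [hv i, norm_mul, norm_mul, Complex.norm_real, norm_neg, Complex.norm_real]
      gcongr
      rw [norm_mul, norm_inv, Real.norm_of_nonneg hh'.le, Real.norm_of_nonneg (hm i),
        inv_mul_le_iff₀ hh']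
      exact norm_exp_neg_sub_one_le (mul_nonneg hh'.le (hm i))
    calc _ ≤ (‖b.repr v i‖ + ‖b.repr v i‖) ^ 2 := by
          gcongr
          exact (norm_sub_le _ _).trans (by linarith)
      _ = _ := by ring

end Diagonal

/-! ### Uniqueness of the semigroup -/

section Uniqueness
variable {H : Type*} [NormedAddCommGroup H] [NormedSpace ℂ H]
  {T : ℝ → H →L[ℂ] H}

lemma IsC0Semigroup.nat_mul (hT : IsC0Semigroup T) {h : ℝ} (hh : 0 ≤ h) (n : ℕ) :
    T (n * h) = (T h) ^ n := by
  induction n with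
  | zero => simp [hT.zero]; rfl
  | succ n ih =>
    rw [show ((n + 1 : ℕ) : ℝ) * h = n * h + h by push_cast; ring,
      hT.add _ _ (by positivity) hh, ih, pow_succ]
    rfl

/-- If the norms were unbounded near 0, there would be times s_n → 0+ with ‖T(s_n)‖ > n. Strong
continuity makes every orbit along s_n bounded, which contradicts Banach–Steinhaus. -/
lemma IsC0Semigroup.exists_bound_near_zero [CompleteSpace H] (hT : IsC0Semigroup T) :
    ∃ δ > 0, ∃ M : ℝ, ∀ h, 0 < h → h < δ → ‖T h‖ ≤ M := by
  by_contra! hc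
  have h1 : ∀ n : ℕ, ∃ h : ℝ, 0 < h ∧ h < 1 / ((n : ℝ) + 1) ∧ (n : ℝ) < ‖T h‖ :=
    fun n => hc _ (by positivity) n
  choose s hs0 hs1 hs2 using h1
  have hlim : Tendsto s atTop (𝓝[>] 0) := by
    refine tendsto_nhdsWithin_iff.2 ⟨?_, Eventually.of_forall hs0⟩
    exact squeeze_zero (fun n => (hs0 n).le) (fun n => (hs1 n).le)
      tendsto_one_div_add_atTop_nhds_zero_nat
  obtain ⟨C, hC⟩ := banach_steinhaus (g := fun n => T (s n)) (fun u => by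
    obtain ⟨C, hC⟩ := ((hT.cont u).comp hlim).norm.bddAbove_range
    exact ⟨C, fun n => hC ⟨n, rfl⟩⟩)
  obtain ⟨n, hn⟩ := exists_nat_gt C
  linarith [hC n, hs2 n]

lemma IsC0Semigroup.exists_bound [CompleteSpace H] (hT : IsC0Semigroup T) {t : ℝ} (ht : 0 < t) :
    ∃ M : ℝ, 0 ≤ M ∧ ∀ s, 0 ≤ s → s ≤ t → ‖T s‖ ≤ M := by
  obtain ⟨δ, hδ, M, hM⟩ := hT.exists_bound_near_zero
  obtain ⟨K, hK⟩ := exists_nat_gt (t / δ)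
  have hK0 : (0 : ℝ) < K := lt_of_le_of_lt (by positivity) hK
  refine ⟨max ‖T 0‖ (|M| ^ K), by positivity, fun s hs hst => ?_⟩
  rcases hs.eq_or_lt with rfl | hs
  · exact le_max_left _ _
  · refine le_trans ?_ (le_max_right _ _)
    -- K was chosen above t/δ, so s/K < δ lies in the range of the bound near zero.
    have h1 : T s = T (s / K) ^ K := by
      rw [← hT.nat_mul (by positivity), mul_div_cancel₀ _ hK0.ne']
    rw [h1]
    refine (norm_pow_le' _ (by exact_mod_cast hK0)).trans ?_
    gcongr
    refine (hM _ (by positivity) ?_).trans (le_abs_self M)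
    rw [div_lt_iff₀ hK0]
    rw [div_lt_iff₀ hδ] at hK
    linarith

/-- The defect D(h) = T(h)e - e^{-ha}e is o(h) as h → 0+. From D((n+1)h) = T(nh)D(h) + e^{-ha}D(nh),
the defect after n steps of length h is at most nM‖D(h)‖, so D(t) = 0 after refining the steps. Only
right differentiability at 0 is needed. -/
lemma IsC0Semigroup.apply_eigenvector [CompleteSpace H] (hT : IsC0Semigroup T) {e : H} {a : ℝ} (ha : 0 ≤ a)
    (he : Tendsto (fun h : ℝ => ((h⁻¹ : ℝ) : ℂ) • (T h e - e)) (𝓝[>] 0) (𝓝 (-(a : ℂ) • e)))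
    {t : ℝ} (ht : 0 < t) : T t e = (Real.exp (-(t * a)) : ℂ) • e := by
  obtain ⟨M, hM0, hM⟩ := hT.exists_bound ht
  set D : ℝ → H := fun h => T h e - (Real.exp (-(h * a)) : ℂ) • e with hD
  have hDlim : Tendsto (fun h : ℝ => ((h⁻¹ : ℝ) : ℂ) • D h) (𝓝[>] 0) (𝓝 0) := by
    have h1 := ((Complex.continuous_ofReal.tendsto _).comp (tendsto_exp_diffQuot a)).smul_const e
    have h2 := he.sub h1
    rw [Complex.ofReal_neg, sub_self] at h2
    refine h2.congr fun h => ?_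
    simp only [hD, Function.comp]
    push_cast
    module
  have hstep : ∀ (h : ℝ) (_ : 0 ≤ h) (n : ℕ), n * h ≤ t → ‖D (n * h)‖ ≤ n * (M * ‖D h‖) := by
    intro h hh n
    induction n with
    | zero => intro _; simp [hD, hT.zero]
    | succ n ih =>
      intro hn
      have hnh : (n : ℝ) * h ≤ t := le_trans (by push_cast; nlinarith) hn
      have e1 : D ((n + 1 : ℕ) * h) = T (n * h) (D h) + (Real.exp (-(h * a)) : ℂ) • D (n * h) := by
        simp only [hD]
        rw [show ((n + 1 : ℕ) : ℝ) * h = n * h + h by push_cast; ring,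
          hT.add _ _ (by positivity) hh, ContinuousLinearMap.comp_apply, map_sub, map_smul,
          smul_sub, smul_smul, ← Complex.ofReal_mul, ← Real.exp_add,
          show -((n * h + h) * a) = -(h * a) + -(n * h * a) by ring]
        abel
      rw [e1]
      have b1 : ‖T (n * h) (D h)‖ ≤ M * ‖D h‖ :=
        ((T (n * h)).le_opNorm _).trans (by gcongr; exact hM _ (by positivity) hnh)
      have b2 : ‖(Real.exp (-(h * a)) : ℂ) • D (n * h)‖ ≤ ‖D (n * h)‖ := by
        rw [norm_smul, Complex.norm_real, Real.norm_of_nonneg (Real.exp_pos _).le]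
        refine mul_le_of_le_one_left (norm_nonneg _) (Real.exp_le_one_iff.2 ?_)
        have := mul_nonneg hh ha
        linarith
      have h3 := norm_add_le (T (n * h) (D h)) ((Real.exp (-(h * a)) : ℂ) • D (n * h))
      have h4 : ((n + 1 : ℕ) : ℝ) * (M * ‖D h‖) = n * (M * ‖D h‖) + M * ‖D h‖ := by
        push_cast; ring
      rw [h4]
      linarith [ih hnh]
  have hseq : Tendsto (fun n : ℕ => t / ((n : ℝ) + 1)) atTop (𝓝[>] 0) := by
    refine tendsto_nhdsWithin_iff.2 ⟨?_, Eventually.of_forall fun n => by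
      simp only [mem_Ioi]; positivity⟩
    have := (tendsto_one_div_add_atTop_nhds_zero_nat (𝕜 := ℝ)).const_mul t
    simpa [div_eq_mul_inv] using this
  have hlim := ((hDlim.comp hseq).norm.const_mul (t * M))
  rw [norm_zero, mul_zero] at hlim
  -- With n + 1 steps of length h = t/(n+1), the bound (n+1)M‖D(h)‖ is tM‖h⁻¹D(h)‖.
  have hle : ∀ n : ℕ, ‖D t‖ ≤
      t * M * ‖((((t / ((n : ℝ) + 1))⁻¹ : ℝ) : ℂ) • D (t / ((n : ℝ) + 1)))‖ := by
    intro n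
    have hn : (0 : ℝ) < (n : ℝ) + 1 := by positivity
    have h1 := hstep (t / ((n : ℝ) + 1)) (by positivity) (n + 1)
      (by push_cast; rw [mul_div_cancel₀ _ hn.ne'])
    push_cast at h1
    rw [mul_div_cancel₀ _ hn.ne'] at h1
    refine h1.trans (le_of_eq ?_)
    rw [norm_smul, Complex.norm_real, Real.norm_of_nonneg (by positivity)]
    field_simp
  have hz : ‖D t‖ ≤ 0 := ge_of_tendsto' hlim hle
  have := norm_le_zero_iff.1 hz
  exact sub_eq_zero.1 this

end Uniqueness

section
variable {ι H : Type*} [NormedAddCommGroup H] [InnerProductSpace ℂ H]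
  (b : HilbertBasis ι ℂ H) {B : H →ₗ.[ℂ] H}

lemma HilbertBasis.isGeneratorOf_diagSemigroup (m : ι → ℝ) (hm : ∀ i, 0 ≤ m i)
    (hB : ∀ u v, (∃ hu : u ∈ B.domain, B ⟨u, hu⟩ = v) ↔
      ∀ i, b.repr v i = -(m i : ℂ) * b.repr u i) :
    IsGeneratorOf B (b.diagSemigroup m hm) :=
  ⟨b.isC0Semigroup_diagSemigroup m hm, fun u v => by rw [hB, b.tendsto_diffQuot_iff m hm]⟩

/-- Basis vectors are eigenvectors of the generator, which fixes T(t) on each of them by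
`IsC0Semigroup.apply_eigenvector`. Their span is dense and T(t) is bounded, so the generator
determines the semigroup. -/
lemma HilbertBasis.repr_semigroup [CompleteSpace H] (m : ι → ℝ) (hm : ∀ i, 0 ≤ m i)
    (hB : ∀ u v, (∃ hu : u ∈ B.domain, B ⟨u, hu⟩ = v) ↔
      ∀ i, b.repr v i = -(m i : ℂ) * b.repr u i) {T : ℝ → H →L[ℂ] H} (hT : IsGeneratorOf B T) {t : ℝ}
    (ht : 0 < t) (u : H) (i : ι) :
    b.repr (T t u) i = (Real.exp (-(t * m i)) : ℝ) * b.repr u i := by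
  classical
  have h : T t = b.diagSemigroup m hm t := by
    refine ContinuousLinearMap.ext_on
      (Submodule.dense_iff_topologicalClosure_eq_top.2 b.dense_span) ?_
    · rintro _ ⟨j, rfl⟩
      rw [hT.1.apply_eigenvector (hm j) ?_ ht]
      · refine b.repr_injective' fun i => ?_
        rw [b.repr_diagSemigroup m hm ht.le]
        simp only [map_smul, lp.coeFn_smul, Pi.smul_apply, smul_eq_mul, b.repr_self]
        by_cases hij : i = j
        · subst hij; rfl
        · simp [hij]
      · refine (hT.2 _ _).1 ((hB _ _).2 fun i => ?_)
        simp only [map_smul, lp.coeFn_smul, Pi.smul_apply, smul_eq_mul, b.repr_self]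
        by_cases hij : i = j
        · subst hij; rfl
        · simp [hij]
  rw [h, b.repr_diagSemigroup m hm ht.le]

end

end

noncomputable section

/-! ### Cutoff functions -/

section Cutoff
variable {N : ℕ}

lemma pd_comp_smul {g : RN N → ℂ} (hg : Differentiable ℝ g) (c : ℝ) (i : Fin N) (x : RN N) :
    pd i (fun y => g (c • y)) x = (c : ℂ) * pd i g (c • x) := by
  have h := (hg (c • x)).hasFDerivAt.comp x ((hasFDerivAt_id x).const_smul c)
  have h' : HasFDerivAt (fun y => g (c • y)) _ x := h
  unfold pd
  rw [h'.fderiv]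
  simp

/-- Dilates x ↦ g(x/(n+1)) of one bump function g that is 1 near the origin. Each derivative gains a
factor 1/(n+1) ≤ 1, so all bounds are uniform in n and the derivatives vanish in the limit. -/
lemma exists_cutoff (N : ℕ) : ∃ χ : ℕ → RN N → ℂ, (∀ n, IsTest (χ n)) ∧
    (∃ C : ℝ, 0 ≤ C ∧ (∀ n x, ‖χ n x‖ ≤ C) ∧
      ∀ n x i, ‖pd i (χ n) x‖ ≤ C ∧ ‖pd i (pd i (χ n)) x‖ ≤ C) ∧
    (∀ x, Tendsto (fun n => χ n x) atTop (𝓝 1)) ∧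
    (∀ x i, Tendsto (fun n => pd i (χ n) x) atTop (𝓝 0)) ∧
    ∀ x i, Tendsto (fun n => pd i (pd i (χ n)) x) atTop (𝓝 0) := by
  let β : ContDiffBump (0 : RN N) := ⟨1, 2, one_pos, one_lt_two⟩
  let g : RN N → ℂ := fun x => (β x : ℂ)
  have hg : IsTest g := ⟨Complex.ofRealCLM.contDiff.comp β.contDiff,
    β.hasCompactSupport.comp_left (g := fun r : ℝ => (r : ℂ)) Complex.ofReal_zero⟩
  have hbd : ∀ φ : RN N → ℂ, IsTest φ → ∃ C, ∀ x, ‖φ x‖ ≤ C := fun φ hφ =>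
    hφ.2.exists_bound_of_continuous hφ.1.continuous
  obtain ⟨C0, hC0⟩ := hbd g hg
  choose C1 hC1 using fun i => hbd _ (hg.pd i)
  choose C2 hC2 using fun i => hbd _ ((hg.pd i).pd i)
  let c : ℕ → ℝ := fun n => 1 / ((n : ℝ) + 1)
  have hc0 : ∀ n, 0 < c n := fun n => by simp only [c]; positivity
  have hc1 : ∀ n, c n ≤ 1 := fun n => by
    simp only [c]; rw [div_le_one (by positivity)]; linarith [Nat.cast_nonneg (α := ℝ) n]
  have hclim : Tendsto c atTop (𝓝 0) := tendsto_one_div_add_atTop_nhds_zero_nat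
  have e1 : ∀ n i, pd i (fun x => g (c n • x)) = fun x => (c n : ℂ) * pd i g (c n • x) :=
    fun n i => funext fun x => pd_comp_smul hg.differentiable _ _ _
  have e2 : ∀ n i, pd i (pd i (fun x => g (c n • x))) =
      fun x => (c n : ℂ) * ((c n : ℂ) * pd i (pd i g) (c n • x)) := by
    intro n i
    rw [e1]
    ext x
    have hd : DifferentiableAt ℝ (fun y => pd i g (c n • y)) x :=
      ((hg.pd i).differentiable.comp (differentiable_id.const_smul (c n))) x
    rw [pd_mul i (differentiableAt_const _) hd, pd_comp_smul (hg.pd i).differentiable]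
    simp [pd]
  have hcn : ∀ n, ‖(c n : ℂ)‖ ≤ 1 := fun n => by
    rw [Complex.norm_real, Real.norm_of_nonneg (hc0 n).le]; exact hc1 n
  have hclim' : Tendsto (fun n => (c n : ℂ)) atTop (𝓝 0) := by
    have := (Complex.continuous_ofReal.tendsto 0).comp hclim
    simpa [Function.comp_def] using this
  have hbz : ∀ (F : ℕ → ℂ) (C : ℝ), (∀ n, ‖F n‖ ≤ C) →
      Tendsto (fun n => (c n : ℂ) * F n) atTop (𝓝 0) := by
    intro F C hF
    have hcn' : Tendsto (fun n => ‖(c n : ℂ)‖ * C) atTop (𝓝 0) := by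
      simpa using hclim'.norm.mul_const C
    exact squeeze_zero_norm (fun n => by rw [norm_mul]; gcongr; exact hF n) hcn'
  refine ⟨fun n x => g (c n • x), fun n => ⟨?_, ?_⟩, ?_, ?_, ?_, ?_⟩
  · exact hg.1.comp (contDiff_id.const_smul (c n))
  · exact hg.2.comp_smul (hc0 n).ne'
  · refine ⟨|C0| + ∑ i, |C1 i| + ∑ i, |C2 i|, by positivity, fun n x => ?_, fun n x i => ?_⟩
    · refine ((hC0 (c n • x)).trans (le_abs_self _)).trans ?_
      rw [add_assoc]
      exact le_add_of_nonneg_right (by positivity)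
    have p1 : |C1 i| ≤ ∑ i, |C1 i| :=
      Finset.single_le_sum (fun i _ => abs_nonneg (C1 i)) (Finset.mem_univ i)
    have p2 : |C2 i| ≤ ∑ i, |C2 i| :=
      Finset.single_le_sum (fun i _ => abs_nonneg (C2 i)) (Finset.mem_univ i)
    have q1 := (hC1 i (c n • x)).trans (le_abs_self _)
    have q2 := (hC2 i (c n • x)).trans (le_abs_self _)
    have r0 := abs_nonneg C0
    have r1 := abs_nonneg (C1 i)
    have r2 := abs_nonneg (C2 i)
    refine ⟨?_, ?_⟩
    · rw [e1, norm_mul]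
      have := mul_le_of_le_one_left (norm_nonneg (pd i g (c n • x))) (hcn n)
      linarith
    · rw [e2, norm_mul, norm_mul]
      have := mul_le_of_le_one_left (norm_nonneg (pd i (pd i g) (c n • x))) (hcn n)
      have := mul_le_of_le_one_left (mul_nonneg (norm_nonneg (c n : ℂ))
        (norm_nonneg (pd i (pd i g) (c n • x)))) (hcn n)
      linarith
  · intro x
    have h1 : Tendsto (fun n => c n • x) atTop (𝓝 0) := by simpa using hclim.smul_const x
    have h2 := (hg.1.continuous.tendsto 0).comp h1
    have : g 0 = 1 := by
      simp only [g]
      rw [β.one_of_mem_closedBall (by simp [β])]; simp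
    rwa [this] at h2
  · intro x i
    simp_rw [e1]
    exact hbz _ (C1 i) fun n => hC1 i _
  · intro x i
    simp_rw [e2]
    refine hbz _ (C2 i) fun n => ?_
    rw [norm_mul]
    exact (mul_le_of_le_one_left (norm_nonneg _) (hcn n)).trans (hC2 i _)

lemma ExpBdd.norm {f : RN N → ℂ} (hf : ExpBdd f) : ExpBdd fun x => ((‖f x‖ : ℝ) : ℂ) :=
  ⟨Complex.continuous_ofReal.comp hf.1.norm, by simpa using hf.2⟩

lemma L2mu_norm_sq_eq (f : L2mu N) : ((‖f‖ ^ 2 : ℝ) : ℂ) =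
    ∫ x, ((‖f x‖ ^ 2 : ℝ) : ℂ) ∂gaussMeasure N := by
  have h := inner_self_eq_norm_sq_to_K (𝕜 := ℂ) f
  rw [L2.inner_def] at h
  rw [Complex.ofReal_pow]
  refine h.symm.trans (integral_congr_ae (Eventually.of_forall fun x => ?_))
  have := inner_self_eq_norm_sq_to_K (𝕜 := ℂ) (f x)
  simp only
  rw [this]; simp

/-- |F_n - f|² ≤ 4G², which is integrable because G grows at most exponentially. The squares are
integrated as complex functions to reuse `ExpBdd`. -/
lemma tendsto_toLp_of_dominated {F : ℕ → RN N → ℂ} {f : RN N → ℂ} {G : RN N → ℝ}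
    (hF : ∀ n, MemLp (F n) 2 (gaussMeasure N)) (hf : MemLp f 2 (gaussMeasure N))
    (hG : ExpBdd fun x => (G x : ℂ)) (hb : ∀ n x, ‖F n x‖ ≤ G x)
    (hlim : ∀ x, Tendsto (fun n => F n x) atTop (𝓝 (f x))) :
    Tendsto (fun n => (hF n).toLp (F n)) atTop (𝓝 (hf.toLp f)) := by
  have hfb : ∀ x, ‖f x‖ ≤ G x := fun x => le_of_tendsto' (hlim x).norm fun n => hb n x
  have key : Tendsto (fun n => ∫ x, ((‖F n x - f x‖ ^ 2 : ℝ) : ℂ) ∂gaussMeasure N) atTop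
      (𝓝 (∫ _, (0 : ℂ) ∂gaussMeasure N)) := by
    refine tendsto_integral_of_dominated_convergence (fun x => ‖(4 : ℂ) * ((G x : ℂ) * (G x : ℂ))‖)
      (fun n => ?_) ((ExpBdd.const 4).mul (hG.mul hG)).integrable.norm (fun n => ?_) ?_
    · have h1 : AEStronglyMeasurable (fun x => F n x - f x) (gaussMeasure N) := (hF n).1.sub hf.1
      exact Complex.continuous_ofReal.comp_aestronglyMeasurable (h1.norm.pow 2)
    · refine Eventually.of_forall fun x => ?_
      have h1 : ‖F n x - f x‖ ≤ 2 * G x := (norm_sub_le _ _).trans (by linarith [hb n x, hfb x])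
      rw [Complex.norm_real, norm_pow, norm_norm, norm_mul, norm_mul, Complex.norm_real,
        Real.norm_of_nonneg ((norm_nonneg _).trans (hfb x))]
      calc _ ≤ (2 * G x) ^ 2 := by gcongr
        _ = _ := by norm_num; ring
    · refine Eventually.of_forall fun x => ?_
      have h1 := ((tendsto_iff_norm_sub_tendsto_zero.1 (hlim x)).pow 2)
      have h2 := (Complex.continuous_ofReal.tendsto _).comp h1
      simpa [Function.comp_def] using h2
  have e : ∀ n, ∫ x, ((‖F n x - f x‖ ^ 2 : ℝ) : ℂ) ∂gaussMeasure N =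
      ((‖(hF n).toLp (F n) - hf.toLp f‖ ^ 2 : ℝ) : ℂ) := by
    intro n
    rw [L2mu_norm_sq_eq]
    refine integral_congr_ae ?_
    filter_upwards [(hF n).coeFn_toLp, hf.coeFn_toLp,
      Lp.coeFn_sub ((hF n).toLp (F n)) (hf.toLp f)] with x h1 h2 h3
    rw [h3, Pi.sub_apply, h1, h2]
  simp_rw [e, integral_zero] at key
  have key2 := (Complex.continuous_re.tendsto _).comp key
  simp only [Function.comp_def, Complex.ofReal_re, Complex.zero_re] at key2
  rw [tendsto_iff_norm_sub_tendsto_zero]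
  simpa [Real.sqrt_sq (norm_nonneg _)] using key2.sqrt

end Cutoff

/-! ### The graph of the Ornstein-Uhlenbeck operator -/

section Graph
variable {N : ℕ}

lemma toLp_mem_ouGraph {φ : RN N → ℂ} (hφ : IsTest φ) :
    (MemLp.toLp φ hφ.expBdd.memLp, MemLp.toLp (ouExpr φ) hφ.ouExpr.expBdd.memLp) ∈ ouGraph N :=
  Submodule.le_topologicalClosure _ (Submodule.subset_span
    ⟨φ, hφ, MemLp.coeFn_toLp hφ.expBdd.memLp, MemLp.coeFn_toLp hφ.ouExpr.expBdd.memLp⟩)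

/-- The graph is closed, so it suffices to approximate f by χ_n f with cutoffs χ_n. In L(χ_n f) the
terms containing derivatives of χ_n tend to 0 and the rest tends to Lf, under a common exponential
bound. -/
lemma toLp_mem_ouGraph_of_expBdd {f : RN N → ℂ} (hf : Tame f)
    (hf2 : ∀ i, ExpBdd (pd i (pd i f))) (hL : ExpBdd (ouExpr f)) :
    (hf.2.1.memLp.toLp f, hL.memLp.toLp (ouExpr f)) ∈ ouGraph N := by
  obtain ⟨χ, hχ, ⟨C, hC0, hCχ, hC⟩, l0, l1, l2⟩ := exists_cutoff N
  have ht : ∀ n, IsTest fun x => χ n x * f x := fun n => by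
    simpa [mul_comm] using (hχ n).mul_left hf.1
  have e1 : ∀ n i, pd i (fun x => χ n x * f x) =
      fun x => pd i (χ n) x * f x + χ n x * pd i f x := fun n i => funext fun x =>
    pd_mul i ((hχ n).differentiable x) (hf.differentiable x)
  have hfd : ∀ i, Differentiable ℝ (pd i f) := fun i =>
    (contDiff_pd i hf.1).differentiable (by simp)
  have e2 : ∀ n i, pd i (pd i (fun x => χ n x * f x)) =
      fun x => pd i (pd i (χ n)) x * f x + 2 * (pd i (χ n) x * pd i f x) +
        χ n x * pd i (pd i f) x := by
    intro n i
    rw [e1]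
    ext x
    have d1 : DifferentiableAt ℝ (fun y => pd i (χ n) y * f y) x :=
      (((hχ n).pd i).differentiable.mul hf.differentiable) x
    have d2 : DifferentiableAt ℝ (fun y => χ n y * pd i f y) x :=
      ((hχ n).differentiable.mul (hfd i)) x
    rw [pd_add i d1 d2, pd_mul i (((hχ n).pd i).differentiable x) (hf.differentiable x),
      pd_mul i ((hχ n).differentiable x) (hfd i x)]
    ring
  have hL' : ∀ n x, ouExpr (fun x => χ n x * f x) x =
      ∑ i, ((pd i (pd i (χ n)) x * f x + 2 * (pd i (χ n) x * pd i f x) +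
        χ n x * pd i (pd i f) x) - (x i : ℂ) * (pd i (χ n) x * f x + χ n x * pd i f x)) := by
    intro n x
    rw [ouExpr_eq (ht n).1]
    refine Finset.sum_congr rfl fun i _ => ?_
    rw [e2, e1]
  refine (Submodule.isClosed_topologicalClosure _).mem_of_tendsto
    (Tendsto.prodMk_nhds (tendsto_toLp_of_dominated (fun n => (ht n).expBdd.memLp) hf.2.1.memLp
      (G := fun x => C * ‖f x‖) ?_ ?_ ?_)
    (tendsto_toLp_of_dominated (fun n => (ht n).ouExpr.expBdd.memLp) hL.memLp
      (G := fun x => ∑ i, (C * ‖f x‖ + 2 * (C * ‖pd i f x‖) + C * ‖pd i (pd i f) x‖ +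
        ‖(x i : ℂ)‖ * (C * ‖f x‖ + C * ‖pd i f x‖))) ?_ ?_ ?_))
    (Eventually.of_forall fun n => ?_)
  · simpa using (ExpBdd.const C).mul hf.2.1.norm
  · intro n x
    rw [norm_mul]
    gcongr
    exact hCχ n x
  · intro x
    simpa using (l0 x).mul_const (f x)
  · have h2 : ExpBdd fun x => ∑ i, ((C : ℂ) * (‖f x‖ : ℝ) + 2 * ((C : ℂ) * (‖pd i f x‖ : ℝ)) +
        (C : ℂ) * (‖pd i (pd i f) x‖ : ℝ) +
        (‖(x i : ℂ)‖ : ℝ) * ((C : ℂ) * (‖f x‖ : ℝ) + (C : ℂ) * (‖pd i f x‖ : ℝ))) :=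
      ExpBdd.sum _ fun i _ => ((((ExpBdd.const C).mul hf.2.1.norm).add
        ((ExpBdd.const 2).mul ((ExpBdd.const C).mul (hf.2.2 i).norm))).add
        ((ExpBdd.const C).mul (hf2 i).norm)).add ((ExpBdd.coord i).norm.mul
        (((ExpBdd.const C).mul hf.2.1.norm).add ((ExpBdd.const C).mul (hf.2.2 i).norm)))
    convert h2 using 2 with x
    push_cast
    rfl
  · intro n x
    rw [hL']
    refine (norm_sum_le _ _).trans (Finset.sum_le_sum fun i _ => ?_)
    have c0 := hCχ n x
    obtain ⟨c1, c2⟩ := hC n x i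
    refine (norm_sub_le _ _).trans (add_le_add ((norm_add₃_le).trans ?_) ?_)
    · rw [norm_mul, norm_mul, norm_mul, norm_mul, Complex.norm_ofNat]
      gcongr
    · rw [norm_mul]
      gcongr
      refine (norm_add_le _ _).trans ?_
      rw [norm_mul, norm_mul]
      gcongr
  · intro x
    simp_rw [hL', ouExpr_eq hf.1]
    refine tendsto_finsetSum _ fun i _ => ?_
    have t0 := l0 x
    have t1 := l1 x i
    have t2 := l2 x i
    have := (((t2.mul_const (f x)).add ((t1.mul_const (pd i f x)).const_mul 2)).add
      (t0.mul_const (pd i (pd i f) x))).sub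
      (((t1.mul_const (f x)).add (t0.mul_const (pd i f x))).const_mul (x i : ℂ))
    simpa using this
  · exact toLp_mem_ouGraph (ht n)

lemma hermL_mem_ouGraph (α : Fin N → ℕ) : (hermL α, -(deg α : ℂ) • hermL α) ∈ ouGraph N := by
  have hL : ExpBdd (ouExpr (herm α)) := by
    rw [funext (ouExpr_herm α)]
    exact (ExpBdd.const _).mul (expBdd_herm α)
  have h := toLp_mem_ouGraph_of_expBdd (tame_herm α) (fun i => ?_) hL
  · have e : hL.memLp.toLp (ouExpr (herm α)) = -(deg α : ℂ) • hermL α := by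
      rw [hermL, ← MemLp.toLp_const_smul]
      exact MemLp.toLp_congr _ _ (ae_of_all _ fun x => ouExpr_herm α x)
    rwa [e] at h
  · have h1 : pd i (herm α) = fun x => (√(α i) : ℂ) * herm (α - Pi.single i 1) x :=
      funext (pd_herm i α)
    have h2 : pd i (pd i (herm α)) =
        fun x => (√(α i) : ℂ) * pd i (herm (α - Pi.single i 1)) x := by
      ext x
      rw [h1, pd_mul i (differentiableAt_const _) ((tame_herm _).differentiable x)]
      simp [pd]
    rw [h2]
    exact (ExpBdd.const _).mul ((tame_herm _).2.2 i)

lemma tame_pd_herm (i : Fin N) (α : Fin N → ℕ) : Tame (pd i (herm α)) := by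
  have h1 : pd i (herm α) = fun x => (√(α i) : ℂ) * herm (α - Pi.single i 1) x :=
    funext (pd_herm i α)
  refine ⟨contDiff_pd i (contDiff_herm α), ?_, fun j => ?_⟩
  · rw [h1]
    exact (ExpBdd.const _).mul (expBdd_herm _)
  · have h2 : pd j (pd i (herm α)) =
        fun x => (√(α i) : ℂ) * pd j (herm (α - Pi.single i 1)) x := by
      ext x
      rw [h1, pd_mul j (differentiableAt_const _) ((tame_herm _).differentiable x)]
      simp [pd]
    rw [h2]
    exact (ExpBdd.const _).mul ((tame_herm _).2.2 j)

/-- Two integrations by parts carry (x_i - ∂_i)∂_i from φ to h_α, where it is multiplication by α_i.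
-/
lemma integral_herm_mul_ouExpr (α : Fin N → ℕ) {φ : RN N → ℂ} (hφ : IsTest φ) :
    ∫ x, herm α x * ouExpr φ x ∂gaussMeasure N =
      -(deg α : ℂ) * ∫ x, herm α x * φ x ∂gaussMeasure N := by
  have e : ∀ x, herm α x * ouExpr φ x = ∑ i, -(herm α x * dl i (pd i φ) x) := by
    intro x
    rw [ouExpr_eq hφ.1, Finset.mul_sum]
    refine Finset.sum_congr rfl fun i _ => ?_
    rw [dl]; ring
  simp_rw [e]
  rw [integral_finsetSum]
  · have h : ∀ i, ∫ x, -(herm α x * dl i (pd i φ) x) ∂gaussMeasure N =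
        -((α i : ℂ) * ∫ x, herm α x * φ x ∂gaussMeasure N) := by
      intro i
      rw [integral_neg, ← gauss_integral_by_parts (tame_herm α) (hφ.pd i).tame]
      simp_rw [mul_comm (pd i (herm α) _)]
      rw [gauss_integral_by_parts hφ.tame (tame_pd_herm i α)]
      have e : ∀ x, φ x * dl i (pd i (herm α)) x = (α i : ℂ) * (herm α x * φ x) := fun x => by
        rw [dl_pd_herm]; ring
      simp_rw [e]
      rw [integral_const_mul]
    simp_rw [h, Finset.sum_neg_distrib, ← Finset.sum_mul, deg]
    push_cast
    ring
  · intro i _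
    exact ((expBdd_herm α).mul ((hφ.pd i).tame.expBdd_dl i)).neg.integrable

/-- For each α the coefficient relation defines a closed subspace that contains the generators of
the graph. Conversely, a pair satisfying all the relations is the limit of finite combinations of
the pairs (h_α, -|α|h_α), which lie in the closed graph. -/
lemma mem_ouGraph_iff {u f : L2mu N} : (u, f) ∈ ouGraph N ↔
    ∀ α, (hermBasis N).repr f α = -(deg α : ℂ) * (hermBasis N).repr u α := by
  constructor
  · intro h α
    let G : Submodule ℂ (L2mu N × L2mu N) :=
      { carrier := {p | (hermBasis N).repr p.2 α = -(deg α : ℂ) * (hermBasis N).repr p.1 α}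
        add_mem' := by
          intro p q hp hq
          simp only [mem_ofPred_eq, Prod.snd_add, Prod.fst_add, map_add, lp.coeFn_add,
            Pi.add_apply] at *
          rw [hp, hq]; ring
        zero_mem' := by simp
        smul_mem' := by
          intro c p hp
          simp only [mem_ofPred_eq, Prod.smul_snd, Prod.smul_fst, map_smul, lp.coeFn_smul,
            Pi.smul_apply, smul_eq_mul] at *
          rw [hp]; ring }
    have hc : IsClosed (G : Set (L2mu N × L2mu N)) :=
      isClosed_eq (((hermBasis N).continuous_repr α).comp continuous_snd)
        (continuous_const.mul (((hermBasis N).continuous_repr α).comp continuous_fst))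
    refine Submodule.topologicalClosure_minimal _ (Submodule.span_le.2 ?_) hc h
    rintro ⟨p1, p2⟩ ⟨φ, hφ, h1, h2⟩
    change (hermBasis N).repr p2 α = -(deg α : ℂ) * (hermBasis N).repr p1 α
    rw [hermBasis_repr, hermBasis_repr]
    refine (integral_congr_ae (h2.mono fun x hx => ?_)).trans
      ((integral_herm_mul_ouExpr α hφ).trans (congrArg _ (integral_congr_ae
        (h1.mono fun x hx => ?_))))
    · simp only at hx ⊢; rw [hx]
    · simp only at hx ⊢; rw [hx]
  · intro h
    have hs := ((hermBasis N).hasSum_repr u).prodMk ((hermBasis N).hasSum_repr f)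
    refine (Submodule.isClosed_topologicalClosure _).mem_of_tendsto hs
      (Eventually.of_forall fun s => sum_mem fun α _ => ?_)
    rw [h α, hermBasis_apply]
    have := (ouGraph N).smul_mem ((hermBasis N).repr u α) (hermL_mem_ouGraph α)
    rw [Prod.smul_mk, smul_smul, mul_comm ((hermBasis N).repr u α)] at this
    exact this

/-- `toLinearPMap` represents the relation only if it is single-valued; for `ouGraph` and
`biOUGraph` the coefficient descriptions supply this. -/
lemma Submodule.mem_iff_toLinearPMap {H : Type*} [AddCommGroup H] [Module ℂ H]
    {g : Submodule ℂ (H × H)} (hg : ∀ x ∈ g, x.1 = 0 → x.2 = 0) {u f : H} :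
    (∃ hu : u ∈ g.toLinearPMap.domain, g.toLinearPMap ⟨u, hu⟩ = f) ↔ (u, f) ∈ g := by
  have h := g.toLinearPMap_graph_eq hg
  conv_rhs => rw [← h, LinearPMap.mem_graph_iff]
  constructor
  · rintro ⟨hu, hf⟩
    exact ⟨⟨u, hu⟩, rfl, hf⟩
  · rintro ⟨⟨y, hy⟩, h1, h2⟩
    simp only at h1 h2
    subst h1
    exact ⟨hy, h2⟩

lemma ouOp_iff {u f : L2mu N} : (∃ hu : u ∈ (ouOp N).domain, ouOp N ⟨u, hu⟩ = f) ↔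
    ∀ α, (hermBasis N).repr f α = -(deg α : ℂ) * (hermBasis N).repr u α := by
  rw [← mem_ouGraph_iff]
  refine Submodule.mem_iff_toLinearPMap ?_
  rintro ⟨u, f⟩ h h0
  simp only at h0
  subst h0
  refine (hermBasis N).repr_injective' fun α => ?_
  simp [mem_ouGraph_iff.1 h α]

lemma repr_ouOp (u : (ouOp N).domain) (α : Fin N → ℕ) :
    (hermBasis N).repr (ouOp N u) α = -(deg α : ℂ) * (hermBasis N).repr (u : L2mu N) α :=
  ouOp_iff.1 ⟨u.2, rfl⟩ α

/-- Testing the form with v = h_α yields the coefficients of f. Conversely, the relation puts u into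
D(L), and Parseval verifies the form identity for every v in D(L). -/
lemma mem_biOUGraph_iff {u f : L2mu N} : (u, f) ∈ biOUGraph N ↔
    ∀ α, (hermBasis N).repr f α = (deg α : ℂ) ^ 2 * (hermBasis N).repr u α := by
  have hinner : ∀ v w : L2mu N, HasSum (fun α => starRingEnd ℂ ((hermBasis N).repr v α) *
      (hermBasis N).repr w α) (inner ℂ v w) := fun v w => by
    have := (hermBasis N).hasSum_inner_mul_inner v w
    simp_rw [HilbertBasis.repr_apply_apply, inner_conj_symm]
    exact this
  constructor
  · rintro ⟨u', hu', h⟩ α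
    simp only at hu' h
    subst hu'
    obtain ⟨hα, hα'⟩ := ouOp_iff.2 fun β => (mem_ouGraph_iff.1 (hermL_mem_ouGraph α) β)
    have h1 : inner ℂ (ouOp N ⟨hermL α, hα⟩) (ouOp N u') = inner ℂ (hermL α) f :=
      h ⟨hermL α, hα⟩
    rw [hα', inner_smul_left, ← hermBasis_apply, ← HilbertBasis.repr_apply_apply,
      ← HilbertBasis.repr_apply_apply, repr_ouOp] at h1
    rw [← h1]
    simp
    ring
  · intro h
    -- `g` is going to be Lu; its coefficients are square summable because d² ≤ 1 + d⁴.
    obtain ⟨g, hg⟩ := (hermBasis N).exists_repr_eq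
      (a := fun α => -(deg α : ℂ) * (hermBasis N).repr u α) (by
        refine Summable.of_nonneg_of_le (fun α => by positivity) (fun α => ?_)
          (((hermBasis N).hasSum_repr_sq u).summable.add ((hermBasis N).hasSum_repr_sq f).summable)
        rw [h α, norm_mul, norm_mul, norm_neg, norm_pow, mul_pow, mul_pow, ← one_add_mul]
        gcongr
        nlinarith [sq_nonneg (‖(deg α : ℂ)‖ ^ 2), sq_nonneg (‖(deg α : ℂ)‖ ^ 2 - 1)])
    obtain ⟨hu, hu'⟩ := ouOp_iff.2 hg
    refine ⟨⟨u, hu⟩, rfl, fun v => ?_⟩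
    have e : (fun α => starRingEnd ℂ ((hermBasis N).repr (ouOp N v) α) *
        (hermBasis N).repr (ouOp N ⟨u, hu⟩) α) =
        fun α => starRingEnd ℂ ((hermBasis N).repr (v : L2mu N) α) * (hermBasis N).repr f α := by
      ext α
      rw [repr_ouOp, repr_ouOp, h α]
      simp
      ring
    have h1 := hinner (ouOp N v) (ouOp N ⟨u, hu⟩)
    rw [e] at h1
    exact h1.unique (hinner _ _)

lemma biOU_iff {u f : L2mu N} : (∃ hu : u ∈ (biOU N).domain, biOU N ⟨u, hu⟩ = f) ↔
    ∀ α, (hermBasis N).repr f α = (deg α : ℂ) ^ 2 * (hermBasis N).repr u α := by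
  rw [← mem_biOUGraph_iff]
  refine Submodule.mem_iff_toLinearPMap ?_
  rintro ⟨u, f⟩ h h0
  simp only at h0
  subst h0
  refine (hermBasis N).repr_injective' fun α => ?_
  simp [mem_biOUGraph_iff.1 h α]

end Graph

end

noncomputable section

/-! ### Weak derivatives -/

section Weak
variable {N : ℕ} {u v u' v' : RN N → ℂ} {i j : Fin N}

lemma MeasureTheory.LocallyIntegrable.integrable_mul_test (hu : LocallyIntegrable u) {φ : RN N → ℂ}
    (hφ : IsTest φ) : Integrable fun x => u x * φ x := by
  simpa [mul_comm] using
    hu.integrable_smul_left_of_hasCompactSupport hφ.1.continuous hφ.2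

lemma ae_eq_of_integral_mul_test (hu : LocallyIntegrable u) (hv : LocallyIntegrable v)
    (h : ∀ φ : RN N → ℂ, IsTest φ → ∫ x, u x * φ x = ∫ x, v x * φ x) : u =ᵐ[volume] v := by
  refine ae_eq_of_integral_contDiff_smul_eq hu hv fun g hg hg' => ?_
  have := h (fun x => (g x : ℂ)) ⟨Complex.ofRealCLM.contDiff.comp hg,
    hg'.comp_left (g := fun r : ℝ => (r : ℂ)) Complex.ofReal_zero⟩
  simpa [mul_comm] using this

lemma HasWeakPartial.integral_pd (h : HasWeakPartial i u v) {φ : RN N → ℂ} (hφ : IsTest φ) :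
    ∫ x, u x * pd i φ x = -∫ x, v x * φ x := h.2.2 φ hφ

lemma HasWeakPartial.ae_unique (h : HasWeakPartial i u v) (h' : HasWeakPartial i u v') :
    v =ᵐ[volume] v' := by
  refine ae_eq_of_integral_mul_test h.2.1 h'.2.1 fun φ hφ => ?_
  have h1 := h.integral_pd hφ
  rw [h'.integral_pd hφ, neg_inj] at h1
  exact h1.symm

lemma HasWeakPartial.congr (h : HasWeakPartial i u v) (hu : u =ᵐ[volume] u')
    (hv : v =ᵐ[volume] v') : HasWeakPartial i u' v' := by
  refine ⟨h.1.congr hu, h.2.1.congr hv, fun φ hφ => ?_⟩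
  have e1 : ∫ x, u x * pd i φ x = ∫ x, u' x * pd i φ x :=
    integral_congr_ae (hu.mono fun x hx => by simp only [hx])
  have e2 : ∫ x, v x * φ x = ∫ x, v' x * φ x :=
    integral_congr_ae (hv.mono fun x hx => by simp only [hx])
  change ∫ x, u' x * pd i φ x = _
  rw [← e1, ← e2, h.integral_pd hφ]

lemma HasWeakPartial.hasWeakPartial_wD (h : HasWeakPartial i u v) :
    HasWeakPartial i u (wD i u) := by
  have h' : ∃ v, HasWeakPartial i u v := ⟨v, h⟩
  rw [wD, dif_pos h']
  exact h'.choose_spec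

lemma HasWeakPartial.wD_ae_eq (h : HasWeakPartial i u v) : wD i u =ᵐ[volume] v :=
  h.hasWeakPartial_wD.ae_unique h

lemma HasWeakPartial.add (h : HasWeakPartial i u v) (h' : HasWeakPartial i u' v') :
    HasWeakPartial i (fun x => u x + u' x) fun x => v x + v' x := by
  refine ⟨h.1.add h'.1, h.2.1.add h'.2.1, fun φ hφ => ?_⟩
  change ∫ x, (u x + u' x) * pd i φ x = _
  simp_rw [add_mul]
  rw [integral_add (h.1.integrable_mul_test (hφ.pd i)) (h'.1.integrable_mul_test (hφ.pd i)),
    integral_add (h.2.1.integrable_mul_test hφ) (h'.2.1.integrable_mul_test hφ),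
    h.integral_pd hφ, h'.integral_pd hφ, neg_add]

lemma HasWeakPartial.neg (h : HasWeakPartial i u v) :
    HasWeakPartial i (fun x => -u x) fun x => -v x := by
  refine ⟨h.1.neg, h.2.1.neg, fun φ hφ => ?_⟩
  simp_rw [neg_mul, integral_neg]
  rw [h.2.2 φ hφ]

lemma HasWeakPartial.sub (h : HasWeakPartial i u v) (h' : HasWeakPartial i u' v') :
    HasWeakPartial i (fun x => u x - u' x) fun x => v x - v' x := by
  simpa [sub_eq_add_neg] using h.add h'.neg

lemma HasWeakPartial.zero : HasWeakPartial i (fun _ : RN N => (0 : ℂ)) fun _ => 0 :=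
  ⟨locallyIntegrable_const 0, locallyIntegrable_const 0, fun φ _ => by simp⟩

lemma HasWeakPartial.sum {ι : Type*} (s : Finset ι) {U V : ι → RN N → ℂ}
    (h : ∀ j ∈ s, HasWeakPartial i (U j) (V j)) :
    HasWeakPartial i (fun x => ∑ j ∈ s, U j x) fun x => ∑ j ∈ s, V j x := by
  classical
  induction s using Finset.induction_on with
  | empty => simpa using HasWeakPartial.zero
  | insert a s ha ih =>
    simp_rw [Finset.sum_insert ha]
    exact (h a (by simp)).add (ih fun k hk => h k (by simp [hk]))

lemma MeasureTheory.LocallyIntegrable.coord_mul (hu : LocallyIntegrable u) (j : Fin N) :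
    LocallyIntegrable fun x => (x j : ℂ) * u x :=
  hu.continuous_mul (contDiff_coord j).continuous

lemma HasWeakPartial.coord_mul (h : HasWeakPartial i u v) (j : Fin N) :
    HasWeakPartial i (fun x => (x j : ℂ) * u x)
      fun x => (if j = i then 1 else 0) * u x + (x j : ℂ) * v x := by
  have hl : LocallyIntegrable fun x => (if j = i then (1 : ℂ) else 0) * u x :=
    h.1.continuous_mul continuous_const
  refine ⟨h.1.coord_mul j, hl.add (h.2.1.coord_mul j), fun φ hφ => ?_⟩
  have h1 := h.integral_pd (hφ.mul_left (contDiff_coord j))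
  have e : ∀ x, u x * pd i (fun y => (y j : ℂ) * φ y) x =
      (if j = i then 1 else 0) * u x * φ x + (x j : ℂ) * u x * pd i φ x := fun x => by
    rw [pd_mul i ((contDiff_coord j).differentiable (by simp) x) (hφ.differentiable x), pd_coord]
    ring
  simp_rw [e] at h1
  rw [integral_add (hl.integrable_mul_test hφ)
    ((h.1.coord_mul j).integrable_mul_test (hφ.pd i))] at h1
  simp_rw [add_mul]
  rw [integral_add (hl.integrable_mul_test hφ) ((h.2.1.coord_mul j).integrable_mul_test hφ)]
  have e2 : ∀ x, v x * ((x j : ℂ) * φ x) = (x j : ℂ) * v x * φ x := fun x => by ring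
  simp_rw [e2] at h1
  refine (eq_sub_of_add_eq' h1).trans ?_
  ring

/-- Both mixed derivatives, tested against φ, equal the integral of u against a mixed derivative of
φ, where the order is irrelevant. -/
lemma HasWeakPartial.comm {w w' : RN N → ℂ} (h1 : HasWeakPartial i u v)
    (h2 : HasWeakPartial j v w) (h3 : HasWeakPartial j u v') (h4 : HasWeakPartial i v' w') :
    w =ᵐ[volume] w' := by
  refine ae_eq_of_integral_mul_test h2.2.1 h4.2.1 fun φ hφ => ?_
  have a := h2.integral_pd hφ
  have b := h1.integral_pd (hφ.pd j)
  have c := h4.integral_pd hφ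
  have d := h3.integral_pd (hφ.pd i)
  simp_rw [pd_comm i j hφ.1] at b
  rw [← neg_inj, ← a, ← c, ← neg_inj, ← b, ← d]

end Weak

/-! ### Hermite coefficients and Sobolev spaces -/

section Sobolev
variable {N : ℕ} {u v : RN N → ℂ} {i : Fin N}

lemma MeasureTheory.MemLp.locallyIntegrable_of_gauss (hu : MemLp u 2 (gaussMeasure N)) :
    LocallyIntegrable u := by
  have h1 : Integrable (fun x => (gw x : ℂ) * u x) :=
    integrable_gauss_iff.1 (hu.integrable (by norm_num))
  have hc : Continuous fun x : RN N => (gw x : ℂ)⁻¹ :=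
    (Complex.continuous_ofReal.comp continuous_gw).inv₀ gw_ne_zero
  refine (h1.locallyIntegrable.continuous_mul hc).congr (Eventually.of_forall fun x => ?_)
  simp only
  rw [inv_mul_cancel_left₀ (gw_ne_zero x)]

/-- The Hermite coefficients of a function. -/
def hc (u : RN N → ℂ) (α : Fin N → ℕ) : ℂ := ∫ x, herm α x * u x ∂gaussMeasure N

lemma hc_congr (h : u =ᵐ[gaussMeasure N] v) (α : Fin N → ℕ) : hc u α = hc v α :=
  integral_congr_ae (h.mono fun x hx => by simp only; rw [hx])

lemma hc_eq_repr (f : L2mu N) (α : Fin N → ℕ) : hc f α = (hermBasis N).repr f α :=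
  (hermBasis_repr f α).symm

lemma summable_hc_sq (hu : MemLp u 2 (gaussMeasure N)) : Summable fun α => ‖hc u α‖ ^ 2 := by
  simpa only [hermBasis_repr_toLp, hc] using ((hermBasis N).hasSum_repr_sq (hu.toLp u)).summable

lemma hasSum_hc_mul (hu : MemLp u 2 (gaussMeasure N)) (hv : MemLp v 2 (gaussMeasure N)) :
    HasSum (fun α => hc u α * hc v α) (∫ x, u x * v x ∂gaussMeasure N) := by
  have hu' : MemLp (fun x => starRingEnd ℂ (u x)) 2 (gaussMeasure N) := hu.star
  have h := (hermBasis N).hasSum_inner_mul_inner (hu'.toLp _) (hv.toLp v)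
  have e1 : inner ℂ (hu'.toLp _) (hv.toLp v) = ∫ x, u x * v x ∂gaussMeasure N := by
    rw [L2.inner_def]
    refine integral_congr_ae ?_
    filter_upwards [hu'.coeFn_toLp, hv.coeFn_toLp] with x h1 h2
    rw [h1, h2, RCLike.inner_apply, Complex.conj_conj, mul_comm]
  have e2 : ∀ α, inner ℂ (hu'.toLp _) (hermBasis N α) * inner ℂ (hermBasis N α) (hv.toLp v) =
      hc u α * hc v α := by
    intro α
    rw [← HilbertBasis.repr_apply_apply, hermBasis_repr_toLp, ← inner_conj_symm,
      ← HilbertBasis.repr_apply_apply, hermBasis_repr_toLp, ← integral_conj]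
    congr 1
    refine integral_congr_ae (Eventually.of_forall fun x => ?_)
    simp [conj_herm]
  rw [e1] at h
  simpa only [e2] using h

lemma exists_hc_eq {a : (Fin N → ℕ) → ℂ} (ha : Summable fun α => ‖a α‖ ^ 2) :
    ∃ v : RN N → ℂ, MemLp v 2 (gaussMeasure N) ∧ ∀ α, hc v α = a α := by
  obtain ⟨f, hf⟩ := (hermBasis N).exists_repr_eq ha
  exact ⟨f, Lp.memLp f, fun α => by rw [hc_eq_repr, hf]⟩

lemma hc_pd_test {ψ : RN N → ℂ} (hψ : IsTest ψ) (i : Fin N) (α : Fin N → ℕ) :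
    hc (dl i ψ) α = (√(α i) : ℂ) * hc ψ (α - Pi.single i 1) := by
  unfold hc
  rw [← gauss_integral_by_parts (tame_herm α) hψ.tame]
  simp_rw [pd_herm, mul_assoc]
  rw [integral_const_mul]

lemma injective_add_single (i : Fin N) :
    Function.Injective fun α : Fin N → ℕ => α + Pi.single i 1 := fun a b h => by
  simpa using h

lemma notMem_range_add_single {i : Fin N} {β : Fin N → ℕ}
    (hβ : β ∉ range fun α : Fin N → ℕ => α + Pi.single i 1) : β i = 0 := by
  by_contra h
  exact hβ ⟨β - Pi.single i 1, sub_add_single h⟩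

/-- For the forward direction the test functions γχ_n h_α are used, and the cutoff is removed by
dominated convergence. For the converse, an arbitrary test function is written as γψ, and Parseval
reduces the weak identity to a shift of the summation index. -/
lemma hasWeakPartial_iff_hc (hu : MemLp u 2 (gaussMeasure N)) (hv : MemLp v 2 (gaussMeasure N)) :
    HasWeakPartial i u v ↔
      ∀ α, hc v α = (√((α i : ℝ) + 1) : ℂ) * hc u (α + Pi.single i 1) := by
  constructor
  · intro h α
    obtain ⟨χ, hχ, ⟨C, hC0, hCχ, hC⟩, l0, l1, -⟩ := exists_cutoff N
    have ht : ∀ n, IsTest fun x => χ n x * herm α x := fun n => by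
      simpa [mul_comm] using (hχ n).mul_left (contDiff_herm α)
    have key : ∀ n, ∫ x, (χ n x * dl i (herm α) x - pd i (χ n) x * herm α x) * u x
        ∂gaussMeasure N = ∫ x, χ n x * herm α x * v x ∂gaussMeasure N := by
      intro n
      have h1 := h.integral_pd (ht n).gw_mul
      simp_rw [pd_gw_mul (ht n).differentiable, dl,
        pd_mul i ((hχ n).differentiable _) ((tame_herm α).differentiable _), mul_neg] at h1
      rw [integral_neg, neg_inj] at h1
      rw [integral_gauss, integral_gauss]
      convert h1 using 3
      · simp only [dl]; ring
      · ring
    have lim1 : Tendsto (fun n => ∫ x, (χ n x * dl i (herm α) x - pd i (χ n) x * herm α x) * u x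
        ∂gaussMeasure N) atTop (𝓝 (∫ x, dl i (herm α) x * u x ∂gaussMeasure N)) := by
      refine tendsto_integral_of_dominated_convergence
        (fun x => ‖((C : ℂ) * (‖dl i (herm α) x‖ : ℝ) + (C : ℂ) * (‖herm α x‖ : ℝ)) * u x‖)
        (fun n => ?_) (ExpBdd.integrable_mul (((ExpBdd.const C).mul
          ((tame_herm α).expBdd_dl i).norm).add ((ExpBdd.const C).mul (expBdd_herm α).norm))
          hu).norm (fun n => ?_) ?_
      · refine AEStronglyMeasurable.mul (Continuous.aestronglyMeasurable ?_) hu.1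
        exact ((hχ n).1.continuous.mul ((tame_herm α).expBdd_dl i).1).sub
          (((hχ n).pd i).1.continuous.mul (expBdd_herm α).1)
      · refine Eventually.of_forall fun x => ?_
        rw [norm_mul, norm_mul]
        gcongr
        rw [← Complex.ofReal_mul, ← Complex.ofReal_mul, ← Complex.ofReal_add, Complex.norm_real,
          Real.norm_of_nonneg (by positivity)]
        refine (norm_sub_le _ _).trans ?_
        rw [norm_mul, norm_mul]
        gcongr
        · exact hCχ n x
        · exact (hC n x i).1
      · refine Eventually.of_forall fun x => ?_
        have := (((l0 x).mul_const (dl i (herm α) x)).sub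
          ((l1 x i).mul_const (herm α x))).mul_const (u x)
        simpa using this
    have lim2 : Tendsto (fun n => ∫ x, χ n x * herm α x * v x ∂gaussMeasure N) atTop
        (𝓝 (∫ x, herm α x * v x ∂gaussMeasure N)) := by
      refine tendsto_integral_of_dominated_convergence
        (fun x => ‖((C : ℂ) * herm α x) * v x‖)
        (fun n => ?_) (ExpBdd.integrable_mul ((ExpBdd.const C).mul (expBdd_herm α)) hv).norm
        (fun n => ?_) ?_
      · exact AEStronglyMeasurable.mul (((hχ n).1.continuous.mul
          (expBdd_herm α).1).aestronglyMeasurable) hv.1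
      · refine Eventually.of_forall fun x => ?_
        rw [norm_mul, norm_mul, norm_mul, norm_mul, Complex.norm_real, Real.norm_of_nonneg hC0]
        gcongr
        exact hCχ n x
      · refine Eventually.of_forall fun x => ?_
        simpa using ((l0 x).mul_const (herm α x)).mul_const (v x)
    simp_rw [key] at lim1
    have := tendsto_nhds_unique lim2 lim1
    rw [hc, this]
    simp_rw [dl_herm, mul_assoc]
    rw [integral_const_mul, hc]
  · intro h
    refine ⟨hu.locallyIntegrable_of_gauss, hv.locallyIntegrable_of_gauss,
      fun φ hφ => ?_⟩
    have hψ := hφ.gw_inv_mul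
    set ψ : RN N → ℂ := fun x => (gw x : ℂ)⁻¹ * φ x with hψd
    have e : φ = fun x => (gw x : ℂ) * ψ x := by
      ext x
      simp only [hψd]
      rw [mul_inv_cancel_left₀ (gw_ne_zero x)]
    have h1 : ∫ x, u x * pd i φ x = -∫ x, u x * dl i ψ x ∂gaussMeasure N := by
      rw [integral_gauss, ← integral_neg]
      refine integral_congr_ae (Eventually.of_forall fun x => ?_)
      simp only
      rw [e, pd_gw_mul hψ.differentiable]
      ring
    have h2 : ∫ x, v x * φ x = ∫ x, v x * ψ x ∂gaussMeasure N := by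
      rw [integral_gauss]
      refine integral_congr_ae (Eventually.of_forall fun x => ?_)
      simp only
      rw [e]
      ring
    change ∫ x, u x * pd i φ x = _
    rw [h1, h2, neg_inj]
    have s1 := hasSum_hc_mul hu (hψ.tame.expBdd_dl i).memLp
    have s2 := hasSum_hc_mul hv hψ.expBdd.memLp
    -- Only indices of the form α + e_i contribute: if β_i = 0, then the coefficient of (x_i - ∂_i)ψ
    -- at β is 0.
    rw [← (injective_add_single i).hasSum_iff] at s1
    · have e2 : (fun α => hc u α * hc (dl i ψ) α) ∘ (fun α : Fin N → ℕ => α + Pi.single i 1) =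
          fun α => hc v α * hc ψ α := by
        ext α
        simp only [Function.comp]
        rw [hc_pd_test hψ, add_sub_single, h α]
        simp only [Pi.add_apply, Pi.single_eq_same, Nat.cast_add, Nat.cast_one]
        ring
      rw [e2] at s1
      exact s1.unique s2
    · intro β hβ
      rw [hc_pd_test hψ, notMem_range_add_single hβ]
      simp

/-! ### Sobolev spaces as weighted ℓ² spaces of Hermite coefficients -/

lemma MemSobolev.memLp {m : ℕ} (h : MemSobolev m u) : MemLp u 2 (gaussMeasure N) := by
  cases m with
  | zero => exact h
  | succ m => exact h.1

/-- Under β = α + e_i the factor α_i + 1 becomes β_i, and summing over i gives |β|. One more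
derivative thus costs one power of the degree; the term β = 0, which no shift reaches, is covered by
summability of c. -/
lemma summable_pow_succ_iff (c : (Fin N → ℕ) → ℝ) (hc0 : ∀ α, 0 ≤ c α) (hcs : Summable c)
    (m : ℕ) : Summable (fun α => ((deg α : ℝ) + 1) ^ (m + 1) * c α) ↔
      ∀ i, Summable fun α : Fin N → ℕ =>
        ((deg α : ℝ) + 1) ^ m * (((α i : ℝ) + 1) * c (α + Pi.single i 1)) := by
  constructor
  · intro h i
    refine Summable.of_nonneg_of_le (fun α => mul_nonneg (by positivity)
      (mul_nonneg (by positivity) (hc0 _))) (fun α => ?_)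
      (h.comp_injective (injective_add_single i))
    simp only [Function.comp, deg_add_single]
    rw [pow_succ, ← mul_assoc]
    have h1 : (α i : ℝ) ≤ deg α := by
      exact_mod_cast Finset.single_le_sum (f := α) (fun _ _ => Nat.zero_le _) (Finset.mem_univ i)
    have h0 := hc0 (α + Pi.single i 1)
    push_cast
    gcongr <;> linarith
  · intro h
    have h1 : ∀ i, Summable fun β : Fin N → ℕ => ((deg β : ℝ) + 1) ^ m * ((β i : ℝ) * c β) := by
      intro i
      rw [← (injective_add_single i).summable_iff]
      -- The shift raises the degree by one, and |α| + 2 ≤ 2(|α| + 1) accounts for the factor 2^m.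
      · refine Summable.of_nonneg_of_le (fun α => mul_nonneg (by positivity)
          (mul_nonneg (by positivity) (hc0 _))) (fun α => ?_) ((h i).mul_left (2 ^ m))
        have h0 := hc0 (α + Pi.single i 1)
        simp only [Function.comp, deg_add_single, Pi.add_apply, Pi.single_eq_same]
        rw [← mul_assoc (2 ^ m : ℝ), ← mul_pow]
        push_cast
        gcongr
        linarith [Nat.cast_nonneg (α := ℝ) (deg α)]
      · intro β hβ
        rw [notMem_range_add_single hβ]
        simp
    refine Summable.of_nonneg_of_le (fun β => mul_nonneg (by positivity) (hc0 _)) (fun β => ?_)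
      (hcs.add ((summable_sum (s := Finset.univ) fun i _ => h1 i).mul_left 2))
    rw [← Finset.mul_sum, ← Finset.sum_mul]
    have hd : ∑ i, (β i : ℝ) = deg β := by simp [deg]
    rw [hd]
    -- The summand 1 handles degree 0; for positive degree, |β| + 1 ≤ 2|β|.
    have key : ((deg β : ℝ) + 1) ^ (m + 1) ≤ 1 + 2 * (((deg β : ℝ) + 1) ^ m * deg β) := by
      rcases Nat.eq_zero_or_pos (deg β) with h0 | h0
      · simp [h0]
      · have h2 : (1 : ℝ) ≤ deg β := by exact_mod_cast h0
        rw [pow_succ]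
        have h3 : 0 ≤ ((deg β : ℝ) + 1) ^ m := by positivity
        nlinarith
    calc _ ≤ (1 + 2 * (((deg β : ℝ) + 1) ^ m * deg β)) * c β := by
          have := hc0 β; gcongr
      _ = _ := by ring

lemma memSobolev_iff (m : ℕ) : MemSobolev m u ↔
    MemLp u 2 (gaussMeasure N) ∧ Summable fun α => ((deg α : ℝ) + 1) ^ m * ‖hc u α‖ ^ 2 := by
  induction m generalizing u with
  | zero =>
    simp only [pow_zero, one_mul]
    exact ⟨fun h => ⟨h, summable_hc_sq h⟩, fun h => h.1⟩
  | succ m ih =>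
    have hnorm : ∀ (i : Fin N) (α : Fin N → ℕ),
        ‖(√((α i : ℝ) + 1) : ℂ) * hc u (α + Pi.single i 1)‖ ^ 2 =
          ((α i : ℝ) + 1) * ‖hc u (α + Pi.single i 1)‖ ^ 2 := fun i α => by
      rw [norm_mul, mul_pow, Complex.norm_real, Real.norm_of_nonneg (by positivity),
        Real.sq_sqrt (by positivity)]
    constructor
    · rintro ⟨hu, h⟩
      refine ⟨hu, (summable_pow_succ_iff _ (fun α => by positivity) (summable_hc_sq hu) m).2
        fun i => ?_⟩
      obtain ⟨v, hv, hv'⟩ := h i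
      obtain ⟨hvL, hvs⟩ := ih.1 hv'
      have h1 := (hasWeakPartial_iff_hc hu hvL).1 hv
      simpa only [h1, hnorm] using hvs
    · rintro ⟨hu, h⟩
      refine ⟨hu, fun i => ?_⟩
      have h1 := (summable_pow_succ_iff _ (fun α => by positivity) (summable_hc_sq hu) m).1 h i
      simp only [← hnorm] at h1
      obtain ⟨v, hv, hvc⟩ := exists_hc_eq
        (a := fun α => (√((α i : ℝ) + 1) : ℂ) * hc u (α + Pi.single i 1)) (by
          refine Summable.of_nonneg_of_le (fun α => by positivity) (fun α => ?_) h1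
          refine le_mul_of_one_le_left (by positivity) (one_le_pow₀ ?_)
          linarith [Nat.cast_nonneg (α := ℝ) (deg α)])
      refine ⟨v, (hasWeakPartial_iff_hc hu hv).2 hvc, ih.2 ⟨hv, ?_⟩⟩
      simpa only [hvc] using h1

lemma mem_domain_biOU_iff (u : L2mu N) :
    u ∈ (biOU N).domain ↔ MemSobolev 4 (u : RN N → ℂ) := by
  have h1 : u ∈ (biOU N).domain ↔ ∃ f, ∀ α,
      (hermBasis N).repr f α = (deg α : ℂ) ^ 2 * (hermBasis N).repr u α := by
    simp_rw [← biOU_iff]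
    exact ⟨fun h => ⟨_, h, rfl⟩, fun ⟨f, h, _⟩ => h⟩
  have hn : ∀ α, ‖(deg α : ℂ) ^ 2 * (hermBasis N).repr u α‖ ^ 2 =
      (deg α : ℝ) ^ 4 * ‖(hermBasis N).repr u α‖ ^ 2 := fun α => by
    rw [norm_mul, norm_pow, Complex.norm_natCast]; ring
  rw [h1, memSobolev_iff]
  simp_rw [hc_eq_repr]
  constructor
  · rintro ⟨f, hf⟩
    refine ⟨Lp.memLp u, ?_⟩
    have hs := ((hermBasis N).hasSum_repr_sq f).summable
    simp_rw [hf, hn] at hs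
    -- The constant 8 comes from (d + 1)⁴ ≤ 8(d⁴ + 1).
    refine Summable.of_nonneg_of_le (fun α => by positivity) (fun α => ?_)
      ((hs.add ((hermBasis N).hasSum_repr_sq u).summable).mul_left 8)
    rw [← add_one_mul, ← mul_assoc]
    gcongr
    nlinarith [sq_nonneg ((deg α : ℝ) - 1), sq_nonneg ((deg α : ℝ) ^ 2 - 1),
      sq_nonneg ((deg α : ℝ) + 1), sq_nonneg ((deg α : ℝ) ^ 2 - deg α)]
  · rintro ⟨-, hs⟩
    refine (hermBasis N).exists_repr_eq ?_
    simp_rw [hn]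
    refine Summable.of_nonneg_of_le (fun α => by positivity) (fun α => ?_) hs
    gcongr
    linarith

end Sobolev

end

noncomputable section

/-! ### The explicit expression of the bi-Ornstein-Uhlenbeck operator -/

section Expression
variable {N : ℕ} {u v f g : RN N → ℂ} {m : ℕ}

lemma MemSobolev.congr (h : MemSobolev m u) (huv : u =ᵐ[volume] v) : MemSobolev m v := by
  rw [← ae_gauss] at huv
  rw [memSobolev_iff] at h ⊢
  refine ⟨(memLp_congr_ae huv).1 h.1, ?_⟩
  simpa only [← hc_congr huv] using h.2

lemma MemSobolev.hasWeakPartial (h : MemSobolev (m + 1) u) (i : Fin N) :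
    HasWeakPartial i u (wD i u) := (h.2 i).choose_spec.1.hasWeakPartial_wD

lemma MemSobolev.wD (h : MemSobolev (m + 1) u) (i : Fin N) : MemSobolev m (wD i u) := by
  obtain ⟨v, hv, hv'⟩ := h.2 i
  exact hv'.congr hv.wD_ae_eq.symm

lemma hc_ouExpr {ψ : RN N → ℂ} (hψ : IsTest ψ) (α : Fin N → ℕ) :
    hc (ouExpr ψ) α = -(deg α : ℂ) * hc ψ α := integral_herm_mul_ouExpr α hψ

/-- This identifies the diagonal operator with a differential expression on H². Writing a test
function as φ = γψ, Parseval moves multiplication by -|α| onto ψ as L, and the weak derivatives of u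
bring it back. -/
lemma ae_eq_of_hc_eq_neg_deg (hu : MemSobolev 2 u) (hf : MemLp f 2 (gaussMeasure N))
    (h : ∀ α, hc f α = -(deg α : ℂ) * hc u α) :
    f =ᵐ[volume] fun x => wLap u x - ∑ i, (x i : ℂ) * wD i u x := by
  have h1 : ∀ i, HasWeakPartial i u (wD i u) := hu.hasWeakPartial
  have h2 : ∀ i, HasWeakPartial i (wD i u) (wD i (wD i u)) := fun i => (hu.wD i).hasWeakPartial i
  have hl : ∀ i, LocallyIntegrable fun x => wD i (wD i u) x - (x i : ℂ) * wD i u x := fun i =>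
    (h2 i).2.1.sub ((h1 i).2.1.coord_mul i)
  have e : (fun x => wLap u x - ∑ i, (x i : ℂ) * wD i u x) =
      fun x => ∑ i, (wD i (wD i u) x - (x i : ℂ) * wD i u x) := by
    ext x
    rw [wLap, Finset.sum_sub_distrib]
  rw [e]
  refine ae_eq_of_integral_mul_test hf.locallyIntegrable_of_gauss
    (locallyIntegrable_finsetSum _ fun i _ => hl i) fun φ hφ => ?_
  have hψ := hφ.gw_inv_mul
  set ψ : RN N → ℂ := fun x => (gw x : ℂ)⁻¹ * φ x with hψd
  have eφ : φ = fun x => (gw x : ℂ) * ψ x := by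
    ext x
    simp only [hψd]
    rw [mul_inv_cancel_left₀ (gw_ne_zero x)]
  have hL : ∫ x, f x * φ x = ∫ x, u x * ouExpr ψ x ∂gaussMeasure N := by
    have s1 := hasSum_hc_mul hf hψ.expBdd.memLp
    have s2 := hasSum_hc_mul hu.memLp hψ.ouExpr.expBdd.memLp
    simp_rw [hc_ouExpr hψ] at s2
    simp_rw [h] at s1
    have e2 : ∀ α, hc u α * (-(deg α : ℂ) * hc ψ α) = -(deg α : ℂ) * hc u α * hc ψ α :=
      fun α => by ring
    simp_rw [e2] at s2
    rw [← s1.unique s2, integral_gauss]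
    refine integral_congr_ae (Eventually.of_forall fun x => ?_)
    simp only
    rw [eφ]
    ring
  -- One derivative is moved by testing with φ, the other by testing with γ∂_iψ = ∂_iφ + x_iφ; the
  -- term x_iφ accounts for the drift.
  have hR : ∀ i, ∫ x, (wD i (wD i u) x - (x i : ℂ) * wD i u x) * φ x =
      -∫ x, u x * dl i (pd i ψ) x ∂gaussMeasure N := by
    intro i
    have t1 : IsTest fun x => (gw x : ℂ) * pd i ψ x := (hψ.pd i).gw_mul
    have a1 := (h2 i).integral_pd hφ
    have a2 := (h1 i).integral_pd t1
    have e1 : ∀ x, (gw x : ℂ) * pd i ψ x = pd i φ x + (x i : ℂ) * φ x := fun x => by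
      rw [eφ, pd_gw_mul hψ.differentiable, dl]
      ring
    have e3 : ∀ x, u x * pd i (fun y => (gw y : ℂ) * pd i ψ y) x =
        -((gw x : ℂ) * (u x * dl i (pd i ψ) x)) := fun x => by
      rw [pd_gw_mul (hψ.pd i).differentiable]; ring
    simp_rw [e3] at a2
    rw [integral_neg, ← integral_gauss, neg_inj] at a2
    rw [a2]
    simp_rw [e1, mul_add, sub_mul]
    rw [integral_add ((h1 i).2.1.integrable_mul_test (hφ.pd i))
      ((h1 i).2.1.integrable_mul_test (hφ.mul_left (contDiff_coord i))), a1,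
      integral_sub ((h2 i).2.1.integrable_mul_test hφ)
        (((h1 i).2.1.coord_mul i).integrable_mul_test hφ)]
    have e4 : ∀ x, wD i u x * ((x i : ℂ) * φ x) = (x i : ℂ) * wD i u x * φ x := fun x => by ring
    simp_rw [e4]
    ring
  rw [hL]
  simp_rw [Finset.sum_mul]
  rw [integral_finsetSum _ fun i _ => (hl i).integrable_mul_test hφ]
  simp_rw [hR]
  have e5 : ∀ x, u x * ouExpr ψ x = ∑ i, -(dl i (pd i ψ) x * u x) := by
    intro x
    rw [ouExpr_eq hψ.1, Finset.mul_sum]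
    refine Finset.sum_congr rfl fun i _ => ?_
    rw [dl]; ring
  simp_rw [e5]
  have hi : ∀ i ∈ Finset.univ, Integrable (fun x => -(dl i (pd i ψ) x * u x))
      (gaussMeasure N) := fun i _ =>
    (ExpBdd.integrable_mul ((hψ.pd i).tame.expBdd_dl i) hu.memLp).neg
  rw [integral_finsetSum _ hi]
  simp_rw [integral_neg, mul_comm]

lemma wD_wD_wD_comm (hu : MemSobolev 4 u) (i j : Fin N) :
    wD i (wD i (wD j u)) =ᵐ[volume] wD j (wD i (wD i u)) := by
  have hij : wD i (wD j u) =ᵐ[volume] wD j (wD i u) :=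
    (hu.hasWeakPartial j).comm ((hu.wD j).hasWeakPartial i) (hu.hasWeakPartial i)
      ((hu.wD i).hasWeakPartial j)
  have h1 : HasWeakPartial i (wD j (wD i u)) (wD i (wD i (wD j u))) :=
    (((hu.wD j).wD i).hasWeakPartial i).congr hij (ae_eq_refl _)
  exact ((hu.wD i).hasWeakPartial j).comm h1 ((hu.wD i).hasWeakPartial i)
    (((hu.wD i).wD i).hasWeakPartial j)

/-- Factor A = L²: the function g with coefficients -|α|u_α is Lu and lies in H², and f = Lg.
Substituting g = Δu - x·∇u into Δg - x·∇g and using the product rule gives the stated expression. -/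
lemma ae_eq_biOUExpr (hu : MemSobolev 4 u) (hf : MemLp f 2 (gaussMeasure N))
    (h : ∀ α, hc f α = (deg α : ℂ) ^ 2 * hc u α) : f =ᵐ[volume] biOUExpr u := by
  have hus := ((memSobolev_iff 4).1 hu).2
  have hn : ∀ α, ‖-(deg α : ℂ) * hc u α‖ ^ 2 = (deg α : ℝ) ^ 2 * ‖hc u α‖ ^ 2 := fun α => by
    rw [norm_mul, norm_neg, Complex.norm_natCast]; ring
  have hle : ∀ α : Fin N → ℕ, (deg α : ℝ) ^ 2 ≤ ((deg α : ℝ) + 1) ^ 2 := fun α => by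
    gcongr; linarith
  have hone : ∀ α : Fin N → ℕ, (1 : ℝ) ≤ ((deg α : ℝ) + 1) ^ 2 := fun α =>
    one_le_pow₀ (by linarith [Nat.cast_nonneg (α := ℝ) (deg α)])
  -- Since |α|²(|α|+1)² ≤ (|α|+1)⁴, four derivatives of u leave two for Lu.
  have hsum : Summable fun α => ((deg α : ℝ) + 1) ^ 2 * ‖-(deg α : ℂ) * hc u α‖ ^ 2 := by
    refine Summable.of_nonneg_of_le (fun α => by positivity) (fun α => ?_) hus
    rw [hn, ← mul_assoc, show ((deg α : ℝ) + 1) ^ 4 = (deg α + 1) ^ 2 * (deg α + 1) ^ 2 by ring]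
    have := hle α
    gcongr
  obtain ⟨g, hg, hgc⟩ := exists_hc_eq (a := fun α => -(deg α : ℂ) * hc u α)
    (Summable.of_nonneg_of_le (fun α => by positivity)
      (fun α => le_mul_of_one_le_left (by positivity) (hone α)) hsum)
  have hg2 : MemSobolev 2 g := (memSobolev_iff 2).2 ⟨hg, by simpa only [hgc] using hsum⟩
  have hu2 : MemSobolev 2 u := (memSobolev_iff 2).2 ⟨hu.memLp,
    Summable.of_nonneg_of_le (fun α => by positivity) (fun α => by
      rw [show ((deg α : ℝ) + 1) ^ 4 = (deg α + 1) ^ 2 * (deg α + 1) ^ 2 by ring, mul_assoc]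
      exact le_mul_of_one_le_left (by positivity) (hone α)) hus⟩
  have hgu := ae_eq_of_hc_eq_neg_deg hu2 hg hgc
  have hfg := ae_eq_of_hc_eq_neg_deg hg2 hf fun α => by rw [h, hgc]; ring
  have d1 : ∀ i, HasWeakPartial i u (wD i u) := hu.hasWeakPartial
  have d2 : ∀ i j, HasWeakPartial i (wD j u) (wD i (wD j u)) := fun i j =>
    (hu.wD j).hasWeakPartial i
  have d3 : ∀ i j k, HasWeakPartial i (wD j (wD k u)) (wD i (wD j (wD k u))) := fun i j k =>
    ((hu.wD k).wD j).hasWeakPartial i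
  have d4 : ∀ i j k l, HasWeakPartial i (wD j (wD k (wD l u))) (wD i (wD j (wD k (wD l u)))) :=
    fun i j k l => (((hu.wD l).wD k).wD j).hasWeakPartial i
  have w1 : ∀ i, HasWeakPartial i (wLap u) fun x => ∑ j, wD i (wD j (wD j u)) x := fun i =>
    HasWeakPartial.sum _ fun j _ => d3 i j j
  have w2 : ∀ i, HasWeakPartial i (wD i (wLap u)) (wD i (wD i (wLap u))) := fun i =>
    ((HasWeakPartial.sum Finset.univ fun j _ => d4 i i j j).congr (w1 i).wD_ae_eq.symm
      (ae_eq_refl _)).hasWeakPartial_wD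
  have g1 : ∀ i, HasWeakPartial i g fun x =>
      wD i (wLap u) x - (wD i u x + ∑ j, (x j : ℂ) * wD i (wD j u) x) := by
    intro i
    have h1 := ((w1 i).hasWeakPartial_wD).sub
      (HasWeakPartial.sum Finset.univ fun j _ => (d2 i j).coord_mul j)
    refine h1.congr hgu.symm (Eventually.of_forall fun x => ?_)
    simp [Finset.sum_add_distrib]
  have g2 : ∀ i, HasWeakPartial i (wD i g) fun x => wD i (wD i (wLap u)) x -
      (2 * wD i (wD i u) x + ∑ j, (x j : ℂ) * wD i (wD i (wD j u)) x) := by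
    intro i
    have h1 := (w2 i).sub ((d2 i i).add
      (HasWeakPartial.sum Finset.univ fun j _ => (d3 i i j).coord_mul j))
    refine h1.congr (g1 i).wD_ae_eq.symm (Eventually.of_forall fun x => ?_)
    simp [Finset.sum_add_distrib]
    ring
  have a1 : ∀ᵐ x : RN N, ∀ i, wD i g x =
      wD i (wLap u) x - (wD i u x + ∑ j, (x j : ℂ) * wD i (wD j u) x) :=
    ae_all_iff.2 fun i => (g1 i).wD_ae_eq
  have a2 : ∀ᵐ x : RN N, ∀ i, wD i (wD i g) x = wD i (wD i (wLap u)) x -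
      (2 * wD i (wD i u) x + ∑ j, (x j : ℂ) * wD i (wD i (wD j u)) x) :=
    ae_all_iff.2 fun i => (g2 i).wD_ae_eq
  have a3 : ∀ᵐ x : RN N, ∀ j, wD j (wLap u) x = ∑ i, wD j (wD i (wD i u)) x :=
    ae_all_iff.2 fun j => (w1 j).wD_ae_eq
  have a4 : ∀ᵐ x : RN N, ∀ i j, wD i (wD i (wD j u)) x = wD j (wD i (wD i u)) x :=
    ae_all_iff.2 fun i => ae_all_iff.2 fun j => wD_wD_wD_comm hu i j
  filter_upwards [hfg, a1, a2, a3, a4] with x hx b1 b2 b3 b4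
  rw [hx, biOUExpr]
  -- This is Δ(x·∇u) = 2Δu + x·∇Δu; the third weak derivatives have to be commuted before the sum
  -- over i can be recognized as ∂_jΔu.
  have c1 : wLap g x = wLap (wLap u) x - (2 * wLap u x + ∑ j, (x j : ℂ) * wD j (wLap u) x) := by
    simp only [wLap] at b3 ⊢
    simp_rw [b2, Finset.sum_sub_distrib, Finset.sum_add_distrib, ← Finset.mul_sum]
    congr 2
    rw [Finset.sum_comm]
    refine Finset.sum_congr rfl fun j _ => ?_
    rw [b3, Finset.mul_sum]
    exact Finset.sum_congr rfl fun i _ => by rw [b4]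
  have c2 : ∑ i, (x i : ℂ) * wD i g x = ∑ i, (x i : ℂ) * wD i (wLap u) x -
      (∑ i, (x i : ℂ) * wD i u x +
        ∑ i, ∑ j, (x i : ℂ) * (x j : ℂ) * wD i (wD j u) x) := by
    rw [← Finset.sum_add_distrib, ← Finset.sum_sub_distrib]
    refine Finset.sum_congr rfl fun i _ => ?_
    rw [b1, mul_sub, mul_add, Finset.mul_sum]
    simp_rw [mul_assoc]
  rw [c1, c2]
  ring

lemma biOU_apply_ae_eq (u : (biOU N).domain) :
    (biOU N u : RN N → ℂ) =ᵐ[gaussMeasure N] biOUExpr ((u : L2mu N) : RN N → ℂ) := by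
  rw [ae_gauss]
  refine ae_eq_biOUExpr ((mem_domain_biOU_iff _).1 u.2) (Lp.memLp _) fun α => ?_
  rw [hc_eq_repr, hc_eq_repr]
  exact biOU_iff.1 ⟨u.2, rfl⟩ α

lemma neg_biOU_iff (u v : L2mu N) :
    (∃ hu : u ∈ (-(biOU N)).domain, (-(biOU N)) ⟨u, hu⟩ = v) ↔
      ∀ α, (hermBasis N).repr v α =
        -(((deg α : ℝ) ^ 2 : ℝ) : ℂ) * (hermBasis N).repr u α := by
  have h := biOU_iff (u := u) (f := -v)
  have e : (∃ hu : u ∈ (-(biOU N)).domain, (-(biOU N)) ⟨u, hu⟩ = v) ↔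
      ∃ hu : u ∈ (biOU N).domain, biOU N ⟨u, hu⟩ = -v := by
    constructor
    · rintro ⟨hu, h⟩
      exact ⟨hu, by rw [← h]; simp [LinearPMap.neg_apply]⟩
    · rintro ⟨hu, h⟩
      exact ⟨hu, by rw [LinearPMap.neg_apply]; simp [h]⟩
  rw [e, h]
  refine forall_congr' fun α => ?_
  simp only [map_neg, lp.coeFn_neg, Pi.neg_apply, Complex.ofReal_pow, Complex.ofReal_natCast,
    neg_mul]
  exact neg_eq_iff_eq_neg

end Expression

end

noncomputable section

/-! ### Gaussian moments and the one-dimensional Mehler formula -/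

lemma Complex.ofReal_mul_cpow {a : ℝ} (ha : 0 < a) (z s : ℂ) :
    ((a : ℂ) * z) ^ s = (a : ℂ) ^ s * z ^ s := by
  have ha' : (a : ℂ) ≠ 0 := by exact_mod_cast ha.ne'
  by_cases hz : z = 0
  · subst hz
    by_cases hs : s = 0
    · simp [hs]
    · simp [Complex.zero_cpow hs]
  · rw [Complex.cpow_def_of_ne_zero (mul_ne_zero ha' hz), Complex.cpow_def_of_ne_zero ha',
      Complex.cpow_def_of_ne_zero hz, Complex.log_ofReal_mul ha hz, ← Complex.exp_add,
      Complex.ofReal_log ha.le, add_mul]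

section Mehler1D

/-- The standard Gaussian density on `ℝ`. -/
def gw1 (s : ℝ) : ℝ := (2 * Real.pi) ^ (-(1 / 2) : ℝ) * Real.exp (-s ^ 2 / 2)

lemma gw1_pos (s : ℝ) : 0 < gw1 s := by unfold gw1; positivity

lemma continuous_gw1 : Continuous gw1 := by unfold gw1; fun_prop

lemma ofReal_gw1 (s : ℝ) :
    (gw1 s : ℂ) = (2 * Real.pi : ℂ) ^ (-(1 / 2) : ℂ) * Complex.exp (-(s : ℂ) ^ 2 / 2) := by
  unfold gw1
  rw [Complex.ofReal_mul, Complex.ofReal_cpow (by positivity)]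
  push_cast
  rfl

lemma exp_mul_gw1 (b c d : ℂ) (s : ℝ) :
    Complex.exp (b * (s : ℂ) ^ 2 + c * s + d) * gw1 s = (2 * Real.pi : ℂ) ^ (-(1 / 2) : ℂ) *
      Complex.exp ((b - 1 / 2) * (s : ℂ) ^ 2 + c * s + d) := by
  rw [ofReal_gw1, mul_left_comm, ← Complex.exp_add]
  congr 2
  ring

lemma integrable_exp_mul_gw1 {b : ℂ} (hb : b.re < 1 / 2) (c d : ℂ) :
    Integrable fun s : ℝ => Complex.exp (b * (s : ℂ) ^ 2 + c * s + d) * gw1 s := by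
  simp_rw [exp_mul_gw1]
  exact (integrable_cexp_quadratic' (by simp; linarith) c d).const_mul _

lemma integral_exp_mul_gw1 {b : ℂ} (hb : b.re < 1 / 2) (c d : ℂ) :
    ∫ s : ℝ, Complex.exp (b * (s : ℂ) ^ 2 + c * s + d) * gw1 s =
      (2 * Real.pi : ℂ) ^ (-(1 / 2) : ℂ) * ((Real.pi / (1 / 2 - b)) ^ (1 / 2 : ℂ) *
        Complex.exp (d + c ^ 2 / (4 * (1 / 2 - b)))) := by
  simp_rw [exp_mul_gw1]
  rw [integral_const_mul, integral_cexp_quadratic (by simp; linarith)]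
  rw [neg_sub, ← neg_sub (1 / 2 : ℂ) b, mul_neg, div_neg, sub_neg_eq_add]

lemma integrable_exp_abs_mul_gw1 {b : ℝ} (hb : b < 1 / 2) (a d : ℝ) :
    Integrable fun s : ℝ => Real.exp (b * s ^ 2 + a * |s| + d) * gw1 s := by
  have h : ∀ a : ℝ, Integrable fun s : ℝ => Real.exp (b * s ^ 2 + a * s + d) * gw1 s := fun a => by
    have := (integrable_exp_mul_gw1 (b := b) (by simpa using hb) a d).norm
    refine this.congr (Eventually.of_forall fun s => ?_)
    simp only
    rw [norm_mul, Complex.norm_exp, Complex.norm_real, Real.norm_of_nonneg (gw1_pos s).le]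
    congr 2
    norm_cast
  refine ((h a).add (h (-a))).mono' ?_ (Eventually.of_forall fun s => ?_)
  · have := continuous_gw1
    exact Continuous.aestronglyMeasurable (by fun_prop)
  · have h0 := gw1_pos s
    rw [Real.norm_of_nonneg (by positivity), Pi.add_apply, ← add_mul]
    refine mul_le_mul_of_nonneg_right ?_ h0.le
    have e1 := Real.exp_pos (b * s ^ 2 + a * s + d)
    have e2 := Real.exp_pos (b * s ^ 2 + -a * s + d)
    rcases abs_cases s with ⟨hs, _⟩ | ⟨hs, _⟩
    · rw [hs]; linarith
    · rw [hs, mul_neg, ← neg_mul]; linarith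

/-- The Gaussian moments `∫ (y + κ s)^n dγ(s)`. -/
def gmom (κ y : ℂ) (n : ℕ) : ℂ := ∫ s : ℝ, (y + κ * s) ^ n * gw1 s

lemma norm_add_mul_le (κ y : ℂ) (s : ℝ) : ‖y + κ * s‖ ≤ ‖y‖ + ‖κ‖ * |s| := by
  refine (norm_add_le _ _).trans ?_
  rw [norm_mul, Complex.norm_real, Real.norm_eq_abs]

lemma pow_le_factorial_mul_exp {r : ℝ} (hr : 0 ≤ r) (n : ℕ) : r ^ n ≤ n.factorial * Real.exp r := by
  have := Real.pow_div_factorial_le_exp r hr n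
  rwa [div_le_iff₀' (by positivity)] at this

lemma integrable_gmom (κ y : ℂ) (n : ℕ) : Integrable fun s : ℝ => (y + κ * s) ^ n * (gw1 s : ℂ) := by
  refine ((integrable_exp_abs_mul_gw1 (b := 0) (by norm_num) ‖κ‖ ‖y‖).const_mul
    (n.factorial : ℝ)).mono' ?_ (Eventually.of_forall fun s => ?_)
  · have := continuous_gw1
    exact Continuous.aestronglyMeasurable (by fun_prop)
  · rw [norm_mul, norm_pow, Complex.norm_real, Real.norm_of_nonneg (gw1_pos s).le, ← mul_assoc]
    refine mul_le_mul_of_nonneg_right ?_ (gw1_pos s).le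
    refine (pow_le_pow_left₀ (norm_nonneg _) (norm_add_mul_le κ y s) n).trans ?_
    refine (pow_le_factorial_mul_exp (by positivity) n).trans (le_of_eq ?_)
    congr 2
    ring

lemma gmom_zero (κ y : ℂ) : gmom κ y 0 = 1 := by
  have h := integral_exp_mul_gw1 (b := 0) (by norm_num) 0 0
  simp only [zero_mul, add_zero, Complex.exp_zero, one_mul] at h
  simp only [gmom, pow_zero, one_mul]
  rw [h]
  have h2 : (Real.pi / (1 / 2 - 0) : ℂ) = 2 * Real.pi := by ring
  rw [h2, Complex.cpow_neg]
  simp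

/-- Integration by parts in s, since s times the density is minus its derivative. For κ = i this is
the Hermite recursion, and for κ = 1 its analogue with all signs positive. -/
lemma gmom_succ (κ y : ℂ) (n : ℕ) :
    gmom κ y (n + 1) = y * gmom κ y n + κ ^ 2 * n * gmom κ y (n - 1) := by
  have hd : ∀ s : ℝ, HasDerivAt (fun s : ℝ => (gw1 s : ℂ)) (-(s : ℂ) * gw1 s) s := by
    intro s
    have h1 : HasDerivAt gw1 (-s * gw1 s) s := by
      have := ((((hasDerivAt_id s).pow 2).neg.div_const 2).exp).const_mul
        ((2 * Real.pi) ^ (-(1 / 2) : ℝ))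
      refine this.congr_deriv ?_
      simp [gw1]
      ring
    exact h1.ofReal_comp.congr_deriv (by push_cast; rfl)
  have hp : ∀ s : ℝ, HasDerivAt (fun s : ℝ => (y + κ * s) ^ n) (n * (y + κ * s) ^ (n - 1) * κ) s := by
    intro s
    have h1 : HasDerivAt (fun s : ℝ => y + κ * s) κ s := by
      simpa using ((Complex.ofRealCLM.hasDerivAt (x := s)).const_mul κ).const_add y
    exact h1.pow n
  have i1 := integrable_gmom κ y n
  have i2 := integrable_gmom κ y (n + 1)
  have i3 := integrable_gmom κ y (n - 1)
  have i4 : Integrable fun s : ℝ => κ * (s * ((y + κ * s) ^ n * (gw1 s : ℂ))) := by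
    refine (i2.sub (i1.const_mul y)).congr (Eventually.of_forall fun s => ?_)
    simp only [Pi.sub_apply]; ring
  -- Integrability of s(y + κs)^n times the density is obtained by dividing by κ, so κ = 0 is
  -- treated separately.
  by_cases hκ : κ = 0
  · subst hκ
    simp only [gmom, zero_mul, add_zero]
    rw [integral_const_mul, integral_const_mul]
    simp [pow_succ]; ring
  have i5 : Integrable fun s : ℝ => s * ((y + κ * s) ^ n * (gw1 s : ℂ)) := by
    refine (i4.const_mul κ⁻¹).congr (Eventually.of_forall fun s => ?_)
    simp only
    rw [inv_mul_cancel_left₀ hκ]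
  have hibp := integral_mul_deriv_eq_deriv_mul_of_integrable (u := fun s : ℝ => (y + κ * s) ^ n)
    (v := fun s : ℝ => (gw1 s : ℂ)) (fun s _ => hp s) (fun s _ => hd s) ?_ ?_ i1
  · have e1 : gmom κ y (n + 1) = y * gmom κ y n +
        κ * ∫ s : ℝ, s * ((y + κ * s) ^ n * (gw1 s : ℂ)) := by
      unfold gmom
      rw [← integral_const_mul, ← integral_const_mul, ← integral_add (i1.const_mul y) i4]
      refine integral_congr_ae (Eventually.of_forall fun s => ?_)
      simp only; ring
    have e2 : ∫ s : ℝ, s * ((y + κ * s) ^ n * (gw1 s : ℂ)) = κ * n * gmom κ y (n - 1) := by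
      have e3 : ∀ s : ℝ, (y + κ * s) ^ n * (-(s : ℂ) * gw1 s) =
          -(s * ((y + κ * s) ^ n * (gw1 s : ℂ))) := fun s => by ring
      have e4 : ∀ s : ℝ, n * (y + κ * s) ^ (n - 1) * κ * (gw1 s : ℂ) =
          κ * n * ((y + κ * s) ^ (n - 1) * (gw1 s : ℂ)) := fun s => by ring
      simp_rw [e3, e4] at hibp
      rw [integral_neg, integral_const_mul, neg_inj] at hibp
      exact hibp
    rw [e1, e2]
    ring
  · refine i5.neg.congr (Eventually.of_forall fun s => ?_)
    simp only [Pi.neg_apply, Pi.mul_apply]; ring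
  · refine (i3.const_mul (κ * n)).congr (Eventually.of_forall fun s => ?_)
    simp only [Pi.mul_apply]; ring

lemma hasSum_gmom (κ y t : ℂ) :
    HasSum (fun n : ℕ => t ^ n / n.factorial * gmom κ y n)
      (Complex.exp (t * y + t ^ 2 * κ ^ 2 / 2)) := by
  have hv : ∫ s : ℝ, Complex.exp (t * (y + κ * s)) * gw1 s =
      Complex.exp (t * y + t ^ 2 * κ ^ 2 / 2) := by
    have h := integral_exp_mul_gw1 (b := 0) (by norm_num) (t * κ) (t * y)
    have e : ∀ s : ℝ, t * (y + κ * s) = 0 * (s : ℂ) ^ 2 + t * κ * s + t * y := fun s => by ring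
    simp_rw [e, h]
    have h2 : (Real.pi / (1 / 2 - 0) : ℂ) = 2 * Real.pi := by ring
    rw [h2, ← mul_assoc, Complex.cpow_neg, inv_mul_cancel₀, one_mul]
    · congr 1; ring
    · rw [Complex.cpow_ne_zero_iff]; left; norm_num [Real.pi_ne_zero]
  rw [← hv]
  have e : ∀ n : ℕ, t ^ n / n.factorial * gmom κ y n =
      ∫ s : ℝ, (t * (y + κ * s)) ^ n / n.factorial * gw1 s := by
    intro n
    rw [gmom, ← integral_const_mul]
    refine integral_congr_ae (Eventually.of_forall fun s => ?_)
    simp only [mul_pow]; ring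
  simp_rw [e]
  refine hasSum_integral_of_dominated_convergence
    (fun n s => (‖t‖ * (‖y‖ + ‖κ‖ * |s|)) ^ n / n.factorial * gw1 s) (fun n => ?_) (fun n => ?_)
    ?_ ?_ ?_
  · have := continuous_gw1
    exact Continuous.aestronglyMeasurable (by fun_prop)
  · refine Eventually.of_forall fun s => ?_
    rw [norm_mul, norm_div, norm_pow, norm_mul, Complex.norm_real,
      Real.norm_of_nonneg (gw1_pos s).le, Complex.norm_natCast]
    have := (gw1_pos s).le
    gcongr
    exact norm_add_mul_le κ y s
  · exact Eventually.of_forall fun s => (Real.summable_pow_div_factorial _).mul_right _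
  · refine (integrable_exp_abs_mul_gw1 (b := 0) (by norm_num) (‖t‖ * ‖κ‖) (‖t‖ * ‖y‖)).congr
      (Eventually.of_forall fun s => ?_)
    simp only
    rw [tsum_mul_right, (NormedSpace.expSeries_div_hasSum_exp (𝔸 := ℝ) _).tsum_eq,
      ← Real.exp_eq_exp_ℝ]
    congr 2
    ring
  · refine Eventually.of_forall fun s => HasSum.mul_right _ ?_
    rw [Complex.exp_eq_exp_ℂ]
    exact NormedSpace.expSeries_div_hasSum_exp _

lemma hermite_eq_gmom (n : ℕ) (y : ℝ) :
    ((Polynomial.aeval y (Polynomial.hermite n) : ℝ) : ℂ) = gmom Complex.I y n := by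
  induction n using Nat.twoStepInduction with
  | zero => simp [gmom_zero]
  | one => rw [gmom_succ]; simp [gmom_zero]
  | more n h1 h2 =>
    rw [gmom_succ, ← h2, Polynomial.hermite_succ, derivative_hermite_succ, Nat.add_sub_cancel, ← h1]
    simp
    ring

/-- Changing κ² = -1 to κ² = 1 and y to |y| makes every term of the recursion nonnegative. This
provides a majorant of He_n(y) with an explicit generating function. -/
lemma norm_gmom_I_le (y : ℝ) (n : ℕ) : ‖gmom Complex.I y n‖ ≤ (gmom 1 (|y| : ℝ) n).re := by
  have hr : ∀ n, (gmom 1 (|y| : ℝ) (n + 1)).re =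
      |y| * (gmom 1 (|y| : ℝ) n).re + n * (gmom 1 (|y| : ℝ) (n - 1)).re := by
    intro n
    rw [gmom_succ, one_pow, one_mul, Complex.add_re, Complex.re_ofReal_mul]
    congr 1
    rw [← Complex.ofReal_natCast, Complex.re_ofReal_mul]
  have hn : ∀ n, ‖gmom Complex.I y (n + 1)‖ ≤
      |y| * ‖gmom Complex.I y n‖ + n * ‖gmom Complex.I y (n - 1)‖ := by
    intro n
    rw [gmom_succ]
    refine (norm_add_le _ _).trans (le_of_eq ?_)
    simp
  induction n using Nat.twoStepInduction with
  | zero => simp [gmom_zero]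
  | one => rw [hr]; refine (hn 0).trans ?_; simp [gmom_zero]
  | more n h1 h2 =>
    rw [hr]
    refine (hn _).trans ?_
    rw [Nat.add_sub_cancel]
    gcongr

lemma hasSum_gmom_one_re (y ρ : ℝ) :
    HasSum (fun n : ℕ => ρ ^ n / n.factorial * (gmom 1 (|y| : ℝ) n).re)
      (Real.exp (ρ * |y| + ρ ^ 2 / 2)) := by
  have h := Complex.reCLM.hasSum (hasSum_gmom 1 (|y| : ℝ) ρ)
  have e1 : Complex.reCLM (Complex.exp (ρ * (|y| : ℝ) + (ρ : ℂ) ^ 2 * 1 ^ 2 / 2)) =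
      Real.exp (ρ * |y| + ρ ^ 2 / 2) := by
    rw [Complex.reCLM_apply, ← Complex.exp_ofReal_re]
    push_cast
    congr 2
    ring
  rw [e1] at h
  have e2 : (fun n : ℕ => ρ ^ n / n.factorial * (gmom 1 (|y| : ℝ) n).re) =
      fun n : ℕ => Complex.reCLM ((ρ : ℂ) ^ n / n.factorial * gmom 1 (|y| : ℝ) n) := by
    ext n
    rw [Complex.reCLM_apply, ← Complex.re_ofReal_mul]
    push_cast
    rfl
  rw [e2]
  exact h

lemma hN_mul_hN (n : ℕ) (x y : ℝ) :
    ((hN n x * hN n y : ℝ) : ℂ) = gmom Complex.I x n * gmom Complex.I y n / n.factorial := by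
  have h : √(n.factorial : ℝ) * √(n.factorial : ℝ) = n.factorial :=
    Real.mul_self_sqrt (by positivity)
  rw [← hermite_eq_gmom, ← hermite_eq_gmom, hN, hN, div_mul_div_comm, h]
  push_cast
  rfl

lemma re_sq_lt_one {r : ℂ} (hr : ‖r‖ < 1) : (r ^ 2).re < 1 := by
  refine (Complex.re_le_norm _).trans_lt ?_
  rw [norm_pow]
  exact pow_lt_one₀ (norm_nonneg _) hr two_ne_zero

/-- Mehler's formula in one variable. Writing He_n(x) = ∫ (x + is)^n dγ(s), the sum over n under the
integral is the generating function of He_n(y), and a Gaussian integral in s remains. -/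
lemma hasSum_hN_mul_hN {r : ℂ} (hr : ‖r‖ < 1) (x y : ℝ) :
    HasSum (fun n : ℕ => r ^ n * (hN n x * hN n y * gw1 y : ℝ))
      ((2 * Real.pi * (1 - r ^ 2)) ^ (-(1 / 2) : ℂ) *
        Complex.exp (-(r * x - y) ^ 2 / (2 * (1 - r ^ 2)))) := by
  have hr2 := re_sq_lt_one hr
  have hre : 0 < (1 - r ^ 2).re := by simp only [Complex.sub_re, Complex.one_re]; linarith
  have hne : (1 - r ^ 2) ≠ 0 := fun h => by rw [h] at hre; simp at hre
  have hb : (r ^ 2 / 2).re < 1 / 2 := by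
    rw [Complex.div_ofNat_re]; linarith
  have hint : HasSum (fun n : ℕ => ∫ s : ℝ, (r * (x + Complex.I * s)) ^ n / n.factorial *
      gmom Complex.I y n * gw1 s)
      (∫ s : ℝ, Complex.exp (r * (x + Complex.I * s) * y +
        (r * (x + Complex.I * s)) ^ 2 * Complex.I ^ 2 / 2) * gw1 s) := by
    refine hasSum_integral_of_dominated_convergence
      (fun n s => (‖r‖ * (|x| + |s|)) ^ n / n.factorial * (gmom 1 (|y| : ℝ) n).re * gw1 s)
      (fun n => ?_) (fun n => ?_) ?_ ?_ ?_
    · have := continuous_gw1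
      exact Continuous.aestronglyMeasurable (by fun_prop)
    · refine Eventually.of_forall fun s => ?_
      have h0 := (gw1_pos s).le
      have h1 := norm_add_mul_le Complex.I x s
      rw [Complex.norm_I, one_mul, Complex.norm_real, Real.norm_eq_abs] at h1
      rw [norm_mul, norm_mul, norm_div, norm_pow, norm_mul, Complex.norm_real (gw1 s),
        Real.norm_of_nonneg h0, Complex.norm_natCast]
      have h2 := norm_gmom_I_le y n
      gcongr
    · exact Eventually.of_forall fun s => (hasSum_gmom_one_re y _).summable.mul_right _
    -- The majorants sum to exp(ρ|y| + ρ²/2) with ρ = |r|(|x| + |s|). Its quadratic coefficient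
    -- |r|²/2 stays below the 1/2 of the Gaussian weight exactly because |r| < 1.
    · have hb' : ‖r‖ ^ 2 / 2 < 1 / 2 := by
        have := pow_lt_one₀ (norm_nonneg r) hr two_ne_zero
        linarith
      refine (integrable_exp_abs_mul_gw1 hb' (‖r‖ * |y| + ‖r‖ ^ 2 * |x|)
        (‖r‖ * |x| * |y| + ‖r‖ ^ 2 * |x| ^ 2 / 2)).congr (Eventually.of_forall fun s => ?_)
      simp only
      rw [tsum_mul_right, (hasSum_gmom_one_re y _).tsum_eq]
      congr 2
      rw [← sq_abs s]
      ring
    · exact Eventually.of_forall fun s => (hasSum_gmom _ _ _).mul_right _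
  have e1 : ∀ n : ℕ, (∫ s : ℝ, (r * (x + Complex.I * s)) ^ n / n.factorial *
      gmom Complex.I y n * gw1 s) * gw1 y = r ^ n * (hN n x * hN n y * gw1 y : ℝ) := by
    intro n
    rw [Complex.ofReal_mul, hN_mul_hN, ← mul_assoc]
    congr 1
    have : ∀ s : ℝ, (r * (x + Complex.I * s)) ^ n / n.factorial * gmom Complex.I y n * gw1 s =
        (r ^ n * gmom Complex.I y n / n.factorial) * ((x + Complex.I * s) ^ n * gw1 s) :=
      fun s => by rw [mul_pow]; ring
    simp_rw [this]
    rw [integral_const_mul, ← gmom]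
    ring
  have e2 : (∫ s : ℝ, Complex.exp (r * (x + Complex.I * s) * y +
        (r * (x + Complex.I * s)) ^ 2 * Complex.I ^ 2 / 2) * gw1 s) * gw1 y =
      (2 * Real.pi * (1 - r ^ 2)) ^ (-(1 / 2) : ℂ) *
        Complex.exp (-(r * x - y) ^ 2 / (2 * (1 - r ^ 2))) := by
    have : ∀ s : ℝ, r * (x + Complex.I * s) * y +
        (r * (x + Complex.I * s)) ^ 2 * Complex.I ^ 2 / 2 = r ^ 2 / 2 * (s : ℂ) ^ 2 +
        Complex.I * (r * y - r ^ 2 * x) * s + (r * x * y - r ^ 2 * x ^ 2 / 2) := fun s => by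
      linear_combination (r ^ 2 * x ^ 2 / 2 + r ^ 2 * x * s * Complex.I +
        r ^ 2 * s ^ 2 * (Complex.I ^ 2 - 1) / 2) * Complex.I_sq
    simp_rw [this]
    rw [integral_exp_mul_gw1 hb, ofReal_gw1]
    have hpi : (0 : ℝ) < 2 * Real.pi := by positivity
    have hcast : (2 * Real.pi : ℂ) = ((2 * Real.pi : ℝ) : ℂ) := by push_cast; rfl
    have c1 : (Real.pi / (1 / 2 - r ^ 2 / 2) : ℂ) = (2 * Real.pi) * (1 - r ^ 2)⁻¹ := by
      field_simp
    -- Positivity of Re(1 - r²) keeps it off the cut, so the principal power of the inverse is the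
    -- inverse of the power.
    have harg : (1 - r ^ 2).arg ≠ Real.pi := fun h => by
      rw [Complex.arg_eq_pi_iff] at h; linarith [h.1]
    have c2 : ((2 * Real.pi : ℂ) * (1 - r ^ 2)⁻¹) ^ (1 / 2 : ℂ) =
        (2 * Real.pi : ℂ) ^ (1 / 2 : ℂ) * (1 - r ^ 2) ^ (-(1 / 2) : ℂ) := by
      rw [hcast, Complex.ofReal_mul_cpow hpi, Complex.inv_cpow _ _ harg, Complex.cpow_neg]
    have c3 : (2 * Real.pi * (1 - r ^ 2) : ℂ) ^ (-(1 / 2) : ℂ) =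
        (2 * Real.pi : ℂ) ^ (-(1 / 2) : ℂ) * (1 - r ^ 2) ^ (-(1 / 2) : ℂ) := by
      rw [hcast, Complex.ofReal_mul_cpow hpi]
    have c4 : (2 * Real.pi : ℂ) ^ (-(1 / 2) : ℂ) * (2 * Real.pi : ℂ) ^ (1 / 2 : ℂ) = 1 := by
      rw [Complex.cpow_neg, inv_mul_cancel₀]
      rw [Complex.cpow_ne_zero_iff]; left; norm_num [Real.pi_ne_zero]
    rw [c1, c2, c3]
    set E : ℂ := r * x * y - r ^ 2 * x ^ 2 / 2 +
        (Complex.I * (r * y - r ^ 2 * x)) ^ 2 / (4 * (1 / 2 - r ^ 2 / 2)) with hE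
    have c5 : E + -(y : ℂ) ^ 2 / 2 = -(r * x - y) ^ 2 / (2 * (1 - r ^ 2)) := by
      rw [hE, mul_pow, Complex.I_sq,
        show (4 * (1 / 2 - r ^ 2 / 2) : ℂ) = 2 * (1 - r ^ 2) by ring]
      field_simp
      ring
    clear_value E
    rw [← c5, Complex.exp_add E]
    linear_combination ((2 * Real.pi : ℂ) ^ (-(1 / 2) : ℂ) * (1 - r ^ 2) ^ (-(1 / 2) : ℂ) *
      Complex.exp E * Complex.exp (-(y : ℂ) ^ 2 / 2)) * c4
  have := hint.mul_right (gw1 y : ℂ)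
  simp_rw [e1] at this
  rwa [e2] at this

end Mehler1D

end

noncomputable section

/-! ### The Mehler formula on `ℝ^N` -/

lemma HasSum.mul_of_summable_norm {R ι κ : Type*} [NormedRing R] [CompleteSpace R]
    {f : ι → R} {g : κ → R} {a b : R} (hf : HasSum f a) (hg : HasSum g b)
    (hf' : Summable fun i => ‖f i‖) (hg' : Summable fun i => ‖g i‖) :
    HasSum (fun p : ι × κ => f p.1 * g p.2) (a * b) :=
  hf.mul hg (summable_mul_of_summable_norm hf' hg')

/-- Induction on n, splitting off the first index by `Fin.consEquiv`; absolute convergence is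
carried along to justify multiplying the series. -/
lemma hasSum_prod_pi {R : Type*} [NormedCommRing R] [CompleteSpace R] {n : ℕ}
    {f : Fin n → ℕ → R} {a : Fin n → R} (hf : ∀ i, HasSum (f i) (a i))
    (hs : ∀ i, Summable fun k => ‖f i k‖) :
    HasSum (fun α : Fin n → ℕ => ∏ i, f i (α i)) (∏ i, a i) ∧
      Summable fun α : Fin n → ℕ => ‖∏ i, f i (α i)‖ := by
  induction n with
  | zero =>
    simp only [Finset.univ_eq_empty, Finset.prod_empty]
    exact ⟨by simp, Summable.of_finite⟩
  | succ n ih =>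
    obtain ⟨h1, h2⟩ := ih (f := fun i => f (Fin.succ i)) (a := fun i => a (Fin.succ i))
      (fun i => hf i.succ) (fun i => hs i.succ)
    have h3 := (hs 0).mul_norm h2
    have h4 := (hf 0).mul_of_summable_norm h1 (hs 0) h2
    let e : ℕ × (Fin n → ℕ) ≃ (Fin (n + 1) → ℕ) := Fin.consEquiv (fun _ => ℕ)
    have he : ∀ p, ∏ i, f i (e p i) = f 0 p.1 * ∏ i : Fin n, f i.succ (p.2 i) := fun p => by
      rw [Fin.prod_univ_succ]; rfl
    refine ⟨?_, ?_⟩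
    · rw [← e.hasSum_iff, Fin.prod_univ_succ]
      exact h4.congr_fun he
    · rw [← e.summable_iff]
      exact h3.congr fun p => by rw [Function.comp_apply, he]

variable {N : ℕ}

/-- The Mehler kernel in terms of `r = e^{-z}`. -/
def mehlerR (r : ℂ) (x y : RN N) : ℂ :=
  (2 * Real.pi * (1 - r ^ 2)) ^ (-(N : ℂ) / 2) *
    Complex.exp (-(∑ i, (r * (x i : ℂ) - (y i : ℂ)) ^ 2) / (2 * (1 - r ^ 2)))

lemma mehler_eq (z : ℂ) (x y : RN N) : mehler z x y = mehlerR (Complex.exp (-z)) x y := by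
  rw [mehler, mehlerR, ← Complex.exp_nat_mul]
  push_cast
  rw [mul_neg, neg_mul]

lemma norm_exp_neg_lt_one {z : ℂ} (hz : 0 < z.re) : ‖Complex.exp (-z)‖ < 1 := by
  rw [Complex.norm_exp, Real.exp_lt_one_iff]; simpa using hz

lemma gw_eq_prod (x : RN N) : gw x = ∏ i, gw1 (x i) := by
  unfold gw gw1
  rw [Finset.prod_mul_distrib, Finset.prod_const, Finset.card_univ, Fintype.card_fin,
    ← Real.exp_sum, EuclideanSpace.real_norm_sq_eq, ← Real.rpow_mul_natCast (by positivity),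
    ← Finset.sum_div, Finset.sum_neg_distrib]
  congr 2
  ring

/-- The product over coordinates of the one-variable formula. The N equal square roots combine as a
natural power, so no branch ambiguity arises. -/
lemma hasSum_mehlerR {r : ℂ} (hr : ‖r‖ < 1) (x y : RN N) :
    HasSum (fun α : Fin N → ℕ => r ^ deg α * (hermR α x * hermR α y * gw y : ℝ))
      (mehlerR r x y) := by
  have h := (hasSum_prod_pi (fun i => hasSum_hN_mul_hN hr (x i) (y i))
    (fun i => (hasSum_hN_mul_hN hr (x i) (y i)).summable.norm)).1
  have e1 : ∀ α : Fin N → ℕ, ∏ i, r ^ α i * (hN (α i) (x i) * hN (α i) (y i) * gw1 (y i) : ℝ) =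
      r ^ deg α * (hermR α x * hermR α y * gw y : ℝ) := by
    intro α
    rw [Finset.prod_mul_distrib, Finset.prod_pow_eq_pow_sum, ← Complex.ofReal_prod,
      Finset.prod_mul_distrib, Finset.prod_mul_distrib, ← gw_eq_prod]
    rfl
  simp_rw [e1] at h
  have e2 : mehlerR r x y = ∏ i, ((2 * Real.pi * (1 - r ^ 2)) ^ (-(1 / 2 : ℂ)) *
      Complex.exp (-(r * (x i : ℂ) - (y i : ℂ)) ^ 2 / (2 * (1 - r ^ 2)))) := by
    rw [Finset.prod_mul_distrib, Finset.prod_const, Finset.card_univ, Fintype.card_fin,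
      ← Complex.exp_sum, ← Complex.cpow_nat_mul, ← Finset.sum_div, Finset.sum_neg_distrib, mehlerR]
    congr 2
    ring
  rw [e2]
  exact h

lemma summable_pow_deg_mul {ρ : ℝ} (hρ0 : 0 ≤ ρ) (hρ : ρ < 1) (x y : RN N) :
    Summable fun α : Fin N → ℕ => ρ ^ deg α * |hermR α x * hermR α y| := by
  have h := (hasSum_mehlerR (r := ρ) (by simpa [abs_of_nonneg hρ0] using hρ) x y).summable.norm
  refine (h.mul_right (gw y)⁻¹).congr fun α => ?_
  rw [norm_mul, norm_pow, Complex.norm_real, Complex.norm_real, Real.norm_of_nonneg hρ0, norm_mul,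
    Real.norm_of_nonneg (gw_pos y).le, mul_assoc, mul_assoc, mul_inv_cancel₀ (gw_pos y).ne', mul_one,
    Real.norm_eq_abs]

/-! ### Bounds for the Mehler kernel up to the imaginary axis and for Hermite functions at a point
-/

lemma re_inv_ge_half {w : ℂ} (h : ‖w - 1‖ ≤ 1) (hw : w ≠ 0) : 1 / 2 ≤ (w⁻¹).re := by
  have h1 : Complex.normSq (w - 1) ≤ 1 := by
    rw [Complex.normSq_eq_norm_sq]
    exact pow_le_one₀ (norm_nonneg _) h
  have h2 : 0 < Complex.normSq w := Complex.normSq_pos.2 hw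
  rw [Complex.inv_re, div_le_div_iff₀ two_pos h2]
  rw [Complex.normSq_apply] at h1 ⊢
  simp at h1
  nlinarith

/-- Partial fractions in r reduce the exponent to nonnegative multiples of 1/(1+r) and 1/(1-r),
entering with a minus sign. For |r| ≤ 1 both 1 ± r lie in the disc |w - 1| ≤ 1, whose nonzero points
inversion maps into Re ≥ 1/2. The bound does not degenerate as |r| → 1. -/
lemma re_mehler_exponent_le {r : ℂ} (hr : ‖r‖ ≤ 1) (hr2 : 1 - r ^ 2 ≠ 0) (x y : ℝ) :
    (-(r * x - y) ^ 2 / (2 * (1 - r ^ 2))).re ≤ (x ^ 2 - y ^ 2) / 4 := by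
  have hp : (1 + r) ≠ 0 := fun h => hr2 (by linear_combination (1 - r) * h)
  have hm : (1 - r) ≠ 0 := fun h => hr2 (by linear_combination (1 + r) * h)
  have h1 := re_inv_ge_half (w := 1 + r) (by simpa using hr) hp
  have h2 := re_inv_ge_half (w := 1 - r) (by simpa using hr) hm
  have e : -(r * x - y) ^ 2 / (2 * (1 - r ^ 2)) =
      ((-y ^ 2 / 2 + (x + y) ^ 2 / 4 + (x - y) ^ 2 / 4 : ℝ) : ℂ) -
      ((((x + y) ^ 2 / 4 : ℝ) : ℂ) * (1 + r)⁻¹ + (((x - y) ^ 2 / 4 : ℝ) : ℂ) * (1 - r)⁻¹) := by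
    rw [show 1 - r ^ 2 = (1 + r) * (1 - r) by ring]
    push_cast
    field_simp
    ring
  rw [e, Complex.sub_re, Complex.add_re, Complex.re_ofReal_mul, Complex.re_ofReal_mul,
    Complex.ofReal_re]
  have h3 := mul_le_mul_of_nonneg_left h1 (show 0 ≤ (x + y) ^ 2 / 4 by positivity)
  have h4 := mul_le_mul_of_nonneg_left h2 (show 0 ≤ (x - y) ^ 2 / 4 by positivity)
  nlinarith

lemma norm_mehlerR_le {r : ℂ} (hr : ‖r‖ ≤ 1) (hr2 : 1 - r ^ 2 ≠ 0) (x y : RN N) :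
    ‖mehlerR r x y‖ ≤ (2 * Real.pi * ‖1 - r ^ 2‖) ^ (-(N : ℝ) / 2) *
      Real.exp ((‖x‖ ^ 2 - ‖y‖ ^ 2) / 4) := by
  rw [mehlerR, norm_mul]
  have e : (-(N : ℂ) / 2) = ((-(N : ℝ) / 2 : ℝ) : ℂ) := by push_cast; rfl
  rw [e, Complex.norm_cpow_real, Complex.norm_exp]
  have e2 : ‖2 * (Real.pi : ℂ) * (1 - r ^ 2)‖ = 2 * Real.pi * ‖1 - r ^ 2‖ := by
    rw [norm_mul, norm_mul, Complex.norm_real, Real.norm_of_nonneg Real.pi_pos.le]; simp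
  rw [e2]
  gcongr
  rw [← Finset.sum_neg_distrib, Finset.sum_div, Complex.re_sum, EuclideanSpace.real_norm_sq_eq,
    EuclideanSpace.real_norm_sq_eq, ← Finset.sum_sub_distrib, Finset.sum_div]
  exact Finset.sum_le_sum fun i _ => re_mehler_exponent_le hr hr2 _ _

/-- On the diagonal and for real r in (0,1), Mehler's series has nonnegative terms, so each term is
at most the kernel, which is bounded by (2π(1-r²))^{-N/2}. Choosing r close to 1 according to |α|
gives polynomial growth. -/
lemma exists_bound_hermR (x : RN N) :
    ∃ C : ℝ, 0 ≤ C ∧ ∀ α : Fin N → ℕ, |hermR α x| ≤ C * ((deg α : ℝ) + 1) ^ N := by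
  refine ⟨√(2 * (gw x)⁻¹), Real.sqrt_nonneg _, fun α => ?_⟩
  have hg := gw_pos x
  set m : ℝ := (deg α : ℝ) + 1 with hm
  have hm1 : 1 ≤ m := by rw [hm]; linarith [(Nat.cast_nonneg (deg α) : (0 : ℝ) ≤ deg α)]
  have hm0 : 0 < m := one_pos.trans_le hm1
  -- With r = 1 - d and d = 1/(2(|α|+1)), Bernoulli's inequality gives r^{|α|} ≥ 1/2, while 1 - r² ≥
  -- d is still of order 1/(|α|+1).
  set d : ℝ := 1 / (2 * m) with hd
  have hd0 : 0 < d := by positivity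
  have hd1 : d ≤ 1 / 2 := by rw [hd, div_le_div_iff₀ (by positivity) two_pos]; linarith
  have hdm : d * m = 1 / 2 := by rw [hd]; field_simp
  have hpow : 1 / 2 ≤ (1 - d) ^ deg α := by
    have := one_add_mul_le_pow (a := -d) (by linarith) (deg α)
    rw [← sub_eq_add_neg] at this
    nlinarith
  have hn : ‖((1 - d : ℝ) : ℂ)‖ < 1 := by
    rw [Complex.norm_real, Real.norm_of_nonneg (by linarith)]; linarith
  have hsq : d ≤ 1 - (1 - d) ^ 2 := by nlinarith
  have hne : (1 : ℂ) - ((1 - d : ℝ) : ℂ) ^ 2 = ((1 - (1 - d) ^ 2 : ℝ) : ℂ) := by push_cast; rfl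
  have h1 := Complex.reCLM.hasSum (hasSum_mehlerR hn x x)
  have e1 : ∀ β : Fin N → ℕ, Complex.reCLM (((1 - d : ℝ) : ℂ) ^ deg β *
      (hermR β x * hermR β x * gw x : ℝ)) = (1 - d) ^ deg β * (hermR β x ^ 2 * gw x) := by
    intro β
    rw [← Complex.ofReal_pow, ← Complex.ofReal_mul, Complex.reCLM_apply, Complex.ofReal_re]
    ring
  have h2 := le_hasSum h1 α fun β _ => by
    rw [e1]
    have : 0 ≤ 1 - d := by linarith
    positivity
  rw [e1] at h2
  have h3 := norm_mehlerR_le hn.le (by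
    rw [hne]; exact Complex.ofReal_ne_zero.2 (by linarith)) x x
  rw [hne, Complex.norm_real, Real.norm_of_nonneg (by linarith), sub_self, zero_div, Real.exp_zero,
    mul_one] at h3
  have h4 : (2 * Real.pi * (1 - (1 - d) ^ 2)) ^ (-(N : ℝ) / 2) ≤ m ^ N := by
    have h5 : m⁻¹ ≤ 2 * Real.pi * (1 - (1 - d) ^ 2) := by
      rw [inv_le_iff_one_le_mul₀ hm0]
      have : 1 / 2 ≤ (1 - (1 - d) ^ 2) * m := by rw [← hdm]; gcongr
      nlinarith [Real.pi_gt_three]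
    calc _ ≤ m⁻¹ ^ (-(N : ℝ) / 2) :=
          Real.rpow_le_rpow_of_nonpos (by positivity) h5 (by
            have : (0 : ℝ) ≤ N := Nat.cast_nonneg N
            linarith)
      _ = m ^ ((N : ℝ) / 2) := by rw [Real.inv_rpow hm0.le, neg_div, Real.rpow_neg hm0.le, inv_inv]
      _ ≤ m ^ (N : ℝ) := Real.rpow_le_rpow_of_exponent_le hm1 (by
            have : (0 : ℝ) ≤ N := Nat.cast_nonneg N
            linarith)
      _ = m ^ N := Real.rpow_natCast _ _
  have h6 : 1 / 2 * (hermR α x ^ 2 * gw x) ≤ m ^ N :=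
    calc _ ≤ (1 - d) ^ deg α * (hermR α x ^ 2 * gw x) := by gcongr
      _ ≤ _ := h2
      _ ≤ _ := (Complex.re_le_norm _).trans (h3.trans h4)
  have h7 : hermR α x ^ 2 ≤ 2 * (gw x)⁻¹ * (m ^ N) ^ 2 := by
    have h8 : m ^ N ≤ (m ^ N) ^ 2 := le_self_pow₀ (one_le_pow₀ hm1) two_ne_zero
    have h9 : hermR α x ^ 2 = (gw x)⁻¹ * (hermR α x ^ 2 * gw x) := by field_simp
    rw [h9, mul_comm 2, mul_assoc]
    exact mul_le_mul_of_nonneg_left (by linarith) (inv_pos.2 hg).le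
  rw [← Real.sqrt_sq (show 0 ≤ m ^ N by positivity), ← Real.sqrt_mul (by positivity)]
  exact Real.abs_le_sqrt h7

/-- Compare with a product of N convergent series ∑ (k+1)^{-2}, using ∏ (α_i+1)² ≤ (|α|+1)^{2N}. -/
lemma summable_inv_deg_pow : Summable fun α : Fin N → ℕ => (((deg α : ℝ) + 1) ^ (2 * N))⁻¹ := by
  have h0 : Summable fun k : ℕ => (((k : ℝ) + 1) ^ 2)⁻¹ := by
    have := (summable_nat_add_iff 1).2 (Real.summable_nat_pow_inv.2 one_lt_two)
    simpa using this
  have h1 := (hasSum_prod_pi (n := N) (fun _ => h0.hasSum) (fun _ => h0.norm)).1.summable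
  refine Summable.of_nonneg_of_le (fun α => by positivity) (fun α => ?_) h1
  rw [Finset.prod_inv_distrib]
  gcongr
  calc ∏ i, ((α i : ℝ) + 1) ^ 2 ≤ ∏ _i : Fin N, ((deg α : ℝ) + 1) ^ 2 := by
        gcongr with i
        exact Finset.single_le_sum (fun _ _ => Nat.zero_le _) (Finset.mem_univ i)
    _ = _ := by rw [Finset.prod_const, Finset.card_univ, Fintype.card_fin, ← pow_mul]

end

noncomputable section

/-! ### Kernels given by Hermite series -/

variable {N : ℕ}

/-- The basis expansion converges in L²_μ, hence almost everywhere along some sequence of finite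
sets; there the limit must be the pointwise sum. -/
lemma ae_eq_tsum_repr (u : L2mu N)
    (hs : ∀ x : RN N, Summable fun α => (hermBasis N).repr u α * herm α x) :
    (u : RN N → ℂ) =ᵐ[gaussMeasure N] fun x => ∑' α, (hermBasis N).repr u α * herm α x := by
  obtain ⟨ns, hns, h⟩ := (tendstoInMeasure_of_tendsto_Lp
    ((hermBasis N).hasSum_repr u)).exists_seq_tendsto_ae'
  have hc : ∀ᵐ x ∂gaussMeasure N, ∀ α, (hermL α : RN N → ℂ) x = herm α x :=
    ae_all_iff.2 fun α => coeFn_hermL α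
  have hsum : ∀ s : Finset (Fin N → ℕ),
      ((∑ α ∈ s, (hermBasis N).repr u α • hermBasis N α : L2mu N) : RN N → ℂ)
        =ᵐ[gaussMeasure N] fun x => ∑ α ∈ s, (hermBasis N).repr u α * (hermL α : RN N → ℂ) x := by
    intro s
    refine (Lp.coeFn_finsetSum _ _).trans ?_
    have h1 : ∀ᵐ x ∂gaussMeasure N, ∀ α,
        (((hermBasis N).repr u α • hermBasis N α : L2mu N) : RN N → ℂ) x =
          (hermBasis N).repr u α * (hermL α : RN N → ℂ) x := by
      refine ae_all_iff.2 fun α => ?_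
      rw [hermBasis_apply]
      exact Lp.coeFn_smul _ _
    filter_upwards [h1] with x hx
    simp [hx]
  filter_upwards [h, hc, ae_all_iff.2 fun n => hsum (ns n)] with x hx hcx hsx
  refine tendsto_nhds_unique hx ?_
  have h2 := (hs x).hasSum.comp hns
  refine h2.congr fun n => ?_
  rw [hsx n, Function.comp_apply]
  exact Finset.sum_congr rfl fun α _ => by rw [hcx]

section Series

variable {w : (Fin N → ℕ) → ℂ}

/-- The kernel `∑ w_α h_α(x) h_α(y) γ(y)`. -/
def serKer (w : (Fin N → ℕ) → ℂ) (x y : RN N) : ℂ :=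
  ∑' α, w α * (hermR α x * hermR α y * gw y : ℝ)

/-- For each fixed x the numbers w_α h_α(x) are square summable, because |w_α|² ≤ |w_α| and the
hypothesis holds with y = x. So the slice y ↦ kernel is γ times an L²_μ function, and Parseval pairs
it with f. This gives absolute convergence for every x, not merely almost every x. -/
lemma hasSum_integral_serKer
    (hw : ∀ x y : RN N, Summable fun α => ‖w α‖ * |hermR α x * hermR α y|) (hw1 : ∀ α, ‖w α‖ ≤ 1)
    (x : RN N) {f : RN N → ℂ} (hf : MemLp f 2 (gaussMeasure N)) :
    (Integrable fun y => serKer w x y * f y) ∧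
      HasSum (fun α => w α * hermR α x * hc f α) (∫ y, serKer w x y * f y) := by
  have hc2 : Summable fun α => ‖w α * hermR α x‖ ^ 2 := by
    refine Summable.of_nonneg_of_le (fun α => by positivity) (fun α => ?_) (hw x x)
    rw [norm_mul, Complex.norm_real, Real.norm_eq_abs, mul_pow, ← sq, sq_abs, abs_sq]
    gcongr
    nlinarith [norm_nonneg (w α), hw1 α]
  obtain ⟨u, hu⟩ := (hermBasis N).exists_repr_eq hc2
  have hs : ∀ y : RN N, Summable fun α => (hermBasis N).repr u α * herm α y := by
    intro y
    refine Summable.of_norm ((hw x y).congr fun α => ?_)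
    rw [hu, norm_mul, norm_mul, herm, Complex.norm_real, Complex.norm_real, abs_mul, mul_assoc]
    rfl
  have hae := ae_eq_tsum_repr u hs
  have hG : ∀ y, serKer w x y = (gw y : ℂ) * ∑' α, (hermBasis N).repr u α * herm α y := by
    intro y
    rw [serKer, ← tsum_mul_left]
    congr 1
    ext α
    rw [hu, herm]
    push_cast
    ring
  have hae' : (fun y => serKer w x y * f y) =ᵐ[volume] fun y => (gw y : ℂ) * (u y * f y) := by
    rw [← ae_gauss]
    filter_upwards [hae] with y hy
    rw [hG, hy, mul_assoc]
  have hint : Integrable (fun y => u y * f y) (gaussMeasure N) := (Lp.memLp u).integrable_mul hf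
  refine ⟨(integrable_congr hae').2 (integrable_gauss_iff.1 hint), ?_⟩
  rw [integral_congr_ae hae', ← integral_gauss]
  have h := hasSum_hc_mul (Lp.memLp u) hf
  simpa only [hc_eq_repr, hu] using h

end Series

/-! ### The heat kernel of the bi-Ornstein-Uhlenbeck operator -/

/-- The weights `e^{-t |α|²}`. -/
def heatW (N : ℕ) (t : ℝ) (α : Fin N → ℕ) : ℝ := Real.exp (-(t * (deg α : ℝ) ^ 2))

/-- The kernel `∑ e^{-t |α|²} h_α(x) h_α(y) γ(y)`. -/
def heatKer (t : ℝ) (x y : RN N) : ℝ := ∑' α, heatW N t α * (hermR α x * hermR α y * gw y)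

lemma ofReal_heatKer (t : ℝ) (x y : RN N) :
    (heatKer t x y : ℂ) = serKer (fun α => (heatW N t α : ℂ)) x y := by
  rw [heatKer, serKer, Complex.ofReal_tsum]
  push_cast
  rfl

lemma heatW_le_one {t : ℝ} (ht : 0 ≤ t) (α : Fin N → ℕ) : heatW N t α ≤ 1 := by
  rw [heatW, Real.exp_le_one_iff]
  have : 0 ≤ t * (deg α : ℝ) ^ 2 := by positivity
  linarith

lemma norm_heatW (t : ℝ) (α : Fin N → ℕ) : ‖(heatW N t α : ℂ)‖ = heatW N t α := by
  rw [Complex.norm_real, heatW, Real.norm_of_nonneg (Real.exp_pos _).le]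

lemma heatW_le_pow {t : ℝ} (ht : 0 ≤ t) (α : Fin N → ℕ) : heatW N t α ≤ Real.exp (-t) ^ deg α := by
  rw [heatW, ← Real.exp_nat_mul, Real.exp_le_exp]
  have h : (deg α : ℝ) ≤ (deg α : ℝ) ^ 2 := by
    exact_mod_cast Nat.le_self_pow two_ne_zero (deg α)
  nlinarith

lemma summable_heatW {t : ℝ} (ht : 0 < t) (x y : RN N) :
    Summable fun α => ‖(heatW N t α : ℂ)‖ * |hermR α x * hermR α y| := by
  refine Summable.of_nonneg_of_le (fun α => by positivity) (fun α => ?_)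
    (summable_pow_deg_mul (Real.exp_pos (-t)).le (Real.exp_lt_one_iff.2 (by linarith)) x y)
  rw [norm_heatW]
  gcongr
  exact heatW_le_pow ht.le α

lemma hasSum_integral_heatKer {t : ℝ} (ht : 0 < t) (x : RN N) {f : RN N → ℂ}
    (hf : MemLp f 2 (gaussMeasure N)) :
    (Integrable fun y => (heatKer t x y : ℂ) * f y) ∧
      HasSum (fun α => heatW N t α * hermR α x * hc f α) (∫ y, (heatKer t x y : ℂ) * f y) := by
  simp_rw [ofReal_heatKer]
  exact hasSum_integral_serKer (summable_heatW ht)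
    (fun α => (norm_heatW t α).trans_le (heatW_le_one ht.le α)) x hf

lemma semigroup_ae_eq {T : ℝ → L2mu N →L[ℂ] L2mu N} (hT : IsGeneratorOf (-(biOU N)) T) {t : ℝ}
    (ht : 0 < t) (f : L2mu N) :
    (T t f : RN N → ℂ) =ᵐ[gaussMeasure N] fun x => ∫ y, (heatKer t x y : ℂ) * f y := by
  have hr : ∀ α, (hermBasis N).repr (T t f) α = heatW N t α * hc f α := fun α => by
    rw [(hermBasis N).repr_semigroup (fun α => (deg α : ℝ) ^ 2) (fun _ => by positivity)
      neg_biOU_iff hT ht, hc_eq_repr, heatW]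
  have h := fun x => (hasSum_integral_heatKer ht x (Lp.memLp f)).2
  have e : ∀ x α, (hermBasis N).repr (T t f) α * herm α x = heatW N t α * hermR α x * hc f α :=
    fun x α => by rw [hr, herm]; ring
  refine (ae_eq_tsum_repr (T t f) fun x => ?_).trans (Eventually.of_forall fun x => ?_)
  · simp_rw [e]; exact (h x).summable
  · simp_rw [e]; exact (h x).tsum_eq

lemma serKer_pow {r : ℂ} (hr : ‖r‖ < 1) (x y : RN N) :
    serKer (fun α => r ^ deg α) x y = mehlerR r x y := (hasSum_mehlerR hr x y).tsum_eq

lemma hasSum_integral_mehlerR {r : ℂ} (hr : ‖r‖ < 1) (x : RN N) {f : RN N → ℂ}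
    (hf : MemLp f 2 (gaussMeasure N)) :
    (Integrable fun y => mehlerR r x y * f y) ∧
      HasSum (fun α => r ^ deg α * hermR α x * hc f α) (∫ y, mehlerR r x y * f y) := by
  simp_rw [← serKer_pow hr]
  refine hasSum_integral_serKer (fun x y => ?_) (fun α => ?_) x hf
  · simp_rw [norm_pow]
    exact summable_pow_deg_mul (norm_nonneg r) hr x y
  · rw [norm_pow]; exact pow_le_one₀ (norm_nonneg r) hr.le

end

noncomputable section

/-! ### Subordination: Gaussian averages over imaginary times -/

section Gaussian

variable {t : ℝ}

lemma integrable_gaussian_time (ht : 0 < t) :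
    Integrable fun s : ℝ => (Real.exp (-s ^ 2 / (4 * t)) : ℂ) := by
  have h := (integrable_exp_neg_mul_sq (b := (4 * t)⁻¹) (by positivity)).ofReal (𝕜 := ℂ)
  refine h.congr (Eventually.of_forall fun s => ?_)
  simp only [div_eq_inv_mul, mul_neg, neg_mul]
  rfl

lemma norm_exp_mul_I_pow (s : ℝ) (n : ℕ) : ‖Complex.exp (s * Complex.I) ^ n‖ = 1 := by
  rw [norm_pow, Complex.norm_exp_ofReal_mul_I, one_pow]

lemma norm_exp_neg_mul_I_pow (s : ℝ) (n : ℕ) : ‖Complex.exp (-(s * Complex.I)) ^ n‖ = 1 := by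
  have := norm_exp_mul_I_pow (-s) n
  rwa [Complex.ofReal_neg, neg_mul] at this

lemma norm_exp_pow_add_le (s : ℝ) (n : ℕ) :
    ‖Complex.exp (-(s * Complex.I)) ^ n + Complex.exp (s * Complex.I) ^ n‖ ≤ 2 := by
  refine (norm_add_le _ _).trans ?_
  rw [norm_exp_mul_I_pow, norm_exp_neg_mul_I_pow]
  norm_num

/-- The two exponentials over the half-line combine to one over the whole line, where the integral
is the Fourier transform of a Gaussian. -/
lemma integral_gaussian_time (ht : 0 < t) (n : ℕ) :
    ∫ s in Ioi (0 : ℝ), (Real.exp (-s ^ 2 / (4 * t)) : ℂ) *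
      (Complex.exp (-(s * Complex.I)) ^ n + Complex.exp (s * Complex.I) ^ n) =
      (√(4 * Real.pi * t) * Real.exp (-(t * (n : ℝ) ^ 2)) : ℝ) := by
  set G : ℝ → ℂ := fun s => (Real.exp (-s ^ 2 / (4 * t)) : ℂ) * Complex.exp (s * Complex.I) ^ n
    with hG
  have hGi : Integrable G := by
    refine (integrable_gaussian_time ht).mul_bdd (c := 1) ?_ ?_
    · exact (by fun_prop : Continuous fun s : ℝ => Complex.exp (s * Complex.I) ^ n)
        |>.aestronglyMeasurable
    · exact Eventually.of_forall fun s => (norm_exp_mul_I_pow s n).le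
  have h1 : ∀ s : ℝ, (Real.exp (-s ^ 2 / (4 * t)) : ℂ) *
      (Complex.exp (-(s * Complex.I)) ^ n + Complex.exp (s * Complex.I) ^ n) = G (-s) + G s := by
    intro s
    simp only [hG]
    rw [neg_sq, Complex.ofReal_neg, neg_mul (s : ℂ)]
    ring
  simp_rw [h1]
  rw [integral_add hGi.comp_neg.integrableOn hGi.integrableOn, integral_comp_neg_Ioi, neg_zero,
    intervalIntegral.integral_Iic_add_Ioi hGi.integrableOn hGi.integrableOn]
  have h2 := fourierIntegral_gaussian (b := ((4 * t)⁻¹ : ℝ)) (by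
    rw [Complex.ofReal_re]; positivity) n
  have h3 : ∀ s : ℝ, G s = Complex.exp (Complex.I * n * s) *
      Complex.exp (-((4 * t)⁻¹ : ℝ) * (s : ℂ) ^ 2) := by
    intro s
    simp only [hG]
    rw [← Complex.exp_nat_mul, mul_comm, Complex.ofReal_exp]
    congr 2
    · ring
    · push_cast; ring
  simp_rw [h3, h2]
  rw [Real.sqrt_eq_rpow, Complex.ofReal_mul, Complex.ofReal_cpow (by positivity),
    Complex.ofReal_exp]
  congr 2
  · push_cast; field_simp
  · push_cast; norm_num
  · push_cast; field_simp

end Gaussian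

variable {N : ℕ}

lemma mehler_add_mehler_hasSum {ε : ℝ} (hε : 0 < ε) (s : ℝ) (x y : RN N) :
    HasSum (fun α : Fin N → ℕ => (Real.exp (-ε) ^ deg α * (hermR α x * hermR α y * gw y) : ℝ) *
      (Complex.exp (-(s * Complex.I)) ^ deg α + Complex.exp (s * Complex.I) ^ deg α))
      (mehler (ε + s * Complex.I) x y + mehler (ε - s * Complex.I) x y) := by
  have h1 := hasSum_mehlerR (norm_exp_neg_lt_one (z := ε + s * Complex.I) (by simpa using hε)) x y
  have h2 := hasSum_mehlerR (norm_exp_neg_lt_one (z := ε - s * Complex.I) (by simpa using hε)) x y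
  rw [mehler_eq, mehler_eq]
  refine (h1.add h2).congr_fun fun α => ?_
  rw [neg_add, neg_sub', sub_neg_eq_add, Complex.exp_add, Complex.exp_add, mul_pow, mul_pow]
  push_cast
  ring

lemma measurable_mehler_time (x y : RN N) : Measurable fun z : ℂ => mehler z x y := by
  unfold mehler
  fun_prop

section Limit

variable {t : ℝ} (x y : RN N)

lemma summable_abs_coeff {ε : ℝ} (hε : 0 < ε) :
    Summable fun α : Fin N → ℕ =>
      ‖((Real.exp (-ε) ^ deg α * (hermR α x * hermR α y * gw y) : ℝ) : ℂ)‖ := by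
  refine ((summable_pow_deg_mul (Real.exp_pos (-ε)).le (Real.exp_lt_one_iff.2 (by linarith)) x
    y).mul_right (gw y)).congr fun α => ?_
  rw [Complex.norm_real, norm_mul, norm_mul _ (gw y), Real.norm_of_nonneg (gw_pos y).le,
    Real.norm_of_nonneg (by positivity), Real.norm_eq_abs, mul_assoc]

lemma integrableOn_mehler_add {ε : ℝ} (ht : 0 < t) (hε : 0 < ε) :
    IntegrableOn (fun s : ℝ => (Real.exp (-s ^ 2 / (4 * t)) : ℂ) *
      (mehler (ε + s * Complex.I) x y + mehler (ε - s * Complex.I) x y)) (Ioi 0) := by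
  refine Integrable.integrableOn ?_
  have hs := summable_abs_coeff x y hε
  refine (integrable_gaussian_time ht).mul_bdd (c := ∑' α : Fin N → ℕ,
    ‖((Real.exp (-ε) ^ deg α * (hermR α x * hermR α y * gw y) : ℝ) : ℂ)‖ * 2) ?_ ?_
  · have hm := measurable_mehler_time x y
    exact ((hm.comp (by fun_prop : Measurable fun s : ℝ => (ε : ℂ) + s * Complex.I)).add
      (hm.comp (by fun_prop : Measurable fun s : ℝ => (ε : ℂ) - s * Complex.I))).aestronglyMeasurable
  · refine Eventually.of_forall fun s => ?_
    rw [← (mehler_add_mehler_hasSum hε s x y).tsum_eq]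
    refine tsum_of_norm_bounded (hs.mul_right 2).hasSum fun α => ?_
    rw [norm_mul]
    gcongr
    exact norm_exp_pow_add_le s _

/-- The factor e^{-ε|α|} makes Mehler's series absolutely summable uniformly in s, so it may be
integrated term by term; each mode then yields e^{-t|α|²}. -/
lemma integral_mehler_add {ε : ℝ} (ht : 0 < t) (hε : 0 < ε) :
    (((4 * Real.pi * t) ^ (-(1 / 2 : ℝ)) : ℝ) : ℂ) *
      ∫ s in Ioi (0 : ℝ), (Real.exp (-s ^ 2 / (4 * t)) : ℂ) *
        (mehler (ε + s * Complex.I) x y + mehler (ε - s * Complex.I) x y) =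
      ∑' α : Fin N → ℕ, ((Real.exp (-ε) ^ deg α *
        (heatW N t α * (hermR α x * hermR α y * gw y)) : ℝ) : ℂ) := by
  set c : (Fin N → ℕ) → ℂ := fun α =>
    ((Real.exp (-ε) ^ deg α * (hermR α x * hermR α y * gw y) : ℝ) : ℂ) with hc
  have hs : Summable fun α => ‖c α‖ := summable_abs_coeff x y hε
  set F : (Fin N → ℕ) → ℝ → ℂ := fun α s => (Real.exp (-s ^ 2 / (4 * t)) : ℂ) * (c α *
      (Complex.exp (-(s * Complex.I)) ^ deg α + Complex.exp (s * Complex.I) ^ deg α)) with hF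
  have hG := (integrable_gaussian_time ht).integrableOn (s := Ioi 0)
  have hFle : ∀ α s, ‖F α s‖ ≤ ‖(Real.exp (-s ^ 2 / (4 * t)) : ℂ)‖ * (‖c α‖ * 2) := by
    intro α s
    simp only [hF]
    rw [norm_mul, norm_mul (c α)]
    gcongr
    exact norm_exp_pow_add_le s _
  have hFi : ∀ α, IntegrableOn (F α) (Ioi 0) := by
    intro α
    refine Integrable.mono' (hG.norm.mul_const (‖c α‖ * 2)) ?_
      (Eventually.of_forall fun s => hFle α s)
    exact (by fun_prop : Continuous (F α)).aestronglyMeasurable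
  have h := hasSum_integral_of_summable_integral_norm hFi (by
    refine Summable.of_nonneg_of_le (fun α => integral_nonneg fun s => norm_nonneg _) (fun α => ?_)
      ((hs.mul_right 2).mul_left (∫ s in Ioi (0 : ℝ), ‖(Real.exp (-s ^ 2 / (4 * t)) : ℂ)‖))
    rw [← integral_mul_const]
    exact integral_mono (hFi α).norm (hG.norm.mul_const _) fun s => hFle α s)
  have e1 : ∀ s : ℝ, ∑' α, F α s = (Real.exp (-s ^ 2 / (4 * t)) : ℂ) *
      (mehler (ε + s * Complex.I) x y + mehler (ε - s * Complex.I) x y) := fun s =>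
    ((mehler_add_mehler_hasSum hε s x y).mul_left _).tsum_eq
  simp_rw [e1] at h
  rw [← h.tsum_eq, ← tsum_mul_left]
  congr 1
  ext α
  have e2 : ∀ s, F α s = c α * ((Real.exp (-s ^ 2 / (4 * t)) : ℂ) *
      (Complex.exp (-(s * Complex.I)) ^ deg α + Complex.exp (s * Complex.I) ^ deg α)) :=
    fun s => by simp only [hF]; ring
  simp_rw [e2]
  rw [integral_const_mul, integral_gaussian_time ht, hc, ← Complex.ofReal_mul, ← Complex.ofReal_mul,
    heatW, Real.sqrt_eq_rpow]
  congr 1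
  have h0 : (4 * Real.pi * t) ^ (-(1 / 2 : ℝ)) * (4 * Real.pi * t) ^ (1 / 2 : ℝ) = 1 := by
    rw [← Real.rpow_add (by positivity)]; simp
  linear_combination (Real.exp (-ε) ^ deg α * (hermR α x * hermR α y * gw y) *
    Real.exp (-(t * (deg α : ℝ) ^ 2))) * h0

/-- Abel limit in the series: the weights e^{-t|α|²} alone are summable against h_α(x)h_α(y) and
dominate all ε > 0. -/
lemma tendsto_integral_mehler_add (ht : 0 < t) :
    Tendsto (fun ε : ℝ => (((4 * Real.pi * t) ^ (-(1 / 2 : ℝ)) : ℝ) : ℂ) *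
        ∫ s in Ioi (0 : ℝ), (Real.exp (-s ^ 2 / (4 * t)) : ℂ) *
          (mehler (ε + s * Complex.I) x y + mehler (ε - s * Complex.I) x y))
      (𝓝[>] 0) (𝓝 (heatKer t x y : ℂ)) := by
  have h : Tendsto (fun ε : ℝ => ∑' α : Fin N → ℕ, ((Real.exp (-ε) ^ deg α *
      (heatW N t α * (hermR α x * hermR α y * gw y)) : ℝ) : ℂ)) (𝓝[>] 0)
      (𝓝 (∑' α : Fin N → ℕ, ((heatW N t α * (hermR α x * hermR α y * gw y) : ℝ) : ℂ))) := by
    refine tendsto_tsum_of_dominated_convergence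
      (bound := fun α => ‖(heatW N t α : ℂ)‖ * |hermR α x * hermR α y| * gw y)
      ((summable_heatW ht x y).mul_right _) (fun α => ?_) ?_
    · have : ContinuousAt (fun ε : ℝ => ((Real.exp (-ε) ^ deg α *
          (heatW N t α * (hermR α x * hermR α y * gw y)) : ℝ) : ℂ)) 0 := by fun_prop
      have h2 := this.tendsto.mono_left (nhdsWithin_le_nhds (s := Ioi 0))
      simpa using h2
    · filter_upwards [self_mem_nhdsWithin] with ε hε α
      rw [Complex.norm_real, norm_mul, norm_mul, norm_mul _ (gw y),
        Real.norm_of_nonneg (gw_pos y).le, Real.norm_of_nonneg (by positivity), Complex.norm_real,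
        Real.norm_eq_abs (_ * _), mul_assoc ‖heatW N t α‖]
      refine mul_le_of_le_one_left
        (mul_nonneg (norm_nonneg _) (mul_nonneg (abs_nonneg _) (gw_pos y).le)) (pow_le_one₀ (Real.exp_pos _).le ?_)
      rw [Real.exp_le_one_iff]
      exact neg_nonpos.2 (le_of_lt hε)
  rw [heatKer, Complex.ofReal_tsum]
  refine h.congr' ?_
  filter_upwards [self_mem_nhdsWithin] with ε hε
  exact (integral_mehler_add x y ht hε).symm

end Limit

end

noncomputable section

/-! ### The Mehler kernel at imaginary times -/

variable {N : ℕ}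

lemma one_sub_exp_neg_two_mul_I (θ : ℝ) :
    1 - Complex.exp (-(θ * Complex.I)) ^ 2 =
      2 * Complex.sin θ * Complex.I * Complex.exp (-(θ * Complex.I)) := by
  have h1 : Complex.exp (-(θ * Complex.I)) = Complex.cos θ - Complex.sin θ * Complex.I := by
    rw [← neg_mul, Complex.exp_mul_I, Complex.cos_neg, Complex.sin_neg, neg_mul, sub_eq_add_neg]
  rw [h1]
  linear_combination (Complex.sin θ) ^ 2 * Complex.I_sq - Complex.sin_sq_add_cos_sq (θ : ℂ)

/-- The representative of the angle `θ` modulo `π` in `[0, π)`. -/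
def redAngle (θ : ℝ) : ℝ := θ - Real.pi * (⌊θ / Real.pi⌋ : ℝ)

lemma redAngle_nonneg (θ : ℝ) : 0 ≤ redAngle θ := by
  have h := Int.floor_le (θ / Real.pi)
  rw [le_div_iff₀ Real.pi_pos] at h
  unfold redAngle
  linarith

lemma redAngle_lt (θ : ℝ) : redAngle θ < Real.pi := by
  have h := Int.lt_floor_add_one (θ / Real.pi)
  rw [div_lt_iff₀ Real.pi_pos] at h
  unfold redAngle
  linarith

lemma abs_sin_redAngle (θ : ℝ) : |Real.sin θ| = Real.sin (redAngle θ) := by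
  rw [← abs_of_nonneg (Real.sin_nonneg_of_nonneg_of_le_pi (redAngle_nonneg θ) (redAngle_lt θ).le),
    redAngle, mul_comm, Real.sin_sub_int_mul_pi, abs_mul, abs_zpow, abs_neg, abs_one, one_zpow,
    one_mul]

lemma exp_redAngle_sq (θ : ℝ) : Complex.exp (-(redAngle θ * Complex.I)) ^ 2 =
    Complex.exp (-(θ * Complex.I)) ^ 2 := by
  rw [← Complex.exp_nat_mul, ← Complex.exp_nat_mul, Complex.exp_eq_exp_iff_exists_int]
  refine ⟨⌊θ / Real.pi⌋, ?_⟩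
  unfold redAngle
  push_cast
  ring

lemma one_sub_exp_polar (θ : ℝ) : 1 - Complex.exp (-(θ * Complex.I)) ^ 2 =
    ((2 * |Real.sin θ| : ℝ) : ℂ) * Complex.exp (((Real.pi / 2 - redAngle θ : ℝ) : ℂ) * Complex.I) := by
  rw [← exp_redAngle_sq, one_sub_exp_neg_two_mul_I, abs_sin_redAngle]
  have : (((Real.pi / 2 - redAngle θ : ℝ) : ℂ) * Complex.I) =
      Real.pi / 2 * Complex.I + -(redAngle θ * Complex.I) := by push_cast; ring
  rw [this, Complex.exp_add, Complex.exp_pi_div_two_mul_I]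
  push_cast
  ring

/-- The angle π/2 - `redAngle θ` lies in (-π/2, π/2], so it is the principal argument of 1 -
e^{-2iθ}. This is why the reduced angle enters the phase of `oscCos`. -/
lemma cpow_one_sub_exp {θ : ℝ} (hθ : Real.sin θ ≠ 0) (a : ℝ) :
    (2 * Real.pi * (1 - Complex.exp (-(θ * Complex.I)) ^ 2)) ^ (a : ℂ) =
      (((4 * Real.pi * |Real.sin θ|) ^ a : ℝ) : ℂ) *
        Complex.exp ((a * (Real.pi / 2 - redAngle θ) : ℝ) * Complex.I) := by
  have h0 : 0 < |Real.sin θ| := abs_pos.2 hθ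
  have hπ := Real.pi_pos
  have h1 := redAngle_nonneg θ
  have h2 := redAngle_lt θ
  have e : 2 * (Real.pi : ℂ) * (1 - Complex.exp (-(θ * Complex.I)) ^ 2) =
      ((4 * Real.pi * |Real.sin θ| : ℝ) : ℂ) *
        Complex.exp (((Real.pi / 2 - redAngle θ : ℝ) : ℂ) * Complex.I) := by
    rw [one_sub_exp_polar]; push_cast; ring
  rw [e, Complex.ofReal_mul_cpow (by positivity), Complex.ofReal_cpow (by positivity),
    Complex.cpow_def_of_ne_zero (Complex.exp_ne_zero _), Complex.log_exp]
  · congr 2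
    push_cast
    ring
  · simp; linarith
  · simp; linarith

/-- With E = e^{-iθ}, the denominator is 4i sin(θ) E. Factoring E out of the numerator leaves E|x|²
- 2x·y + E⁻¹|y|², up to sign; the cosines add and the sines subtract, which separates real and
imaginary parts. -/
lemma mehler_exponent {θ : ℝ} (hθ : Real.sin θ ≠ 0) (x y : RN N) :
    -(∑ i, (Complex.exp (-(θ * Complex.I)) * (x i : ℂ) - (y i : ℂ)) ^ 2) /
      (2 * (1 - Complex.exp (-(θ * Complex.I)) ^ 2)) =
    (((‖x‖ ^ 2 - ‖y‖ ^ 2) / 4 : ℝ) : ℂ) +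
      ((((‖x‖ ^ 2 + ‖y‖ ^ 2) * Real.cos θ - 2 * inner ℝ x y) / (4 * Real.sin θ) : ℝ) : ℂ) *
        Complex.I := by
  set E := Complex.exp (-(θ * Complex.I)) with hE
  have hS : Complex.sin θ ≠ 0 := by
    rw [← Complex.ofReal_sin]; exact Complex.ofReal_ne_zero.2 hθ
  have hE0 : E ≠ 0 := Complex.exp_ne_zero _
  have hEc : E = Complex.cos θ - Complex.sin θ * Complex.I := by
    rw [hE, ← neg_mul, Complex.exp_mul_I, Complex.cos_neg, Complex.sin_neg, neg_mul, sub_eq_add_neg]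
  have h1 : (∑ i, (E * (x i : ℂ) - (y i : ℂ)) ^ 2) =
      E ^ 2 * (‖x‖ ^ 2 : ℝ) - 2 * E * (inner ℝ x y : ℝ) + (‖y‖ ^ 2 : ℝ) := by
    rw [EuclideanSpace.real_norm_sq_eq, EuclideanSpace.real_norm_sq_eq, PiLp.inner_apply]
    push_cast
    rw [Finset.mul_sum, Finset.mul_sum, ← Finset.sum_sub_distrib, ← Finset.sum_add_distrib]
    refine Finset.sum_congr rfl fun i _ => ?_
    simp
    ring
  have h2 := one_sub_exp_neg_two_mul_I θ
  rw [← hE] at h2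
  rw [h1, h2, div_eq_iff (by
    refine mul_ne_zero two_ne_zero (mul_ne_zero (mul_ne_zero (mul_ne_zero two_ne_zero hS)
      Complex.I_ne_zero) hE0))]
  have h3 : Complex.sin (θ : ℂ) ^ 2 + Complex.cos θ ^ 2 = 1 := Complex.sin_sq_add_cos_sq (θ : ℂ)
  push_cast
  have h4 : ((‖x‖ : ℂ) ^ 2 - (‖y‖ : ℂ) ^ 2) / 4 + ((‖x‖ ^ 2 + ‖y‖ ^ 2) * Complex.cos θ -
      2 * (inner ℝ x y : ℝ)) / (4 * Complex.sin θ) * Complex.I =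
      (Complex.sin θ * ((‖x‖ : ℂ) ^ 2 - (‖y‖ : ℂ) ^ 2) + ((‖x‖ ^ 2 + ‖y‖ ^ 2) * Complex.cos θ -
      2 * (inner ℝ x y : ℝ)) * Complex.I) / (4 * Complex.sin θ) := by
    field_simp
  rw [h4, div_mul_eq_mul_div, eq_div_iff (mul_ne_zero (by norm_num) hS)]
  have h5 : E * (Complex.cos θ + Complex.sin θ * Complex.I) = 1 := by
    rw [hEc]; linear_combination h3 - Complex.sin θ ^ 2 * Complex.I_sq
  have hI := Complex.I_sq
  have key : -(E ^ 2 * (‖x‖ : ℂ) ^ 2 - 2 * E * (inner ℝ x y : ℝ) + (‖y‖ : ℂ) ^ 2) =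
      E * Complex.I * (Complex.sin θ * ((‖x‖ : ℂ) ^ 2 - (‖y‖ : ℂ) ^ 2) +
        ((‖x‖ ^ 2 + ‖y‖ ^ 2) * Complex.cos θ - 2 * (inner ℝ x y : ℝ)) * Complex.I) := by
    linear_combination (-E * (‖x‖ : ℂ) ^ 2) * hEc + (‖y‖ : ℂ) ^ 2 * h5 -
      E * ((‖x‖ ^ 2 + ‖y‖ ^ 2) * Complex.cos θ - 2 * (inner ℝ x y : ℝ)) * hI
  rw [key]
  ring

lemma mehler_mul_I {θ : ℝ} (hθ : Real.sin θ ≠ 0) (x y : RN N) :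
    mehler (θ * Complex.I) x y =
      (((4 * Real.pi * |Real.sin θ|) ^ (-(N : ℝ) / 2) * Real.exp ((‖x‖ ^ 2 - ‖y‖ ^ 2) / 4) : ℝ) : ℂ) *
        Complex.exp (((N : ℝ) / 2 * (redAngle θ - Real.pi / 2) +
      ((‖x‖ ^ 2 + ‖y‖ ^ 2) * Real.cos θ - 2 * inner ℝ x y) / (4 * Real.sin θ) : ℝ) * Complex.I) := by
  have e : (-(N : ℂ) / 2) = ((-(N : ℝ) / 2 : ℝ) : ℂ) := by push_cast; rfl
  rw [mehler_eq, mehlerR, mehler_exponent hθ, e, cpow_one_sub_exp hθ,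
    Complex.exp_add (((‖x‖ ^ 2 - ‖y‖ ^ 2) / 4 : ℝ) : ℂ), mul_mul_mul_comm, ← Complex.exp_add,
    ← add_mul, ← Complex.ofReal_add, Complex.ofReal_mul _ (Real.exp _), Complex.ofReal_exp]
  congr 4
  ring

/-- Conjugation commutes with the principal power off the cut, and Re(1 - e^{-2iθ}) = 2 sin²θ > 0.
Hence the sum of the two kernels is twice a real part. -/
lemma mehler_conj {θ : ℝ} (hθ : Real.sin θ ≠ 0) (x y : RN N) :
    mehler (-(θ * Complex.I)) x y = starRingEnd ℂ (mehler (θ * Complex.I) x y) := by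
  have h1 : Complex.exp (- -(θ * Complex.I)) = starRingEnd ℂ (Complex.exp (-(θ * Complex.I))) := by
    rw [← Complex.exp_conj]; simp
  have h2 : (2 * (Real.pi : ℂ) * (1 - Complex.exp (-(θ * Complex.I)) ^ 2)).arg ≠ Real.pi := by
    have h3 : 2 * (Real.pi : ℂ) * (1 - Complex.exp (-(θ * Complex.I)) ^ 2) =
        ((4 * Real.pi * Real.sin θ ^ 2 : ℝ) : ℂ) +
          ((4 * Real.pi * Real.sin θ * Real.cos θ : ℝ) : ℂ) * Complex.I := by
      rw [one_sub_exp_neg_two_mul_I, ← neg_mul, Complex.exp_mul_I, Complex.cos_neg, Complex.sin_neg]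
      push_cast
      linear_combination (-4 * Real.pi * Complex.sin θ ^ 2) * Complex.I_sq
    have h4 : 0 < Real.sin θ ^ 2 := by positivity
    refine (Complex.mem_slitPlane_iff_arg.1 (Complex.mem_slitPlane_iff.2 (Or.inl ?_))).1
    rw [h3, Complex.add_re, Complex.ofReal_re, Complex.re_ofReal_mul, Complex.I_re, mul_zero,
      add_zero]
    have := Real.pi_pos
    positivity
  rw [mehler_eq, mehler_eq, mehlerR, mehlerR, h1]
  generalize Complex.exp (-(θ * Complex.I)) = E at h2
  have h6 : starRingEnd ℂ 2 = 2 := map_ofNat _ 2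
  have h5 : 2 * (Real.pi : ℂ) * (1 - starRingEnd ℂ E ^ 2) =
      starRingEnd ℂ (2 * Real.pi * (1 - E ^ 2)) := by simp [h6]
  rw [map_mul, ← Complex.exp_conj, h5, Complex.conj_cpow _ _ h2]
  simp [h6]

lemma mehler_add_mehler_eq {θ : ℝ} (hθ : Real.sin θ ≠ 0) (x y : RN N) :
    mehler (θ * Complex.I) x y + mehler (-(θ * Complex.I)) x y =
      ((2 * (4 * Real.pi) ^ (-(N : ℝ) / 2) * oscCos θ x y : ℝ) : ℂ) := by
  have hπ := Real.pi_pos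
  rw [mehler_conj hθ, Complex.add_conj, mehler_mul_I hθ, Complex.re_ofReal_mul,
    Complex.exp_ofReal_mul_I_re, Real.mul_rpow (by positivity) (abs_nonneg _), oscCos]
  congr 1
  unfold redAngle
  ring

end

noncomputable section

/-! ### Approach to the imaginary axis -/

/-- Moving radially into the disc at most halves the distance to 1, since |1 - ρw| ≥ 1 - ρ. Singular
bounds on the unit circle therefore hold uniformly along the approach. -/
lemma norm_one_sub_le {w : ℂ} (hw : ‖w‖ = 1) {ρ : ℝ} (h0 : 0 ≤ ρ) (h1 : ρ ≤ 1) :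
    ‖1 - w‖ ≤ 2 * ‖1 - ρ * w‖ := by
  have e : 1 - w = (1 - ρ * w) - ((1 - ρ : ℝ) : ℂ) * w := by push_cast; ring
  have hρ : ‖((1 - ρ : ℝ) : ℂ) * w‖ = 1 - ρ := by
    rw [norm_mul, hw, mul_one, Complex.norm_real, Real.norm_of_nonneg (by linarith)]
  have h2 : 1 - ρ ≤ ‖1 - ρ * w‖ := by
    have := norm_sub_norm_le (1 : ℂ) (ρ * w)
    rwa [norm_mul, hw, norm_one, mul_one, Complex.norm_real, Real.norm_of_nonneg h0] at this
  calc ‖1 - w‖ ≤ ‖1 - ρ * w‖ + ‖((1 - ρ : ℝ) : ℂ) * w‖ := by rw [e]; exact norm_sub_le _ _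
    _ ≤ _ := by rw [hρ]; linarith

variable {N : ℕ}

section Axis

variable {r : ℂ}

lemma norm_mehlerR_mul_le (hr : ‖r‖ = 1) (hr2 : r ^ 2 ≠ 1) {ρ : ℝ} (h0 : 0 ≤ ρ) (h1 : ρ ≤ 1)
    (x y : RN N) :
    ‖mehlerR (ρ * r) x y‖ ≤ (Real.pi * ‖1 - r ^ 2‖) ^ (-(N : ℝ) / 2) *
      Real.exp ((‖x‖ ^ 2 - ‖y‖ ^ 2) / 4) := by
  have hw : ‖r ^ 2‖ = 1 := by rw [norm_pow, hr, one_pow]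
  have hpos : 0 < ‖1 - r ^ 2‖ := norm_pos_iff.2 (sub_ne_zero.2 (Ne.symm hr2))
  have h2 := norm_one_sub_le hw (ρ := ρ ^ 2) (by positivity) (pow_le_one₀ h0 h1)
  have e : 1 - (ρ * r) ^ 2 = 1 - ((ρ ^ 2 : ℝ) : ℂ) * r ^ 2 := by push_cast; ring
  have hne : 1 - (ρ * r) ^ 2 ≠ 0 := by
    rw [e, ← norm_pos_iff]; linarith
  have hn : ‖(ρ : ℂ) * r‖ ≤ 1 := by
    rw [norm_mul, hr, mul_one, Complex.norm_real, Real.norm_of_nonneg h0]; exact h1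
  refine (norm_mehlerR_le hn hne x y).trans ?_
  refine mul_le_mul_of_nonneg_right ?_ (Real.exp_pos _).le
  have hπ := Real.pi_pos
  refine Real.rpow_le_rpow_of_nonpos (by positivity) ?_ ?_
  · rw [e]; nlinarith
  · have : (0 : ℝ) ≤ N := Nat.cast_nonneg N
    linarith

lemma re_one_sub_sq_pos (hr : ‖r‖ = 1) (hr2 : r ^ 2 ≠ 1) : 0 < (1 - r ^ 2).re := by
  have hw : ‖r ^ 2‖ = 1 := by rw [norm_pow, hr, one_pow]
  have h1 : (r ^ 2).re ≤ 1 := (Complex.re_le_norm _).trans hw.le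
  rw [Complex.sub_re, Complex.one_re, sub_pos]
  refine lt_of_le_of_ne h1 fun h => hr2 ?_
  have h2 := Complex.sq_norm (r ^ 2)
  rw [hw, Complex.normSq_apply, h] at h2
  have h3 : (r ^ 2).im = 0 := by nlinarith
  exact Complex.ext h h3

lemma continuousAt_mehlerR (hr : ‖r‖ = 1) (hr2 : r ^ 2 ≠ 1) (x y : RN N) :
    ContinuousAt (fun q : ℂ => mehlerR q x y) r := by
  have hre := re_one_sub_sq_pos hr hr2
  have hne : (2 : ℂ) * (1 - r ^ 2) ≠ 0 := mul_ne_zero two_ne_zero fun h => by simp [h] at hre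
  unfold mehlerR
  refine ContinuousAt.mul ?_ ?_
  · refine ContinuousAt.cpow (by fun_prop) continuousAt_const (Or.inl ?_)
    rw [← Complex.ofReal_ofNat, ← Complex.ofReal_mul, Complex.re_ofReal_mul]
    exact mul_pos Real.two_pi_pos hre
  · refine Complex.continuous_exp.continuousAt.comp ?_
    exact ContinuousAt.div (by fun_prop) (by fun_prop) hne

lemma tendsto_exp_neg_mul (r : ℂ) :
    Tendsto (fun ε : ℝ => ((Real.exp (-ε) : ℝ) : ℂ) * r) (𝓝[>] 0) (𝓝 r) := by
  have h : Continuous fun ε : ℝ => ((Real.exp (-ε) : ℝ) : ℂ) * r := by fun_prop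
  have h2 := (h.tendsto 0).mono_left (nhdsWithin_le_nhds (s := Ioi 0))
  simpa using h2

lemma tendsto_mehlerR (hr : ‖r‖ = 1) (hr2 : r ^ 2 ≠ 1) (x y : RN N) :
    Tendsto (fun ε : ℝ => mehlerR (((Real.exp (-ε) : ℝ) : ℂ) * r) x y) (𝓝[>] 0)
      (𝓝 (mehlerR r x y)) :=
  (continuousAt_mehlerR hr hr2 x y).tendsto.comp (tendsto_exp_neg_mul r)

lemma continuous_mehlerR_right (r : ℂ) (x : RN N) : Continuous fun y => mehlerR r x y := by
  unfold mehlerR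
  have : Continuous fun y : RN N => ∑ i, (r * (x i : ℂ) - (y i : ℂ)) ^ 2 := by fun_prop
  fun_prop

lemma norm_mehlerR_mul_test_le (hr : ‖r‖ = 1) (hr2 : r ^ 2 ≠ 1) {ρ : ℝ} (h0 : 0 ≤ ρ) (h1 : ρ ≤ 1)
    (x y : RN N) (φ : RN N → ℂ) :
    ‖mehlerR (ρ * r) x y * φ y‖ ≤
      (Real.pi * ‖1 - r ^ 2‖) ^ (-(N : ℝ) / 2) * Real.exp (‖x‖ ^ 2 / 4) * ‖φ y‖ := by
  rw [norm_mul]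
  refine mul_le_mul_of_nonneg_right ((norm_mehlerR_mul_le hr hr2 h0 h1 x y).trans ?_)
    (norm_nonneg _)
  gcongr
  linarith [sq_nonneg ‖y‖]

lemma integrable_mehlerR_mul (hr : ‖r‖ = 1) (hr2 : r ^ 2 ≠ 1) (x : RN N) {φ : RN N → ℂ}
    (hφ : IsTest φ) : Integrable fun y => mehlerR r x y * φ y := by
  have hi : Integrable φ := hφ.1.continuous.integrable_of_hasCompactSupport hφ.2
  refine Integrable.mono' (hi.norm.const_mul
    ((Real.pi * ‖1 - r ^ 2‖) ^ (-(N : ℝ) / 2) * Real.exp (‖x‖ ^ 2 / 4)))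
    ((continuous_mehlerR_right r x).mul hφ.1.continuous).aestronglyMeasurable
    (Eventually.of_forall fun y => ?_)
  have := norm_mehlerR_mul_test_le hr hr2 zero_le_one le_rfl x y φ
  rwa [Complex.ofReal_one, one_mul] at this

lemma tendsto_integral_mehlerR (hr : ‖r‖ = 1) (hr2 : r ^ 2 ≠ 1) (x : RN N) {φ : RN N → ℂ}
    (hφ : IsTest φ) :
    Tendsto (fun ε : ℝ => ∫ y, mehlerR (((Real.exp (-ε) : ℝ) : ℂ) * r) x y * φ y) (𝓝[>] 0)
      (𝓝 (∫ y, mehlerR r x y * φ y)) := by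
  have hi : Integrable φ := hφ.1.continuous.integrable_of_hasCompactSupport hφ.2
  refine tendsto_integral_filter_of_dominated_convergence _
    (Eventually.of_forall fun ε =>
      ((continuous_mehlerR_right _ x).mul hφ.1.continuous).aestronglyMeasurable) ?_
    (hi.norm.const_mul
    ((Real.pi * ‖1 - r ^ 2‖) ^ (-(N : ℝ) / 2) * Real.exp (‖x‖ ^ 2 / 4)))
    (Eventually.of_forall fun y => (tendsto_mehlerR hr hr2 x y).mul_const _)
  filter_upwards [self_mem_nhdsWithin] with ε hε
  exact Eventually.of_forall fun y => norm_mehlerR_mul_test_le hr hr2 (Real.exp_pos _).le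
    (Real.exp_le_one_iff.2 (neg_nonpos.2 (le_of_lt hε))) x y φ

end Axis

/-! ### Decay of the Hermite coefficients of test functions -/

/-- Replacing φ by φ - Lφ, again a test function, multiplies the coefficients by |α| + 1; m
repetitions give decay of order m. -/
lemma exists_bound_hc (m : ℕ) {φ : RN N → ℂ} (hφ : IsTest φ) :
    ∃ C : ℝ, 0 ≤ C ∧ ∀ α, ((deg α : ℝ) + 1) ^ m * ‖hc φ α‖ ≤ C := by
  induction m generalizing φ with
  | zero =>
    have hs := summable_hc_sq (hφ.expBdd.memLp)
    refine ⟨√(∑' α, ‖hc φ α‖ ^ 2), Real.sqrt_nonneg _, fun α => ?_⟩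
    rw [pow_zero, one_mul]
    exact Real.le_sqrt_of_sq_le (hs.le_tsum α fun _ _ => by positivity)
  | succ m ih =>
    obtain ⟨C, hC, h⟩ := ih (hφ.sub hφ.ouExpr)
    refine ⟨C, hC, fun α => ?_⟩
    have e : hc (fun x => φ x - ouExpr φ x) α = ((deg α : ℝ) + 1 : ℝ) * hc φ α := by
      have h1 : hc (fun x => φ x - ouExpr φ x) α = hc φ α - hc (ouExpr φ) α := by
        unfold hc
        simp_rw [mul_sub]
        exact integral_sub ((expBdd_herm α).integrable_mul hφ.expBdd.memLp)
          ((expBdd_herm α).integrable_mul hφ.ouExpr.expBdd.memLp)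
      rw [h1, hc_ouExpr hφ]
      push_cast
      ring
    have h2 := h α
    rw [e, norm_mul, Complex.norm_real, Real.norm_of_nonneg (by positivity)] at h2
    rw [pow_succ, mul_assoc]
    exact h2

lemma summable_hermR_mul_hc (x : RN N) {φ : RN N → ℂ} (hφ : IsTest φ) :
    Summable fun α => ‖(hermR α x : ℂ) * hc φ α‖ := by
  obtain ⟨C, hC, h⟩ := exists_bound_hermR x
  -- Of the order 3N, N compensates the growth of h_α(x) and 2N makes the series over α converge.
  obtain ⟨D, hD, h'⟩ := exists_bound_hc (3 * N) hφ
  refine Summable.of_nonneg_of_le (fun α => norm_nonneg _) (fun α => ?_)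
    ((summable_inv_deg_pow (N := N)).mul_left (C * D))
  rw [norm_mul, Complex.norm_real, Real.norm_eq_abs]
  have h0 : (0 : ℝ) < (deg α : ℝ) + 1 := by positivity
  have h2 : ‖hc φ α‖ ≤ D / ((deg α : ℝ) + 1) ^ (3 * N) := by
    rw [le_div_iff₀ (by positivity), mul_comm]; exact h' α
  calc |hermR α x| * ‖hc φ α‖ ≤ (C * ((deg α : ℝ) + 1) ^ N) * (D / ((deg α : ℝ) + 1) ^ (3 * N)) :=
        mul_le_mul (h α) h2 (norm_nonneg _) (by positivity)
    _ = C * D * (((deg α : ℝ) + 1) ^ (2 * N))⁻¹ := by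
        rw [show 3 * N = N + 2 * N by ring, pow_add]
        field_simp

/-- Let ρ → 1- in the identity at ρr. The series side is dominated by rapid decay of the
coefficients of φ, the integral side by the uniform bound on the kernel. -/
lemma hasSum_integral_mehlerR_test {r : ℂ} (hr : ‖r‖ = 1) (hr2 : r ^ 2 ≠ 1) (x : RN N)
    {φ : RN N → ℂ} (hφ : IsTest φ) :
    HasSum (fun α => r ^ deg α * (hermR α x * hc φ α)) (∫ y, mehlerR r x y * φ y) := by
  have hs := summable_hermR_mul_hc x hφ
  have hn : ∀ α : Fin N → ℕ, ‖r ^ deg α * (hermR α x * hc φ α)‖ = ‖(hermR α x : ℂ) * hc φ α‖ :=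
    fun α => by rw [norm_mul, norm_pow, hr, one_pow, one_mul]
  have h1 : Tendsto (fun ε : ℝ => ∑' α, (((Real.exp (-ε) : ℝ) : ℂ) * r) ^ deg α *
      (hermR α x * hc φ α)) (𝓝[>] 0) (𝓝 (∑' α, r ^ deg α * (hermR α x * hc φ α))) := by
    refine tendsto_tsum_of_dominated_convergence hs
      (fun α => ((tendsto_exp_neg_mul r).pow _).mul_const _) ?_
    filter_upwards [self_mem_nhdsWithin] with ε hε α
    rw [norm_mul]
    refine mul_le_of_le_one_left (norm_nonneg _) ?_
    rw [norm_pow, norm_mul, hr, mul_one, Complex.norm_real, Real.norm_of_nonneg (Real.exp_pos _).le]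
    exact pow_le_one₀ (Real.exp_pos _).le (Real.exp_le_one_iff.2 (neg_nonpos.2 (le_of_lt hε)))
  have h2 : (∫ y, mehlerR r x y * φ y) = ∑' α, r ^ deg α * (hermR α x * hc φ α) := by
    refine tendsto_nhds_unique (tendsto_integral_mehlerR hr hr2 x hφ) (h1.congr' ?_)
    filter_upwards [self_mem_nhdsWithin] with ε hε
    have hlt : ‖((Real.exp (-ε) : ℝ) : ℂ) * r‖ < 1 := by
      rw [norm_mul, hr, mul_one, Complex.norm_real, Real.norm_of_nonneg (Real.exp_pos _).le,
        Real.exp_lt_one_iff]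
      exact neg_lt_zero.2 hε
    simpa only [mul_assoc] using (hasSum_integral_mehlerR hlt x hφ.expBdd.memLp).2.tsum_eq
  rw [h2]
  exact (Summable.of_norm (by simpa only [hn] using hs)).hasSum

end

noncomputable section

/-! ### The formulas tested against `φ` -/

lemma ae_sin_mul_ne_zero {a : ℝ} (ha : a ≠ 0) : ∀ᵐ s : ℝ, Real.sin (s * a) ≠ 0 := by
  have hc : {s : ℝ | Real.sin (s * a) = 0}.Countable := by
    refine (countable_range fun n : ℤ => (n : ℝ) * Real.pi / a).mono fun s hs => ?_
    obtain ⟨n, hn⟩ := Real.sin_eq_zero_iff.1 hs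
    exact ⟨n, by simp only [hn]; field_simp⟩
  exact (measure_eq_zero_iff_ae_notMem.1 (hc.measure_zero volume)).mono fun s hs => hs

lemma ae_sin_ne_zero : ∀ᵐ s : ℝ, Real.sin s ≠ 0 := by
  simpa using ae_sin_mul_ne_zero one_ne_zero

lemma norm_exp_neg_mul_I (θ : ℝ) : ‖Complex.exp (-(θ * Complex.I))‖ = 1 := by
  simpa using norm_exp_neg_mul_I_pow θ 1

lemma norm_exp_neg_neg_mul_I (θ : ℝ) : ‖Complex.exp (- -(θ * Complex.I))‖ = 1 := by
  rw [neg_neg, Complex.norm_exp_ofReal_mul_I]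

lemma norm_one_sub_exp_sq (θ : ℝ) :
    ‖1 - Complex.exp (-(θ * Complex.I)) ^ 2‖ = 2 * |Real.sin θ| := by
  rw [one_sub_exp_polar, norm_mul, Complex.norm_exp_ofReal_mul_I, mul_one, Complex.norm_real,
    Real.norm_of_nonneg (by positivity)]

lemma norm_one_sub_exp_sq' (θ : ℝ) :
    ‖1 - Complex.exp (- -(θ * Complex.I)) ^ 2‖ = 2 * |Real.sin θ| := by
  have h := norm_one_sub_exp_sq (-θ)
  rwa [Real.sin_neg, abs_neg, Complex.ofReal_neg, neg_mul] at h

lemma exp_sq_ne_one {θ : ℝ} (hθ : Real.sin θ ≠ 0) :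
    Complex.exp (-(θ * Complex.I)) ^ 2 ≠ 1 := fun h => by
  have h2 := norm_one_sub_exp_sq θ
  rw [h, sub_self, norm_zero] at h2
  exact hθ (abs_eq_zero.1 (by linarith))

lemma exp_sq_ne_one' {θ : ℝ} (hθ : Real.sin θ ≠ 0) :
    Complex.exp (- -(θ * Complex.I)) ^ 2 ≠ 1 := fun h => by
  have h2 := norm_one_sub_exp_sq' θ
  rw [h, sub_self, norm_zero] at h2
  exact hθ (abs_eq_zero.1 (by linarith))

/-- The substitution s ↦ s√t turns e^{-s²/4t} into e^{-s²/4}, and its Jacobian cancels t^{-1/2}. P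
and Q need only be proportional off the zeros of the sine, which form a null set. -/
lemma integrableOn_and_integral_comp_mul_sqrt {t : ℝ} (ht : 0 < t) {P Q : ℝ → ℂ} {c : ℝ}
    (hc : c ≠ 0) (hPQ : ∀ θ, Real.sin θ ≠ 0 → P θ = c * Q θ)
    (hI : IntegrableOn (fun s : ℝ => (Real.exp (-s ^ 2 / (4 * t)) : ℂ) * P s) (Ioi 0)) :
    IntegrableOn (fun s : ℝ => (Real.exp (-s ^ 2 / 4) : ℂ) * Q (s * √t)) (Ioi 0) ∧
    (((4 * Real.pi * t) ^ (-(1 / 2 : ℝ)) : ℝ) : ℂ) *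
      ∫ s in Ioi (0 : ℝ), (Real.exp (-s ^ 2 / (4 * t)) : ℂ) * P s =
      ((c * (4 * Real.pi) ^ (-(1 / 2 : ℝ)) : ℝ) : ℂ) *
        ∫ s in Ioi (0 : ℝ), (Real.exp (-s ^ 2 / 4) : ℂ) * Q (s * √t) := by
  have hst : 0 < √t := Real.sqrt_pos.2 ht
  have hc' : (c : ℂ) ≠ 0 := Complex.ofReal_ne_zero.2 hc
  set g : ℝ → ℂ := fun s => (Real.exp (-s ^ 2 / (4 * t)) : ℂ) * P s with hg
  have hae : (fun s : ℝ => (c : ℂ)⁻¹ * g (s * √t)) =ᵐ[volume.restrict (Ioi 0)]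
      fun s : ℝ => (Real.exp (-s ^ 2 / 4) : ℂ) * Q (s * √t) := by
    refine ae_restrict_of_ae ?_
    filter_upwards [ae_sin_mul_ne_zero hst.ne'] with s hs
    have e : -(s * √t) ^ 2 / (4 * t) = -s ^ 2 / 4 := by
      rw [mul_pow, Real.sq_sqrt ht.le]; field_simp
    simp only [hg]
    rw [hPQ _ hs, e]
    field_simp
  have hgi : IntegrableOn (fun s => g (s * √t)) (Ioi 0) := by
    rw [integrableOn_Ioi_comp_mul_right_iff g 0 hst, zero_mul]
    exact hI
  refine ⟨(hgi.const_mul _).congr hae, ?_⟩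
  rw [← integral_congr_ae hae, integral_const_mul, integral_comp_mul_right_Ioi g 0 hst, zero_mul,
    Real.mul_rpow (by positivity) ht.le, Complex.real_smul]
  have h1 : t ^ (-(1 / 2 : ℝ)) = (√t)⁻¹ := by rw [Real.rpow_neg ht.le, Real.sqrt_eq_rpow]
  rw [h1]
  push_cast
  field_simp

lemma const_mul_rpow (N : ℕ) : 2 * (4 * Real.pi) ^ (-(N : ℝ) / 2) * (4 * Real.pi) ^ (-(1 / 2 : ℝ)) =
    2 * (4 * Real.pi) ^ (-((N : ℝ) + 1) / 2) := by
  rw [mul_assoc, ← Real.rpow_add (by have := Real.pi_pos; positivity)]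
  congr 2
  ring

variable {N : ℕ}

lemma const_ne_zero (N : ℕ) : 2 * (4 * Real.pi) ^ (-(N : ℝ) / 2) ≠ 0 := by
  have := Real.pi_pos
  positivity

section Tested

variable {t : ℝ} (x : RN N) {φ : RN N → ℂ}

lemma hasSum_integral_mehler_add {θ : ℝ} (hθ : Real.sin θ ≠ 0) (hφ : IsTest φ) :
    HasSum (fun α => (hermR α x * hc φ α) * (Complex.exp (-(θ * Complex.I)) ^ deg α +
        Complex.exp (θ * Complex.I) ^ deg α))
      (∫ y, (mehler (θ * Complex.I) x y + mehler (-(θ * Complex.I)) x y) * φ y) := by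
  have hp := norm_exp_neg_mul_I θ
  have hq := norm_exp_neg_neg_mul_I θ
  have hp2 := exp_sq_ne_one hθ
  have hq2 := exp_sq_ne_one' hθ
  simp_rw [mehler_eq, add_mul]
  rw [integral_add (integrable_mehlerR_mul hp hp2 x hφ) (integrable_mehlerR_mul hq hq2 x hφ)]
  refine ((hasSum_integral_mehlerR_test hp hp2 x hφ).add
    (hasSum_integral_mehlerR_test hq hq2 x hφ)).congr_fun fun α => ?_
  rw [neg_neg]
  ring

/-- The interchange of sum and integral is now done directly at ε = 0: summability comes from the
coefficients of φ instead of from damping. -/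
lemma tested_formula (ht : 0 < t) (hφ : IsTest φ) :
    IntegrableOn (fun s : ℝ => (Real.exp (-s ^ 2 / (4 * t)) : ℂ) *
      ∫ y, (mehler (s * Complex.I) x y + mehler (-(s * Complex.I)) x y) * φ y) (Ioi 0) ∧
    ∫ y, (heatKer t x y : ℂ) * φ y = (((4 * Real.pi * t) ^ (-(1 / 2 : ℝ)) : ℝ) : ℂ) *
      ∫ s in Ioi (0 : ℝ), (Real.exp (-s ^ 2 / (4 * t)) : ℂ) *
        ∫ y, (mehler (s * Complex.I) x y + mehler (-(s * Complex.I)) x y) * φ y := by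
  set c : (Fin N → ℕ) → ℂ := fun α => hermR α x * hc φ α with hcdef
  have hs : Summable fun α => ‖c α‖ := summable_hermR_mul_hc x hφ
  set F : (Fin N → ℕ) → ℝ → ℂ := fun α s => (Real.exp (-s ^ 2 / (4 * t)) : ℂ) * (c α *
      (Complex.exp (-(s * Complex.I)) ^ deg α + Complex.exp (s * Complex.I) ^ deg α)) with hF
  have hG := (integrable_gaussian_time ht).integrableOn (s := Ioi 0)
  have hFle : ∀ α s, ‖F α s‖ ≤ ‖(Real.exp (-s ^ 2 / (4 * t)) : ℂ)‖ * (‖c α‖ * 2) := by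
    intro α s
    simp only [hF]
    rw [norm_mul, norm_mul (c α)]
    gcongr
    exact norm_exp_pow_add_le s _
  have hFc : ∀ α, Continuous (F α) := fun α => by fun_prop
  have hFi : ∀ α, IntegrableOn (F α) (Ioi 0) := fun α =>
    Integrable.mono' (hG.norm.mul_const (‖c α‖ * 2)) (hFc α).aestronglyMeasurable
      (Eventually.of_forall fun s => hFle α s)
  have h := hasSum_integral_of_summable_integral_norm hFi (by
    refine Summable.of_nonneg_of_le (fun α => integral_nonneg fun s => norm_nonneg _) (fun α => ?_)
      ((hs.mul_right 2).mul_left (∫ s in Ioi (0 : ℝ), ‖(Real.exp (-s ^ 2 / (4 * t)) : ℂ)‖))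
    rw [← integral_mul_const]
    exact integral_mono (hFi α).norm (hG.norm.mul_const _) fun s => hFle α s)
  have hae : (fun s => ∑' α, F α s) =ᵐ[volume.restrict (Ioi 0)] fun s : ℝ =>
      (Real.exp (-s ^ 2 / (4 * t)) : ℂ) *
      ∫ y, (mehler (s * Complex.I) x y + mehler (-(s * Complex.I)) x y) * φ y := by
    refine ae_restrict_of_ae ?_
    filter_upwards [ae_sin_ne_zero] with s hsin
    exact ((hasSum_integral_mehler_add x hsin hφ).mul_left _).tsum_eq
  -- Measurability in s of the inner integral is inherited from this continuous series, with which
  -- it agrees almost everywhere.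
  have hcont : Continuous fun s => ∑' α, F α s := by
    refine continuous_tsum hFc (hs.mul_right 2) fun α s => (hFle α s).trans ?_
    refine mul_le_of_le_one_left (by positivity) ?_
    rw [Complex.norm_real, Real.norm_of_nonneg (Real.exp_pos _).le, Real.exp_le_one_iff, neg_div,
      neg_nonpos]
    positivity
  have hSint : IntegrableOn (fun s => ∑' α, F α s) (Ioi 0) := by
    refine Integrable.mono' (hG.norm.mul_const (∑' α, ‖c α‖ * 2)) hcont.aestronglyMeasurable
      (Eventually.of_forall fun s => ?_)
    rw [← tsum_mul_left]
    exact tsum_of_norm_bounded ((hs.mul_right 2).mul_left _).hasSum fun α => hFle α s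
  refine ⟨hSint.congr hae, ?_⟩
  rw [← integral_congr_ae hae, ← h.tsum_eq, ← tsum_mul_left,
    ← (hasSum_integral_heatKer ht x hφ.expBdd.memLp).2.tsum_eq]
  congr 1
  ext α
  have e2 : ∀ s, F α s = c α * ((Real.exp (-s ^ 2 / (4 * t)) : ℂ) *
      (Complex.exp (-(s * Complex.I)) ^ deg α + Complex.exp (s * Complex.I) ^ deg α)) :=
    fun s => by simp only [hF]; ring
  simp_rw [e2]
  rw [integral_const_mul, integral_gaussian_time ht, hcdef, heatW, Real.sqrt_eq_rpow]
  have h0 : (((4 * Real.pi * t) ^ (-(1 / 2 : ℝ)) : ℝ) : ℂ) *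
      (((4 * Real.pi * t) ^ (1 / 2 : ℝ) : ℝ) : ℂ) = 1 := by
    rw [← Complex.ofReal_mul, ← Real.rpow_add (by have := Real.pi_pos; positivity)]; simp
  rw [Complex.ofReal_mul]
  linear_combination (-(hermR α x * hc φ α * (Real.exp (-(t * (deg α : ℝ) ^ 2)) : ℝ)) : ℂ) * h0

lemma tested_formula_oscCos (ht : 0 < t) (hφ : IsTest φ) :
    IntegrableOn (fun s : ℝ => (Real.exp (-s ^ 2 / 4) : ℂ) *
      ∫ y, (oscCos (s * √t) x y : ℂ) * φ y) (Ioi 0) ∧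
    ∫ y, (heatKer t x y : ℂ) * φ y = ((2 * (4 * Real.pi) ^ (-((N : ℝ) + 1) / 2) : ℝ) : ℂ) *
      ∫ s in Ioi (0 : ℝ), (Real.exp (-s ^ 2 / 4) : ℂ) *
        ∫ y, (oscCos (s * √t) x y : ℂ) * φ y := by
  obtain ⟨h1, h2⟩ := tested_formula x ht hφ
  obtain ⟨h3, h4⟩ := integrableOn_and_integral_comp_mul_sqrt ht (const_ne_zero N)
    (P := fun s => ∫ y, (mehler (s * Complex.I) x y + mehler (-(s * Complex.I)) x y) * φ y)
    (Q := fun s => ∫ y, (oscCos s x y : ℂ) * φ y) (fun θ hθ => by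
      simp_rw [mehler_add_mehler_eq hθ]
      rw [← integral_const_mul]
      congr 1
      ext y
      push_cast
      ring) h1
  refine ⟨h3, ?_⟩
  rw [h2, h4, const_mul_rpow]

end Tested

end

noncomputable section

/-! ### Absolute convergence in dimension one -/

/-- Jordan's inequality sin s ≥ 2s/π reduces this to integrability of s^{-1/2} at 0. -/
lemma intervalIntegrable_abs_sin_rpow_half :
    IntervalIntegrable (fun s => |Real.sin s| ^ (-(1 / 2 : ℝ))) volume 0 (Real.pi / 2) := by
  have hπ := Real.pi_pos
  have h := (intervalIntegral.intervalIntegrable_rpow' (a := 0) (b := Real.pi / 2)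
    (r := -(1 / 2 : ℝ)) (by norm_num)).const_mul ((2 / Real.pi) ^ (-(1 / 2 : ℝ)))
  refine h.mono_fun' (by fun_prop : Measurable fun s =>
    |Real.sin s| ^ (-(1 / 2 : ℝ))).aestronglyMeasurable ?_
  rw [uIoc_of_le (by positivity)]
  refine (ae_restrict_iff' measurableSet_Ioc).2 (Eventually.of_forall fun s hs => ?_)
  have h1 := Real.mul_le_sin hs.1.le hs.2
  have h2 : 0 < 2 / Real.pi * s := mul_pos (by positivity) hs.1
  simp only
  rw [Real.norm_of_nonneg (by positivity), ← Real.mul_rpow (by positivity) hs.1.le,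
    abs_of_pos (h2.trans_le h1)]
  exact Real.rpow_le_rpow_of_nonpos h2 h1 (by norm_num)

lemma intervalIntegrable_abs_sin_rpow :
    IntervalIntegrable (fun s => |Real.sin s| ^ (-(1 / 2 : ℝ))) volume 0 Real.pi := by
  have h := intervalIntegrable_abs_sin_rpow_half
  have h2 := h.comp_sub_left Real.pi
  simp only [Real.sin_pi_sub, sub_zero, sub_half] at h2
  exact h.trans h2.symm

lemma periodic_abs_sin_rpow :
    Function.Periodic (fun s => |Real.sin s| ^ (-(1 / 2 : ℝ))) Real.pi := fun s => by
  simp only [Real.sin_add_pi, abs_neg]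

/-- Over the n-th period the integral is at most e^{-nπ} times the integral over one period, and the
geometric series converges. -/
lemma integrableOn_abs_sin_mul_exp :
    IntegrableOn (fun s => |Real.sin s| ^ (-(1 / 2 : ℝ)) * Real.exp (-s)) (Ioi 0) := by
  have hπ := Real.pi_pos
  set f : ℝ → ℝ := fun s => |Real.sin s| ^ (-(1 / 2 : ℝ)) with hf
  have hf0 : ∀ s, 0 ≤ f s := fun s => by positivity
  have hii : ∀ a b, IntervalIntegrable f volume a b := fun a b =>
    periodic_abs_sin_rpow.intervalIntegrable₀ hπ.ne' intervalIntegrable_abs_sin_rpow a b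
  have hunion : Ioi (0 : ℝ) = ⋃ n : ℕ, Ioc (n * Real.pi) (n * Real.pi + Real.pi) := by
    ext s
    simp only [mem_Ioi, mem_iUnion, mem_Ioc]
    constructor
    · intro hs
      obtain ⟨n, hn⟩ := existsUnique_sub_zsmul_mem_Ioc hπ s 0 |>.exists
      rw [zero_add, zsmul_eq_mul, mem_Ioc] at hn
      have hn0 : 0 ≤ n := by
        by_contra! hlt
        have : (n : ℝ) ≤ -1 := by exact_mod_cast (by omega : n ≤ -1)
        nlinarith
      refine ⟨n.toNat, ?_⟩
      have : ((n.toNat : ℕ) : ℝ) = n := by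
        exact_mod_cast congrArg (Int.cast : ℤ → ℝ) (Int.toNat_of_nonneg hn0)
      rw [this]
      constructor <;> linarith [hn.1, hn.2]
    · rintro ⟨n, hn, -⟩
      exact lt_of_le_of_lt (by positivity) hn
  have hfe : ∀ n : ℕ, IntegrableOn (fun s => f s * Real.exp (-s))
      (Ioc (n * Real.pi) (n * Real.pi + Real.pi)) := fun n => by
    have := (hii (n * Real.pi) (n * Real.pi + Real.pi)).mul_continuousOn
      (g := fun s => Real.exp (-s)) (by fun_prop)
    rwa [intervalIntegrable_iff_integrableOn_Ioc_of_le (by linarith)] at this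
  rw [hunion]
  refine integrableOn_iUnion_of_summable_integral_norm hfe ?_
  have hg : Summable fun n : ℕ => Real.exp (-Real.pi) ^ n * ∫ s in (0 : ℝ)..Real.pi, f s :=
    (summable_geometric_of_lt_one (Real.exp_pos _).le
      (Real.exp_lt_one_iff.2 (by linarith))).mul_right _
  refine Summable.of_nonneg_of_le (fun n => integral_nonneg fun s => norm_nonneg _) (fun n => ?_) hg
  have h1 := periodic_abs_sin_rpow.intervalIntegral_add_eq (n * Real.pi) 0
  rw [zero_add] at h1
  rw [← h1, intervalIntegral.integral_of_le (by linarith), ← integral_const_mul]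
  refine setIntegral_mono_on (hfe n).norm ?_ measurableSet_Ioc fun s hs => ?_
  · have := hii (n * Real.pi) (n * Real.pi + Real.pi)
    rw [intervalIntegrable_iff_integrableOn_Ioc_of_le (by linarith)] at this
    exact this.const_mul _
  · rw [Real.norm_of_nonneg (mul_nonneg (hf0 s) (Real.exp_pos _).le), mul_comm]
    refine mul_le_mul_of_nonneg_right ?_ (hf0 s)
    rw [← Real.exp_nat_mul, Real.exp_le_exp]
    linarith [hs.1]

lemma integrableOn_abs_sin_mul_gaussian {t : ℝ} (ht : 0 < t) :
    IntegrableOn (fun s => Real.exp (-s ^ 2 / (4 * t)) * |Real.sin s| ^ (-(1 / 2 : ℝ))) (Ioi 0) := by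
  refine Integrable.mono' (integrableOn_abs_sin_mul_exp.const_mul (Real.exp t))
    (by fun_prop : Measurable fun s =>
      Real.exp (-s ^ 2 / (4 * t)) * |Real.sin s| ^ (-(1 / 2 : ℝ))).aestronglyMeasurable
    (Eventually.of_forall fun s => ?_)
  rw [Real.norm_of_nonneg (by positivity), mul_left_comm, mul_comm, ← Real.exp_add]
  refine mul_le_mul_of_nonneg_left (Real.exp_le_exp.2 ?_) (by positivity)
  -- From (s - 2t)² ≥ 0 one gets -s²/(4t) ≤ t - s.
  rw [div_le_iff₀ (by positivity)]
  nlinarith [sq_nonneg (s - 2 * t)]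

section One

variable {t : ℝ} (x y : RN 1)

/-- For N = 1 the kernel bound is a multiple of |sin s|^{-1/2}, which is integrable against the
Gaussian and uniform in ε. Dominated convergence then evaluates the limit in
`tendsto_integral_mehler_add` as the integral at ε = 0. -/
lemma pointwise_formula (ht : 0 < t) :
    IntegrableOn (fun s : ℝ => (Real.exp (-s ^ 2 / (4 * t)) : ℂ) *
      (mehler (s * Complex.I) x y + mehler (-(s * Complex.I)) x y)) (Ioi 0) ∧
    (heatKer t x y : ℂ) = (((4 * Real.pi * t) ^ (-(1 / 2 : ℝ)) : ℝ) : ℂ) *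
      ∫ s in Ioi (0 : ℝ), (Real.exp (-s ^ 2 / (4 * t)) : ℂ) *
        (mehler (s * Complex.I) x y + mehler (-(s * Complex.I)) x y) := by
  -- The prefactor arises from π‖1 - r²‖ = 2π|sin s| on the unit circle.
  set K : ℝ := (2 * Real.pi) ^ (-(1 / 2 : ℝ)) * Real.exp ((‖x‖ ^ 2 - ‖y‖ ^ 2) / 4) with hK
  set B : ℝ → ℝ := fun s =>
    (Real.exp (-s ^ 2 / (4 * t)) * |Real.sin s| ^ (-(1 / 2 : ℝ))) * (K * 2) with hB
  have hBi : IntegrableOn B (Ioi 0) := (integrableOn_abs_sin_mul_gaussian ht).mul_const _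
  have hbd : ∀ {r : ℂ} {s ρ : ℝ}, ‖r‖ = 1 → r ^ 2 ≠ 1 → ‖1 - r ^ 2‖ = 2 * |Real.sin s| →
      0 ≤ ρ → ρ ≤ 1 → ‖mehlerR (ρ * r) x y‖ ≤ |Real.sin s| ^ (-(1 / 2 : ℝ)) * K := by
    intro r s ρ hr hr2 hs h0 h1
    refine (norm_mehlerR_mul_le hr hr2 h0 h1 x y).trans_eq ?_
    rw [hs, hK, ← mul_assoc, ← mul_assoc, ← Real.mul_rpow (abs_nonneg _) Real.two_pi_pos.le]
    congr 2
    · ring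
    · norm_num
  have hbd2 : ∀ {s ρ : ℝ}, Real.sin s ≠ 0 → 0 ≤ ρ → ρ ≤ 1 →
      ‖(Real.exp (-s ^ 2 / (4 * t)) : ℂ) * (mehlerR (ρ * Complex.exp (-(s * Complex.I))) x y +
        mehlerR (ρ * Complex.exp (- -(s * Complex.I))) x y)‖ ≤ B s := by
    intro s ρ hs h0 h1
    have e1 := hbd (norm_exp_neg_mul_I s) (exp_sq_ne_one hs) (norm_one_sub_exp_sq s) h0 h1
    have e2 := hbd (norm_exp_neg_neg_mul_I s) (exp_sq_ne_one' hs) (norm_one_sub_exp_sq' s) h0 h1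
    rw [norm_mul, Complex.norm_real, Real.norm_of_nonneg (Real.exp_pos _).le, hB]
    simp only
    rw [mul_assoc]
    refine mul_le_mul_of_nonneg_left ((norm_add_le _ _).trans ?_) (Real.exp_pos _).le
    linarith
  have hm := measurable_mehler_time x y
  have hmeas : ∀ ε : ℝ, Measurable fun s : ℝ => (Real.exp (-s ^ 2 / (4 * t)) : ℂ) *
      (mehler (ε + s * Complex.I) x y + mehler (ε - s * Complex.I) x y) := fun ε => by
    refine Measurable.mul (by fun_prop) ?_
    exact (hm.comp (by fun_prop : Measurable fun s : ℝ => (ε : ℂ) + s * Complex.I)).add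
      (hm.comp (by fun_prop : Measurable fun s : ℝ => (ε : ℂ) - s * Complex.I))
  have he : ∀ ε s : ℝ, mehler (ε + s * Complex.I) x y + mehler (ε - s * Complex.I) x y =
      mehlerR ((Real.exp (-ε) : ℝ) * Complex.exp (-(s * Complex.I))) x y +
        mehlerR ((Real.exp (-ε) : ℝ) * Complex.exp (- -(s * Complex.I))) x y := by
    intro ε s
    rw [mehler_eq, mehler_eq, Complex.ofReal_exp, ← Complex.exp_add, ← Complex.exp_add]
    congr 3 <;> push_cast <;> ring
  have hae := ae_restrict_of_ae (s := Ioi (0 : ℝ)) ae_sin_ne_zero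
  have e0 : ∀ s : ℝ, mehler (s * Complex.I) x y + mehler (-(s * Complex.I)) x y =
      mehlerR (Complex.exp (-(s * Complex.I))) x y +
        mehlerR (Complex.exp (- -(s * Complex.I))) x y := fun s => by
    rw [mehler_eq, mehler_eq]
  constructor
  · refine Integrable.mono' hBi ?_ ?_
    · have := hmeas 0
      simp only [Complex.ofReal_zero, zero_add, zero_sub] at this
      exact this.aestronglyMeasurable
    · filter_upwards [hae] with s hs
      have := hbd2 hs zero_le_one le_rfl
      rwa [Complex.ofReal_one, one_mul, one_mul, ← e0] at this
  · refine tendsto_nhds_unique (tendsto_integral_mehler_add x y ht) (Tendsto.const_mul _ ?_)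
    refine tendsto_integral_filter_of_dominated_convergence B
      (Eventually.of_forall fun ε => (hmeas ε).aestronglyMeasurable) ?_ hBi ?_
    · filter_upwards [self_mem_nhdsWithin] with ε hε
      filter_upwards [hae] with s hs
      rw [he]
      exact hbd2 hs (Real.exp_pos _).le (Real.exp_le_one_iff.2 (neg_nonpos.2 (le_of_lt hε)))
    · filter_upwards [hae] with s hs
      simp_rw [he, e0]
      exact ((tendsto_mehlerR (norm_exp_neg_mul_I s) (exp_sq_ne_one hs) x y).add
        (tendsto_mehlerR (norm_exp_neg_neg_mul_I s) (exp_sq_ne_one' hs) x y)).const_mul _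

lemma pointwise_formula_oscCos (ht : 0 < t) :
    IntegrableOn (fun s : ℝ => Real.exp (-s ^ 2 / 4) * oscCos (s * √t) x y) (Ioi 0) ∧
    heatKer t x y = 2 * (4 * Real.pi) ^ (-(((1 : ℕ) : ℝ) + 1) / 2) *
      ∫ s in Ioi (0 : ℝ), Real.exp (-s ^ 2 / 4) * oscCos (s * √t) x y := by
  obtain ⟨h1, h2⟩ := pointwise_formula x y ht
  obtain ⟨h3, h4⟩ := integrableOn_and_integral_comp_mul_sqrt ht (const_ne_zero 1)
    (P := fun s => mehler (s * Complex.I) x y + mehler (-(s * Complex.I)) x y)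
    (Q := fun s => (oscCos s x y : ℂ)) (fun θ hθ => by
      rw [mehler_add_mehler_eq hθ, Complex.ofReal_mul]) h1
  rw [h4, const_mul_rpow] at h2
  simp_rw [← Complex.ofReal_mul] at h2 h3
  rw [integral_complex_ofReal, ← Complex.ofReal_mul] at h2
  refine ⟨?_, Complex.ofReal_injective h2⟩
  exact h3.re

end One

end

/-! ### Assembly of the theorem -/

theorem mainTheorem6 (N : ℕ) (hN : 1 ≤ N) :
    -- the domain and the explicit expression of `A`
    (∀ u : L2mu N, u ∈ (biOU N).domain ↔ MemSobolev 4 (u : RN N → ℂ)) ∧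
    (∀ u : (biOU N).domain,
      (biOU N u : RN N → ℂ) =ᵐ[gaussMeasure N] biOUExpr ((u : L2mu N) : RN N → ℂ)) ∧
    -- `-A` generates a semigroup
    (∃ T : ℝ → L2mu N →L[ℂ] L2mu N, IsGeneratorOf (-(biOU N)) T) ∧
    ∃ k : ℝ → RN N → RN N → ℝ,
      -- `k` is the kernel of the semigroup generated by `-A`
      (∀ T : ℝ → L2mu N →L[ℂ] L2mu N, IsGeneratorOf (-(biOU N)) T →
        ∀ t : ℝ, 0 < t → ∀ f : L2mu N,
          (∀ x : RN N, Integrable fun y => (k t x y : ℂ) * f y) ∧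
          (T t f : RN N → ℂ) =ᵐ[gaussMeasure N] fun x => ∫ y, (k t x y : ℂ) * f y) ∧
      -- `k` as the oscillatory integral of the Mehler kernel over imaginary times, pointwise
      (∀ t : ℝ, 0 < t → ∀ x y : RN N,
        (∀ ε : ℝ, 0 < ε → IntegrableOn (fun s : ℝ => (Real.exp (-s ^ 2 / (4 * t)) : ℂ) *
          (mehler (ε + s * Complex.I) x y + mehler (ε - s * Complex.I) x y)) (Ioi 0)) ∧
        Tendsto (fun ε : ℝ => (((4 * Real.pi * t) ^ (-(1 / 2 : ℝ)) : ℝ) : ℂ) *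
            ∫ s in Ioi (0 : ℝ), (Real.exp (-s ^ 2 / (4 * t)) : ℂ) *
              (mehler (ε + s * Complex.I) x y + mehler (ε - s * Complex.I) x y))
          (𝓝[>] 0) (𝓝 (k t x y : ℂ))) ∧
      -- the explicit form of the integrand
      (∀ θ : ℝ, Real.sin θ ≠ 0 → ∀ x y : RN N,
        mehler (θ * Complex.I) x y + mehler (-(θ * Complex.I)) x y =
          ((2 * (4 * Real.pi) ^ (-(N : ℝ) / 2) * oscCos θ x y : ℝ) : ℂ)) ∧
      -- both integral formulas at `ε = 0`, tested against `φ ∈ C_c^∞` in `y`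
      (∀ t : ℝ, 0 < t → ∀ x : RN N, ∀ φ : RN N → ℂ, IsTest φ →
        (IntegrableOn (fun s : ℝ => (Real.exp (-s ^ 2 / (4 * t)) : ℂ) *
          ∫ y, (mehler (s * Complex.I) x y + mehler (-(s * Complex.I)) x y) * φ y) (Ioi 0) ∧
        ∫ y, (k t x y : ℂ) * φ y = (((4 * Real.pi * t) ^ (-(1 / 2 : ℝ)) : ℝ) : ℂ) *
          ∫ s in Ioi (0 : ℝ), (Real.exp (-s ^ 2 / (4 * t)) : ℂ) *
            ∫ y, (mehler (s * Complex.I) x y + mehler (-(s * Complex.I)) x y) * φ y) ∧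
        (IntegrableOn (fun s : ℝ => (Real.exp (-s ^ 2 / 4) : ℂ) *
          ∫ y, (oscCos (s * √t) x y : ℂ) * φ y) (Ioi 0) ∧
        ∫ y, (k t x y : ℂ) * φ y = ((2 * (4 * Real.pi) ^ (-((N : ℝ) + 1) / 2) : ℝ) : ℂ) *
          ∫ s in Ioi (0 : ℝ), (Real.exp (-s ^ 2 / 4) : ℂ) *
            ∫ y, (oscCos (s * √t) x y : ℂ) * φ y)) ∧
      -- for `N = 1` both integrals converge absolutely and the formulas hold pointwise
      (N = 1 → ∀ t : ℝ, 0 < t → ∀ x y : RN N,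
        (IntegrableOn (fun s : ℝ => (Real.exp (-s ^ 2 / (4 * t)) : ℂ) *
          (mehler (s * Complex.I) x y + mehler (-(s * Complex.I)) x y)) (Ioi 0) ∧
        (k t x y : ℂ) = (((4 * Real.pi * t) ^ (-(1 / 2 : ℝ)) : ℝ) : ℂ) *
          ∫ s in Ioi (0 : ℝ), (Real.exp (-s ^ 2 / (4 * t)) : ℂ) *
            (mehler (s * Complex.I) x y + mehler (-(s * Complex.I)) x y)) ∧
        (IntegrableOn (fun s : ℝ => Real.exp (-s ^ 2 / 4) * oscCos (s * √t) x y) (Ioi 0) ∧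
        k t x y = 2 * (4 * Real.pi) ^ (-((N : ℝ) + 1) / 2) *
          ∫ s in Ioi (0 : ℝ), Real.exp (-s ^ 2 / 4) * oscCos (s * √t) x y)) := by
  refine ⟨mem_domain_biOU_iff, biOU_apply_ae_eq,
    ⟨_, (hermBasis N).isGeneratorOf_diagSemigroup (fun α => (deg α : ℝ) ^ 2)
      (fun _ => by positivity) neg_biOU_iff⟩, heatKer, ?_, ?_, ?_, ?_, ?_⟩
  · exact fun T hT t ht f =>
      ⟨fun x => (hasSum_integral_heatKer ht x (Lp.memLp f)).1, semigroup_ae_eq hT ht f⟩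
  · exact fun t ht x y => ⟨fun ε hε => integrableOn_mehler_add x y ht hε,
      tendsto_integral_mehler_add x y ht⟩
  · exact fun θ hθ x y => mehler_add_mehler_eq hθ x y
  · exact fun t ht x φ hφ => ⟨tested_formula x ht hφ, tested_formula_oscCos x ht hφ⟩
  · intro h t ht x y
    subst h
    exact ⟨pointwise_formula x y ht, pointwise_formula_oscCos x y ht⟩
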